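/- **Kolmogorov's 4/5, 4/3 and 4/15 laws in the inviscid limit.** Let $d\ge 2$, let $\mathbb T^d=\mathbb R^d/\mathbb Z^d$, and let $u_0\in L^2(\mathbb T^d;\mathbb R^d)$. For each $\nu\in(0,1)$ let $u_\nu$ be a Leray–Hopf solution on $[0,1]\times\mathbb T^d$ of $$\partial_t u_\nu+(u_\nu\cdot\nabla)u_\nu+\nabla p_\nu=\nu\Delta u_\nu+f_\nu,\qquad \operatorname{div}u_\nu=0,\qquad u_\nu|_{t=0}=u_0,$$ that is: $f_\nu\in L^1_tL^2_x$, $u_\nu\in L^\infty_tL^2_x\cap L^2_tH^1_x$ is weakly continuous in time with values in $L^2$, solves the system in the sense of distributions with initial datum $u_0$, and satisfies, for all $t\in[0,1]$, $\frac12\|u_\nu(t)\|_{L^2}^2+\nu\int_0^t\|\nabla u_\nu\|_{L^2}^2\,dr\le\frac12\|u_0\|_{L^2}^2+\int_0^t\langle f_\nu,u_\nu\rangle\,dr$. If $d\ge5$, assume also $u_\nu\in L^3([0,1]\times\mathbb T^d)$ for each $\nu$ (this is automatic if $d\le4$). For $0<\beta<1$ put $$\|v\|_{B^\beta_{2,\infty}}=\|v\|_{L^2}+\sup_{y\ne0}|y|^{-\beta}\|v(\cdot+y)-v\|_{L^2}.$$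 With $\delta u=u_\nu(t,x+\ell y)-u_\nu(t,x)$, $T_I(y)=\mathrm{Id}$, $T_L(y)=\frac{y\otimes y}{|y|^2}$ and $T_T=T_I-T_L$, define for $\ell>0$ $$S^\nu_\bullet(t,\ell)=c_\bullet\int_{\mathbb T^d}\frac1{|\mathbb S^{d-1}|}\int_{\mathbb S^{d-1}}(\delta u\cdot y)\,|T_\bullet(y)\,\delta u|^2\,dy\,dx,\qquad \bullet\in\{I,L,T\},$$ where $c_I=\frac d4$, $c_L=\frac{d(d+2)}{12}$ and $c_T=\frac{d(d+2)}{4(d-1)}$, and $$\varepsilon_\nu(t)=\tfrac12\|u_0\|_{L^2}^2-\tfrac12\|u_\nu(t)\|_{L^2}^2+\int_0^t\langle f_\nu(r),u_\nu(r)\rangle\,dr .$$ Suppose that for some $\alpha\in(0,1)$ one has $\sup_{\nu\in(0,1)}\|u_\nu\|_{L^2_tB^\alpha_{2,\infty}}<\infty$, let $L<\frac1{2(1-\alpha)}$, and set $\ell_D(\nu)=\nu^L$. Then, for each $\bullet\in\{I,L,T\}$: 1. For every $\nu\in(0,1)$ and $\ell>0$, the function $(\delta u\cdot y)|T_\bullet(y)\delta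 u|^2$ is integrable over $(t,x,y)\in[0,1]\times\mathbb T^d\times\mathbb S^{d-1}$. 2. If $\sup_{\nu\in(0,1)}\|f_\nu\|_{L^{1+\sigma}_tL^2_x}<\infty$ for some $\sigma>0$, then for every $p\in[1,\infty)$ $$\lim_{\ell_I\to0}\limsup_{\nu\to0}\sup_{\ell\in[\ell_D(\nu),\ell_I]}\int_0^1\left|\int_0^t\frac{S^\nu_\bullet(r,\ell)}{\ell}\,dr+\varepsilon_\nu(t)\right|^p dt=0 .$$ 3. If $\sup_{\nu\in(0,1)}\|f_\nu\|_{L^1_tL^2_x}<\infty$ and, for some $\bar\alpha\in(0,1)$, $\sup_{\nu\in(0,1)}\|u_\nu\|_{L^\infty_tB^{\bar\alpha}_{2,\infty}}<\infty$, then $$\lim_{\ell_I\to0}\limsup_{\nu\to0}\sup_{\ell\in[\ell_D(\nu),\ell_I]}\ \sup_{t\in[0,1]}\left|\int_0^t\frac{S^\nu_\bullet(r,\ell)}{\ell}\,dr+\varepsilon_\nu(t)\right|=0 .$$ -/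

import Mathlib

open MeasureTheory Set Filter Topology
open scoped ENNReal NNReal

noncomputable section

namespace NSLaws

/-- Euclidean space `ℝ^d`. -/
abbrev E (d : ℕ) : Type := EuclideanSpace ℝ (Fin d)

/-- The flat torus `𝕋^d = ℝ^d / ℤ^d`, with its translation-invariant measure of total mass one. -/
abbrev Torus (d : ℕ) : Type := UnitAddTorus (Fin d)

/-- The quotient map `ℝ^d → 𝕋^d`. -/
def toTorus {d : ℕ} (y : E d) : Torus d := fun i => (y i : UnitAddCircle)

/-- The time interval `[0,1]` with Lebesgue measure. -/
def timeMeasure : Measure ℝ := volume.restrict (Icc (0 : ℝ) 1)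

/-- Lebesgue measure on `[0,1] × 𝕋^d`. -/
def spaceTime (d : ℕ) : Measure (ℝ × Torus d) := timeMeasure.prod volume

/-! ### Smooth functions on the torus -/

/-- `g` is smooth on `𝕋^d`: its periodic lift to `ℝ^d` is `C^∞`. -/
def SmoothOnTorus {d : ℕ} {F : Type*} [NormedAddCommGroup F] [NormedSpace ℝ F]
    (g : Torus d → F) : Prop :=
  ContDiff ℝ (⊤ : ℕ∞) (fun y : E d => g (toTorus y))

/-- `φ` is smooth on `ℝ × 𝕋^d`: its lift to `ℝ × ℝ^d` is `C^∞`. -/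
def SmoothSpaceTime {d : ℕ} {F : Type*} [NormedAddCommGroup F] [NormedSpace ℝ F]
    (φ : ℝ → Torus d → F) : Prop :=
  ContDiff ℝ (⊤ : ℕ∞) (fun z : ℝ × E d => φ z.1 (toTorus z.2))

/-- The classical partial derivative `∂_j g` of a function on the torus. -/
def partialDeriv {d : ℕ} {F : Type*} [NormedAddCommGroup F] [NormedSpace ℝ F]
    (j : Fin d) (g : Torus d → F) (x : Torus d) : F :=
  deriv (fun s : ℝ => g (x + toTorus (EuclideanSpace.single j s))) 0

/-- `div v = 0` in the sense of distributions on `𝕋^d`. -/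
def WeakDivFree {d : ℕ} (v : Torus d → E d) : Prop :=
  ∀ η : Torus d → ℝ, SmoothOnTorus η → ∫ x, ∑ j, v x j * partialDeriv j η x = 0

/-- `G x j` is the weak derivative `∂_j v` at `x`. -/
def IsWeakGradient {d : ℕ} (v : Torus d → E d) (G : Torus d → Fin d → E d) : Prop :=
  ∀ η : Torus d → ℝ, SmoothOnTorus η → ∀ i j : Fin d,
    ∫ x, v x i * partialDeriv j η x = - ∫ x, G x j i * η x

/-! ### Norms -/

/-- The norm of `B^α_{2,∞}(𝕋^d)`, `0 < α < 1`:
`‖v‖_{L²} + sup_{y ≠ 0} |y|^{-α} ‖v(· + y) - v‖_{L²}`. -/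
def besovNorm {d : ℕ} (α : ℝ) (v : Torus d → E d) : ℝ≥0∞ :=
  eLpNorm v 2 volume +
    ⨆ y : E d, ⨆ _ : y ≠ 0,
      ENNReal.ofReal (‖y‖ ^ (-α)) * eLpNorm (fun x => v (x + toTorus y) - v x) 2 volume

/-- The norm of `L^q(0,1; L²(𝕋^d))`. -/
def normLqL2 {d : ℕ} (q : ℝ≥0∞) (u : ℝ → Torus d → E d) : ℝ≥0∞ :=
  eLpNorm (fun t => eLpNorm (u t) 2 volume) q timeMeasure

/-- The norm of `L^q(0,1; B^α_{2,∞}(𝕋^d))`. -/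
def normLqBesov {d : ℕ} (q : ℝ≥0∞) (α : ℝ) (u : ℝ → Torus d → E d) : ℝ≥0∞ :=
  eLpNorm (fun t => besovNorm α (u t)) q timeMeasure

/-! ### Leray–Hopf solutions -/

/-- `u` is a Leray–Hopf solution on `[0,1] × 𝕋^d` of
`∂_t u + (u·∇)u + ∇p = ν Δu + f`, `div u = 0`, `u(0) = u₀`,
and `G t x j` is the spatial weak derivative `∂_j u(t,x)`.
The pressure is eliminated by testing with divergence-free fields. -/
structure IsLerayHopfWith {d : ℕ} (ν : ℝ) (u₀ : Torus d → E d) (f u : ℝ → Torus d → E d)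
    (G : ℝ → Torus d → Fin d → E d) : Prop where
  /-- `f ∈ L¹_t L²_x` -/
  force_meas : AEStronglyMeasurable (fun z : ℝ × Torus d => f z.1 z.2) (spaceTime d)
  force_L1L2 : normLqL2 1 f < ⊤
  /-- `u ∈ L^∞_t L²_x` -/
  meas : AEStronglyMeasurable (fun z : ℝ × Torus d => u z.1 z.2) (spaceTime d)
  memLp : ∀ t ∈ Icc (0 : ℝ) 1, MemLp (u t) 2 volume
  bounded : ∃ M : ℝ≥0, ∀ t ∈ Icc (0 : ℝ) 1, eLpNorm (u t) 2 volume ≤ M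
  /-- `u ∈ L²_t H¹_x` -/
  grad_memLp : ∀ j, MemLp (fun z : ℝ × Torus d => G z.1 z.2 j) 2 (spaceTime d)
  grad : ∀ᵐ t ∂timeMeasure, IsWeakGradient (u t) (G t)
  /-- `t ↦ u(t)` is weakly continuous into `L²` -/
  weak_cont : ∀ v : Torus d → E d, MemLp v 2 volume →
    ContinuousOn (fun t => ∫ x, inner ℝ (u t x) (v x)) (Icc 0 1)
  initial : u 0 =ᵐ[volume] u₀
  div_free : ∀ t ∈ Icc (0 : ℝ) 1, WeakDivFree (u t)
  /-- the momentum equation on `[0,t]`, tested with smooth divergence-free fields -/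
  momentum : ∀ φ : ℝ → Torus d → E d, SmoothSpaceTime φ →
    (∀ s x, ∑ j, (partialDeriv j (φ s) x) j = 0) →
    ∀ t ∈ Icc (0 : ℝ) 1,
      (∫ x, inner ℝ (φ 0 x) (u₀ x)) - (∫ x, inner ℝ (φ t x) (u t x))
          + ∫ s in (0 : ℝ)..t, ∫ x, inner ℝ (φ s x) (f s x)
        = ∫ s in (0 : ℝ)..t, ∫ x,
            (- inner ℝ (deriv (fun r => φ r x) s) (u s x)
              - (∑ i, ∑ j, partialDeriv j (φ s) x i * u s x i * u s x j)
              + ν * ∑ j, inner ℝ (partialDeriv j (φ s) x) (G s x j))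
  /-- the energy inequality -/
  energy : ∀ t ∈ Icc (0 : ℝ) 1,
    (1 / 2) * (∫ x, ‖u t x‖ ^ 2) + ν * (∫ s in (0 : ℝ)..t, ∫ x, ∑ j, ‖G s x j‖ ^ 2)
      ≤ (1 / 2) * (∫ x, ‖u₀ x‖ ^ 2) + ∫ s in (0 : ℝ)..t, ∫ x, inner ℝ (f s x) (u s x)

/-- `u` is a Leray–Hopf solution on `[0,1] × 𝕋^d` with viscosity `ν`, datum `u₀`, force `f`. -/
def IsLerayHopf {d : ℕ} (ν : ℝ) (u₀ : Torus d → E d) (f u : ℝ → Torus d → E d) : Prop :=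
  ∃ G : ℝ → Torus d → Fin d → E d, IsLerayHopfWith ν u₀ f u G

/-! ### Structure functions -/

/-- The three cases `• = I, L, T`. -/
inductive Kind : Type
  | I
  | L
  | T

/-- `T_•(y) v`, where `T_I = δ^{ij}`, `T_L = y^i y^j / |y|²`, `T_T = δ^{ij} - y^i y^j / |y|²`. -/
def tensor {d : ℕ} : Kind → E d → E d → E d
  | Kind.I, _, v => v
  | Kind.L, y, v => (inner ℝ y v / ‖y‖ ^ 2) • y
  | Kind.T, y, v => v - (inner ℝ y v / ‖y‖ ^ 2) • y

/-- The normalizing constants of the three structure functions in dimension `d`. -/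
def coeff (d : ℕ) : Kind → ℝ
  | Kind.I => (d : ℝ) / 4
  | Kind.L => (d : ℝ) * (d + 2) / 12
  | Kind.T => (d : ℝ) * (d + 2) / (4 * ((d : ℝ) - 1))

/-- `((v(x+ℓy) - v(x)) · y) |T_•(y) (v(x+ℓy) - v(x))|²`. -/
def increment3 {d : ℕ} (k : Kind) (v : Torus d → E d) (ℓ : ℝ) (x : Torus d) (y : E d) : ℝ :=
  inner ℝ (v (x + toTorus (ℓ • y)) - v x) y * ‖tensor k y (v (x + toTorus (ℓ • y)) - v x)‖ ^ 2

/-- Surface measure on the unit sphere of `ℝ^d`. -/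
def sphereMeasure (d : ℕ) : Measure (Metric.sphere (0 : E d) 1) :=
  (volume : Measure (E d)).toSphere

/-- The normalized third-order structure function of a single velocity field. -/
def structureFn {d : ℕ} (k : Kind) (v : Torus d → E d) (ℓ : ℝ) : ℝ :=
  coeff d k * ∫ x, ⨍ y : Metric.sphere (0 : E d) 1, increment3 k v ℓ x y ∂(sphereMeasure d)

/-- `ε(t) = ½‖u₀‖² - ½‖u(t)‖² + ∫₀ᵗ ⟨f(r), u(r)⟩ dr`. -/
def dissipation {d : ℕ} (u₀ : Torus d → E d) (f u : ℝ → Torus d → E d) (t : ℝ) : ℝ :=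
  (1 / 2) * (∫ x, ‖u₀ x‖ ^ 2) - (1 / 2) * (∫ x, ‖u t x‖ ^ 2)
    + ∫ r in (0 : ℝ)..t, ∫ x, inner ℝ (f r x) (u r x)

/-- `∫₀ᵗ S_•(r,ℓ)/ℓ dr + ε(t)`. -/
def lawDefect {d : ℕ} (k : Kind) (u₀ : Torus d → E d) (f u : ℝ → Torus d → E d)
    (ℓ t : ℝ) : ℝ :=
  (∫ r in (0 : ℝ)..t, structureFn k (u r) ℓ / ℓ) + dissipation u₀ f u t

end NSLaws

end

open NSLaws

/-!
The dissipation `ε` is compared with third-order increments through a smoothed local energy balance.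
Let `K` be an even, symmetric, matrix-valued kernel of mean `c · Id` whose divergence is a gradient.
Averaging the divergence-free field `u(t)` against `K` (`smear`) then gives a smooth divergence-free
test field, so there is no pressure term. Since `u` is only weakly continuous in time, the momentum
equation is tested with the smeared field frozen at the ends of short time intervals; symmetry of
`K` turns the result into a balance for `∫ u · (K * u)` (`sub_eq_integral_diag`,
`smeared_energy_balance`). Expressed with the increments `δ_z u = u(· + z) - u`, that balance says
that `c ε(t) - ¼ ∫₀ᵗ ∫∫ ⟨δ_z u, ∂_{δ_z u} K(z) δ_z u⟩` is bounded by quadratic increments at the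
times `0` and `t`, by a pairing of the force with increments, and by `ν` times a pairing of the
gradient with increments (`IsLerayHopfWith.enorm_dissipation_sub_le`).

Two kernels give two laws (`IsLawKernel`). With `K = β(|z|²) Id` the cubic term involves
`(δu · z) |δu|²`. With `K = A(|z|²) Id + β(|z|²) z ⊗ z` and `A' = -β`, the terms other than
`(δu · z)³` cancel. In both cases the cubic term is an average over `|z|²` with density `-β'`, which
may be any bump function. Since the remainders are bounded independently of the bump, it can be
shrunk to the point `ℓ²`; the cubic term becomes the average over the sphere of radius `ℓ`, and the
estimate holds for the structure function at the single scale `ℓ` (`tendsto_smoothed_defect`,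
`exists_defect_const`). The transversal law is a linear combination of the other two
(`lawDefect_transversal`).

The remainders are small for the following reasons. The energy inequality bounds `‖u(t)‖_{L²}` and
`ν ∫ ‖∇u‖²` by the data, and the Besov bound gives `∫ ‖δ_z u‖² dt ≤ C |z|^{2α}`. The viscous
remainder is therefore at most a constant times `ν^{1/2} ℓ^{α - 1} ≤ ν^{1/2 - L(1 - α)}`, whose
exponent is positive exactly because `L < 1 / (2 (1 - α))` (`viscous_scale_le`). A force bounded in
`L^{1 + σ}` in time is split at a large height, and a force bounded only in `L¹` is paired with
increments that are small at every time. The increments of the initial datum vanish by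
continuity of translations. The increments at time `t` are small in `L¹` in time, and the
defect is bounded, which gives convergence in every `L^p` (`tendsto_lawDefect_Lp`). Under the Besov
bound for almost every time, weak continuity extends the bound to every time
(`eLpNorm_incr_le_of_normLqBesov_top`) and the convergence is uniform (`tendsto_lawDefect_uniform`).

All of this uses `u ∈ L³` of space-time. For `d ≤ 4` this follows from `‖v‖₃³ ≤ ‖v‖₂ ‖v‖₄²` and the
embedding `H¹ ⊂ L⁴` on the torus (`exists_sobolev`), which is deduced from the
Gagliardo–Nirenberg–Sobolev inequality on `ℝ^d` by mollification and a cutoff.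
-/

noncomputable section

namespace NSLaws

variable {d : ℕ}

/-! ### The covering map of the torus -/

lemma toTorus_add (y z : E d) : toTorus (y + z) = toTorus y + toTorus z := by
  ext i; simp [toTorus]

lemma toTorus_neg (y : E d) : toTorus (-y) = -toTorus y := by
  ext i; simp [toTorus]

@[simp] lemma toTorus_zero : toTorus (0 : E d) = 0 := by
  ext i; simp [toTorus]

lemma toTorus_sub (y z : E d) : toTorus (y - z) = toTorus y - toTorus z := by
  rw [sub_eq_add_neg, toTorus_add, toTorus_neg, sub_eq_add_neg]

lemma continuous_toTorus : Continuous (toTorus : E d → Torus d) := by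
  unfold toTorus
  refine continuous_pi fun i => ?_
  exact (AddCircle.continuous_mk' 1).comp (by fun_prop)

lemma measurable_toTorus : Measurable (toTorus : E d → Torus d) :=
  continuous_toTorus.measurable

/-- The representative in `(-1/2, 1/2]^d` of a point of the torus. -/
def torusRepr (x : Torus d) : E d :=
  WithLp.toLp 2 fun i => ((AddCircle.measurableEquivIoc (1 : ℝ) (-1 / 2) (x i) : Ioc (-1 / 2 : ℝ) _) : ℝ)

lemma measurable_torusRepr : Measurable (torusRepr : Torus d → E d) := by
  unfold torusRepr
  refine (WithLp.measurable_toLp 2 _).comp (measurable_pi_lambda _ fun i => ?_)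
  exact measurable_subtype_coe.comp
    ((AddCircle.measurableEquivIoc (1 : ℝ) (-1 / 2)).measurable.comp (measurable_pi_apply i))

lemma toTorus_torusRepr (x : Torus d) : toTorus (torusRepr x) = x := by
  ext i
  exact (AddCircle.measurableEquivIoc (1 : ℝ) (-1 / 2)).symm_apply_apply (x i)

lemma torusRepr_toTorus_of_mem {y : E d} (hy : ∀ i, y i ∈ Ioc (-1 / 2 : ℝ) (-1 / 2 + 1)) :
    torusRepr (toTorus y) = y := by
  ext i
  have := (AddCircle.measurableEquivIoc (1 : ℝ) (-1 / 2)).apply_symm_apply ⟨y i, hy i⟩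
  exact congrArg Subtype.val this

lemma torusRepr_toTorus {y : E d} (hy : ‖y‖ < 1 / 2) : torusRepr (toTorus y) = y := by
  refine torusRepr_toTorus_of_mem fun i => ?_
  have h := (PiLp.norm_apply_le y i).trans_lt hy
  rw [Real.norm_eq_abs, abs_lt] at h
  constructor <;> linarith [h.1, h.2]

/-- The half-open unit cube with lower corner `a`. -/
def unitCube (a : E d) : Set (E d) := {y | ∀ i, y i ∈ Ioc (a i) (a i + 1)}

lemma measurableSet_unitCube (a : E d) : MeasurableSet (unitCube a) := by
  have : unitCube a = ⋂ i, (fun y : E d => y i) ⁻¹' Ioc (a i) (a i + 1) := by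
    ext y; simp [unitCube]
  rw [this]
  exact MeasurableSet.iInter fun i => measurableSet_Ioc.preimage (by fun_prop)

lemma measurePreserving_toTorus (a : E d) :
    MeasurePreserving (toTorus : E d → Torus d) (volume.restrict (unitCube a)) volume := by
  have h1 : MeasurePreserving (fun (x : Fin d → ℝ) => (fun i => (x i : UnitAddCircle)))
      (Measure.pi fun i => volume.restrict (Ioc (a i) (a i + 1)))
      (Measure.pi fun _ => (volume : Measure UnitAddCircle)) :=
    measurePreserving_pi _ _ fun i => AddCircle.measurePreserving_mk 1 (a i)
  rw [← Measure.restrict_pi_pi] at h1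
  have h2 := (EuclideanSpace.volume_preserving_symm_measurableEquiv_toLp (Fin d)).restrict_preimage
    (s := univ.pi fun i => Ioc (a i) (a i + 1)) (MeasurableSet.univ_pi fun i => measurableSet_Ioc)
  have h3 := h1.comp h2
  have : (MeasurableEquiv.toLp 2 (Fin d → ℝ)).symm ⁻¹' (univ.pi fun i => Ioc (a i) (a i + 1))
      = unitCube a := by
    ext y; simp [unitCube]
  rw [this] at h3
  exact h3

lemma lintegral_unitCube {F : Torus d → ℝ≥0∞} (hF : AEMeasurable F) (a : E d) :
    ∫⁻ y in unitCube a, F (toTorus y) = ∫⁻ x, F x := by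
  have h := measurePreserving_toTorus a
  rw [← h.map_eq, lintegral_map' (by rwa [h.map_eq]) h.measurable.aemeasurable]

lemma integral_unitCube {F' : Type*} [NormedAddCommGroup F'] [NormedSpace ℝ F']
    {F : Torus d → F'} (hF : AEStronglyMeasurable F volume) (a : E d) :
    ∫ y in unitCube a, F (toTorus y) = ∫ x, F x := by
  have h := measurePreserving_toTorus a
  rw [← h.map_eq, integral_map h.measurable.aemeasurable (by rwa [h.map_eq])]

instance isProbabilityMeasure_unitAddCircle :
    IsProbabilityMeasure (volume : Measure UnitAddCircle) :=
  ⟨by simp⟩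

instance isProbabilityMeasure_torus : IsProbabilityMeasure (volume : Measure (Torus d)) := by
  unfold Torus; infer_instance

lemma measurePreserving_translate (a : Torus d) :
    MeasurePreserving (fun x : Torus d => x + a) volume volume :=
  measurePreserving_add_right volume a

/-- Over a compact set, the integral of a periodic lift is controlled by the integral over the torus,
since finitely many unit cubes cover the set. -/
lemma exists_lintegral_lift_le {s : Set (E d)} (hs : IsCompact s) :
    ∃ N : ℝ≥0, ∀ F : Torus d → ℝ≥0∞, AEMeasurable F →
      ∫⁻ y in s, F (toTorus y) ≤ N * ∫⁻ x, F x := by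
  refine hs.induction_on (p := fun s => ∃ N : ℝ≥0, ∀ F : Torus d → ℝ≥0∞, AEMeasurable F →
      ∫⁻ y in s, F (toTorus y) ≤ N * ∫⁻ x, F x) ?_ ?_ ?_ ?_
  · exact ⟨0, fun F _ => by simp⟩
  · rintro s t hst ⟨N, hN⟩
    exact ⟨N, fun F hF => (lintegral_mono_set hst).trans (hN F hF)⟩
  · rintro s t ⟨N, hN⟩ ⟨M, hM⟩
    refine ⟨N + M, fun F hF => (lintegral_union_le _ _ _).trans ?_⟩
    rw [ENNReal.coe_add, add_mul]
    exact add_le_add (hN F hF) (hM F hF)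
  · intro x _
    let a : E d := WithLp.toLp 2 fun i => x i - 1 / 2
    refine ⟨Metric.ball x (1 / 2), mem_nhdsWithin_of_mem_nhds (Metric.ball_mem_nhds _ (by norm_num)),
      1, fun F hF => ?_⟩
    rw [ENNReal.coe_one, one_mul, ← lintegral_unitCube hF a]
    refine lintegral_mono_set fun y hy i => ?_
    rw [Metric.mem_ball, dist_eq_norm] at hy
    have h := (PiLp.norm_apply_le (y - x) i).trans_lt hy
    rw [Real.norm_eq_abs, abs_lt, PiLp.sub_apply] at h
    simp only [a]
    constructor <;> linarith [h.1, h.2]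

lemma aestronglyMeasurable_lift {F' : Type*} [NormedAddCommGroup F']
    {F : Torus d → F'} (hF : AEStronglyMeasurable F volume) :
    AEStronglyMeasurable (fun y : E d => F (toTorus y)) volume := by
  refine hF.comp_quasiMeasurePreserving ⟨measurable_toTorus, ?_⟩
  refine Measure.AbsolutelyContinuous.mk fun s hs h0 => ?_
  rw [Measure.map_apply measurable_toTorus hs]
  have hcov : (univ : Set (E d)) = ⋃ n : ℕ, Metric.closedBall 0 n := by
    simp
  rw [← inter_univ (toTorus ⁻¹' s), hcov, inter_iUnion]
  refine measure_iUnion_null fun n => ?_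
  obtain ⟨N, hN⟩ := exists_lintegral_lift_le (isCompact_closedBall (0 : E d) n)
  have := hN (s.indicator 1) ((measurable_one.indicator hs).aemeasurable)
  rw [lintegral_indicator_one hs, h0, mul_zero] at this
  have e : (fun y : E d => s.indicator (1 : Torus d → ℝ≥0∞) (toTorus y))
      = (toTorus ⁻¹' s).indicator 1 := rfl
  rw [e, lintegral_indicator_one (measurable_toTorus hs),
    Measure.restrict_apply (measurable_toTorus hs)] at this
  exact le_antisymm this (by simp)

lemma locallyIntegrable_lift {F' : Type*} [NormedAddCommGroup F']
    {F : Torus d → F'} (hF : Integrable F) :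
    LocallyIntegrable (fun y : E d => F (toTorus y)) volume := by
  rw [locallyIntegrable_iff]
  intro k hk
  obtain ⟨N, hN⟩ := exists_lintegral_lift_le hk
  refine ⟨(aestronglyMeasurable_lift hF.1).restrict, ?_⟩
  refine (hN _ hF.1.enorm).trans_lt ?_
  exact ENNReal.mul_lt_top ENNReal.coe_lt_top hF.2

lemma integrable_translate {F' : Type*} [NormedAddCommGroup F']
    {F : Torus d → F'} (hF : Integrable F) (x : Torus d) : Integrable fun w => F (x + w) :=
  (measurePreserving_add_left volume x).integrable_comp_of_integrable hF

/-- Integrals against a kernel supported in the closed ball of radius `1/4` live on the torus. -/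
lemma integral_eq_integral_torusRepr {F' G' : Type*} [NormedAddCommGroup F'] [NormedSpace ℝ F']
    [NormedAddCommGroup G'] [NormedSpace ℝ G']
    {K : E d → F' →L[ℝ] G'} (hK : Continuous K) (hs : ∀ z, 1 / 4 < ‖z‖ → K z = 0)
    {F : Torus d → F'} (hF : AEStronglyMeasurable F volume) :
    ∫ z, K z (F (toTorus z)) = ∫ w, K (torusRepr w) (F w) := by
  let a : E d := WithLp.toLp 2 fun _ => -1 / 2
  have hm : AEStronglyMeasurable (fun w => K (torusRepr w) (F w)) volume :=
    (ContinuousLinearMap.apply ℝ G' : F' →L[ℝ] (F' →L[ℝ] G') →L[ℝ] G').flip.aestronglyMeasurable_comp₂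
      (hK.comp_stronglyMeasurable (measurable_torusRepr.stronglyMeasurable)).aestronglyMeasurable hF
  rw [← integral_unitCube hm a]
  rw [← setIntegral_eq_integral_of_forall_compl_eq_zero (s := unitCube a)]
  · refine setIntegral_congr_fun (measurableSet_unitCube a) fun y hy => ?_
    rw [torusRepr_toTorus_of_mem (y := y) hy]
  · intro z hz
    rw [hs z, zero_apply]
    by_contra! h
    refine hz fun i => ?_
    have h := (PiLp.norm_apply_le z i).trans h
    rw [Real.norm_eq_abs, abs_le] at h
    simp only [a]
    constructor <;> linarith [h.1, h.2]

/-! ### Shifts with a parameter -/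

section Shift

variable {X Z F' : Type*} [MeasurableSpace X] [MeasurableSpace Z] [NormedAddCommGroup F']
  {μ : Measure X} {ν : Measure Z} {Φ : X × Z → X}

/-- A family of measure preserving maps, with a parameter, pushes the product measure to a multiple
of the base measure. -/
lemma map_shift [SFinite μ] [SFinite ν] (hΦ : Measurable Φ)
    (h : ∀ z, MeasurePreserving (fun x => Φ (x, z)) μ μ) :
    Measure.map Φ (μ.prod ν) = ν univ • μ := by
  ext s hs
  rw [Measure.map_apply hΦ hs, Measure.prod_apply_symm (hΦ hs)]
  have : ∀ z, μ ((fun x => (x, z)) ⁻¹' (Φ ⁻¹' s)) = μ s := fun z =>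
    (h z).measure_preimage hs.nullMeasurableSet
  simp [this, mul_comm]

lemma aestronglyMeasurable_shift [SFinite μ] [SFinite ν] (hΦ : Measurable Φ)
    (h : ∀ z, MeasurePreserving (fun x => Φ (x, z)) μ μ) {F : X → F'}
    (hF : AEStronglyMeasurable F μ) : AEStronglyMeasurable (fun q => F (Φ q)) (μ.prod ν) := by
  refine hF.comp_quasiMeasurePreserving ⟨hΦ, ?_⟩
  refine Measure.AbsolutelyContinuous.mk fun s hs h0 => ?_
  rw [Measure.map_apply hΦ hs, Measure.prod_apply_symm (hΦ hs)]
  have : ∀ z, μ ((fun x => (x, z)) ⁻¹' (Φ ⁻¹' s)) = μ s := fun z =>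
    (h z).measure_preimage hs.nullMeasurableSet
  simp [this, h0]

lemma memLp_shift [SFinite μ] [IsFiniteMeasure ν] (hΦ : Measurable Φ)
    (h : ∀ z, MeasurePreserving (fun x => Φ (x, z)) μ μ) {p : ℝ≥0∞} {F : X → F'}
    (hF : MemLp F p μ) : MemLp (fun q => F (Φ q)) p (μ.prod ν) := by
  have hm := map_shift (ν := ν) hΦ h
  have h1 : MemLp F p (Measure.map Φ (μ.prod ν)) := by
    rw [hm]
    exact hF.smul_measure (measure_ne_top _ _)
  exact h1.comp_of_map hΦ.aemeasurable

end Shift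

/-- The shift `(x, z) ↦ x + θ z` of the torus. -/
lemma measurable_torusShift {Z : Type*} [MeasurableSpace Z] {θ : Z → Torus d} (hθ : Measurable θ) :
    Measurable (fun q : Torus d × Z => q.1 + θ q.2) :=
  measurable_fst.add (hθ.comp measurable_snd)

lemma measurable_spaceTimeShift {Z : Type*} [MeasurableSpace Z] {θ : Z → Torus d}
    (hθ : Measurable θ) :
    Measurable (fun q : (ℝ × Torus d) × Z => (q.1.1, q.1.2 + θ q.2)) :=
  (measurable_fst.comp measurable_fst).prodMk
    ((measurable_snd.comp measurable_fst).add (hθ.comp measurable_snd))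

instance isFiniteMeasure_timeMeasure : IsFiniteMeasure timeMeasure := by
  unfold timeMeasure; infer_instance

instance isFiniteMeasure_spaceTime : IsFiniteMeasure (spaceTime d) := by
  unfold spaceTime; infer_instance

lemma measurePreserving_spaceTime_translate (a : Torus d) :
    MeasurePreserving (fun q : ℝ × Torus d => (q.1, q.2 + a)) (spaceTime d) (spaceTime d) :=
  (MeasurePreserving.id timeMeasure).prod (measurePreserving_translate a)

/-! ### Continuity of translations -/

lemma memLp_translate {F' : Type*} [NormedAddCommGroup F'] {p : ℝ≥0∞} {v : Torus d → F'}
    (hv : MemLp v p volume) (a : Torus d) : MemLp (fun x => v (x + a)) p volume :=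
  hv.comp_measurePreserving (measurePreserving_translate a)

/-- A continuous family of measure preserving maps acts continuously on `L^p`, `p < ∞`. -/
lemma tendsto_eLpNorm_comp_sub {X F' : Type*} [TopologicalSpace X] [R1Space X] [MeasurableSpace X]
    [BorelSpace X] {μ : Measure X} [IsLocallyFiniteMeasure μ] [μ.InnerRegularCompactLTTop]
    [NormedAddCommGroup F'] {p : ℝ≥0∞} (hp1 : 1 ≤ p) (hp : p ≠ ∞) {v : X → F'} (hv : MemLp v p μ)
    {g : E d → C(X, X)} (hg : Continuous g) (hgm : ∀ z, MeasurePreserving (g z) μ μ) (z₀ : E d) :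
    Tendsto (fun z : E d => eLpNorm (fun x => v (g z x) - v (g z₀ x)) p μ) (𝓝 z₀) (𝓝 0) := by
  have : Fact (1 ≤ p) := ⟨hp1⟩
  have h := (continuous_const (y := hv.toLp v)).compMeasurePreservingLp hg hgm hp
  have h2 := (h.tendsto z₀)
  rw [Lp.tendsto_Lp_iff_tendsto_eLpNorm'] at h2
  refine h2.congr fun z => ?_
  refine eLpNorm_congr_ae ?_
  have e : ∀ z, (Lp.compMeasurePreserving (g z) (hgm z) (hv.toLp v) : X → F')
      =ᵐ[μ] fun x => v (g z x) := fun z =>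
    (Lp.coeFn_compMeasurePreserving _ (hgm z)).trans
      ((hgm z).quasiMeasurePreserving.ae_eq_comp hv.coeFn_toLp)
  exact (e z).sub (e z₀)

lemma tendsto_eLpNorm_translate {F' : Type*} [NormedAddCommGroup F'] {p : ℝ≥0∞} (hp1 : 1 ≤ p)
    (hp : p ≠ ∞) {v : Torus d → F'} (hv : MemLp v p volume) (z₀ : E d) :
    Tendsto (fun z : E d => eLpNorm (fun x => v (x + toTorus z) - v (x + toTorus z₀)) p volume)
      (𝓝 z₀) (𝓝 0) := by
  refine tendsto_eLpNorm_comp_sub (g := fun z => ⟨fun x => x + toTorus z, by fun_prop⟩) hp1 hp hv ?_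
    (fun z => measurePreserving_translate (toTorus z)) z₀
  refine ContinuousMap.continuous_of_continuous_uncurry _ ?_
  exact continuous_snd.add (continuous_toTorus.comp continuous_fst)

lemma tendsto_eLpNorm_spaceTime_translate {F' : Type*} [NormedAddCommGroup F'] {p : ℝ≥0∞}
    (hp1 : 1 ≤ p) (hp : p ≠ ∞) {v : ℝ × Torus d → F'} (hv : MemLp v p (spaceTime d)) (z₀ : E d) :
    Tendsto (fun z : E d => eLpNorm
      (fun q => v (q.1, q.2 + toTorus z) - v (q.1, q.2 + toTorus z₀)) p (spaceTime d))
      (𝓝 z₀) (𝓝 0) := by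
  refine tendsto_eLpNorm_comp_sub (g := fun z => ⟨fun q => (q.1, q.2 + toTorus z), by fun_prop⟩)
    hp1 hp hv ?_ (fun z => measurePreserving_spaceTime_translate (toTorus z)) z₀
  refine ContinuousMap.continuous_of_continuous_uncurry _ ?_
  exact (continuous_fst.comp continuous_snd).prodMk
    ((continuous_snd.comp continuous_snd).add (continuous_toTorus.comp continuous_fst))

/-! ### Periodized bumps -/

/-- The periodization, centred at `x`, of a function supported in a small ball. -/
def periodize (Θ : E d → ℝ) (x w : Torus d) : ℝ := Θ (torusRepr (w - x))

lemma periodize_eventuallyEq {Θ : E d → ℝ} (hs : ∀ z, 1 / 4 < ‖z‖ → Θ z = 0) (x : Torus d)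
    (y₀ : E d) : (fun y => periodize Θ x (toTorus y)) =ᶠ[𝓝 y₀]
      fun y => Θ (y - y₀ + torusRepr (toTorus y₀ - x)) := by
  set r := torusRepr (toTorus y₀ - x) with hr
  have hr' : toTorus r = toTorus y₀ - x := toTorus_torusRepr _
  have key : ∀ y, toTorus (y - y₀ + r) = toTorus y - x := fun y => by
    rw [toTorus_add, toTorus_sub, hr']; abel
  rcases lt_or_ge ‖r‖ (1 / 2) with h | h
  · have : ∀ᶠ y in 𝓝 y₀, ‖y - y₀ + r‖ < 1 / 2 := by
      have hc : ContinuousAt (fun y : E d => ‖y - y₀ + r‖) y₀ := by fun_prop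
      refine hc.eventually_lt continuousAt_const ?_
      simpa using h
    filter_upwards [this] with y hy
    rw [periodize, ← key, torusRepr_toTorus hy]
  · filter_upwards [Metric.ball_mem_nhds y₀ (show (0 : ℝ) < 1 / 4 by norm_num)] with y hy
    rw [Metric.mem_ball, dist_eq_norm] at hy
    rw [hs (y - y₀ + r), periodize, hs]
    · by_contra! hcon
      have h1 : toTorus (torusRepr (toTorus y - x) - (y - y₀)) = toTorus y₀ - x := by
        rw [toTorus_sub, toTorus_torusRepr, toTorus_sub]; abel
      have h2 : ‖torusRepr (toTorus y - x) - (y - y₀)‖ < 1 / 2 := by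
        linarith [norm_sub_le (torusRepr (toTorus y - x)) (y - y₀)]
      have h3 := torusRepr_toTorus h2
      rw [h1, ← hr] at h3
      rw [h3] at h
      linarith
    · have := norm_sub_norm_le r (-(y - y₀))
      rw [norm_neg, sub_neg_eq_add, add_comm r] at this
      linarith

lemma smoothOnTorus_periodize {Θ : E d → ℝ} (hΘ : ContDiff ℝ (⊤ : ℕ∞) Θ)
    (hs : ∀ z, 1 / 4 < ‖z‖ → Θ z = 0) (x : Torus d) : SmoothOnTorus (periodize Θ x) := by
  unfold SmoothOnTorus
  rw [contDiff_iff_contDiffAt]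
  intro y₀
  refine ContDiffAt.congr_of_eventuallyEq ?_ (periodize_eventuallyEq hs x y₀)
  exact ContDiff.contDiffAt (by fun_prop)

lemma hasDerivAt_line (y₀ : E d) (j : Fin d) :
    HasDerivAt (fun s : ℝ => y₀ + EuclideanSpace.single j s)
      (EuclideanSpace.single j 1 : E d) 0 := by
  have : (fun s : ℝ => y₀ + EuclideanSpace.single j s)
      = fun s : ℝ => y₀ + s • (EuclideanSpace.single j 1 : E d) := by
    funext s
    congr 1
    ext i
    simp
  rw [this]
  simpa using ((hasDerivAt_id (0 : ℝ)).smul_const (EuclideanSpace.single j 1 : E d)).const_add y₀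

lemma partialDeriv_periodize {Θ : E d → ℝ} (hΘ : ContDiff ℝ (⊤ : ℕ∞) Θ)
    (hs : ∀ z, 1 / 4 < ‖z‖ → Θ z = 0) (x w : Torus d) (j : Fin d) :
    partialDeriv j (periodize Θ x) w
      = fderiv ℝ Θ (torusRepr (w - x)) (EuclideanSpace.single j 1) := by
  set y₀ := torusRepr w with hy₀
  have hw : toTorus y₀ = w := toTorus_torusRepr w
  have hline := hasDerivAt_line y₀ j
  have hev := periodize_eventuallyEq hs x y₀
  have h0 : y₀ + EuclideanSpace.single j (0 : ℝ) = y₀ := by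
    have : (EuclideanSpace.single j (0 : ℝ) : E d) = 0 := by ext i; simp
    rw [this, add_zero]
  have hf : HasFDerivAt (fun y => periodize Θ x (toTorus y))
      (fderiv ℝ Θ (torusRepr (w - x))) (y₀ + EuclideanSpace.single j (0 : ℝ)) := by
    rw [h0]
    refine HasFDerivAt.congr_of_eventuallyEq ?_ hev
    have h1 : HasFDerivAt Θ (fderiv ℝ Θ (torusRepr (w - x))) (y₀ - y₀ + torusRepr (toTorus y₀ - x)) := by
      rw [hw, sub_self, zero_add]
      exact ((hΘ.differentiable (by simp)) _).hasFDerivAt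
    have h2 : HasFDerivAt (fun y : E d => y - y₀ + torusRepr (toTorus y₀ - x))
        (ContinuousLinearMap.id ℝ (E d)) y₀ :=
      ((hasFDerivAt_id y₀).sub_const y₀).add_const _
    have h3 := h1.comp y₀ h2
    rwa [ContinuousLinearMap.comp_id] at h3
  have h := hf.comp_hasDerivAt (0 : ℝ) hline
  unfold partialDeriv
  rw [← h.deriv]
  congr 1
  funext s
  simp only [Function.comp]
  rw [toTorus_add, hw]

lemma fderiv_eq_zero_of_norm {F' : Type*} [NormedAddCommGroup F'] [NormedSpace ℝ F'] {Θ : E d → F'}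
    (hs : ∀ z, 1 / 4 < ‖z‖ → Θ z = 0) {z : E d} (hz : 1 / 4 < ‖z‖) : fderiv ℝ Θ z = 0 := by
  have : Θ =ᶠ[𝓝 z] fun _ => 0 := by
    filter_upwards [(continuous_norm.continuousAt (x := z)).eventually_const_lt hz] with y hy
    exact hs y hy
  rw [this.fderiv_eq, fderiv_const_apply]

/-- A gradient kernel annihilates divergence-free fields. -/
lemma integral_fderiv_eq_zero_of_weakDivFree {Θ : E d → ℝ} (hΘ : ContDiff ℝ (⊤ : ℕ∞) Θ)
    (hs : ∀ z, 1 / 4 < ‖z‖ → Θ z = 0) {v : Torus d → E d} (hv : Integrable v)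
    (hdiv : WeakDivFree v) (x : Torus d) : ∫ z, fderiv ℝ Θ z (v (x + toTorus z)) = 0 := by
  rw [integral_eq_integral_torusRepr (K := fderiv ℝ Θ) (F := fun w => v (x + w))
    (hΘ.continuous_fderiv (by simp)) (fun z hz => fderiv_eq_zero_of_norm hs hz)
    (integrable_translate hv x).1]
  rw [← hdiv _ (smoothOnTorus_periodize hΘ hs x), ← integral_add_left_eq_self (μ := volume)
    (fun w => ∑ j, v w j * partialDeriv j (periodize Θ x) w) x]
  refine integral_congr_ae (Eventually.of_forall fun w => ?_)
  simp only
  rw [show v (x + w) = ∑ j, v (x + w) j • (EuclideanSpace.single j 1 : E d) by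
    ext i; simp [Pi.single_apply]]
  rw [map_sum]
  refine Finset.sum_congr rfl fun j _ => ?_
  rw [map_smul, partialDeriv_periodize hΘ hs, add_sub_cancel_left, smul_eq_mul]
  simp [Pi.single_apply]

/-! ### Smearing by a matrix kernel -/

/-- A smooth matrix-valued kernel supported in the closed ball of radius `1/4`. -/
structure IsSmoothKernel (K : E d → E d →L[ℝ] E d) : Prop where
  smooth : ContDiff ℝ (⊤ : ℕ∞) K
  supp : ∀ z, 1 / 4 < ‖z‖ → K z = 0

/-- Lebesgue measure on the closed ball of radius `1/4`, which carries all kernels. -/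
def ballMeasure (d : ℕ) : Measure (E d) := volume.restrict (Metric.closedBall 0 (1 / 4))

instance : IsFiniteMeasure (ballMeasure d) := by
  unfold ballMeasure
  exact ⟨by simpa using measure_closedBall_lt_top⟩

lemma integral_ballMeasure {F' : Type*} [NormedAddCommGroup F'] [NormedSpace ℝ F'] {F : E d → F'}
    (h : ∀ z, 1 / 4 < ‖z‖ → F z = 0) : ∫ z, F z ∂(ballMeasure d) = ∫ z, F z := by
  unfold ballMeasure
  refine setIntegral_eq_integral_of_forall_compl_eq_zero fun z hz => h z ?_
  simpa using hz

lemma measurePreserving_neg_ballMeasure :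
    MeasurePreserving (fun z : E d => -z) (ballMeasure d) (ballMeasure d) := by
  have := (Measure.measurePreserving_neg (volume : Measure (E d))).restrict_preimage
    (s := Metric.closedBall 0 (1 / 4)) Metric.isClosed_closedBall.measurableSet
  have e : (Neg.neg ⁻¹' Metric.closedBall (0 : E d) (1 / 4)) = Metric.closedBall 0 (1 / 4) := by
    ext z; simp
  rw [e] at this
  exact this

lemma integral_ballMeasure_neg {F' : Type*} [NormedAddCommGroup F'] [NormedSpace ℝ F']
    (F : E d → F') : ∫ z, F (-z) ∂(ballMeasure d) = ∫ z, F z ∂(ballMeasure d) :=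
  measurePreserving_neg_ballMeasure.integral_comp (MeasurableEquiv.neg _).measurableEmbedding _

/-- Relabelling `(x, x + z)` as `(x + z, x)` in an integral over pairs of points. -/
lemma integral_integral_flip {A B F' : Type*} [NormedAddCommGroup F'] [NormedSpace ℝ F']
    (Φ : E d → A → B → F') (v : Torus d → A) (w : Torus d → B) :
    ∫ z, (∫ x, Φ z (v x) (w (x + toTorus z))) ∂(ballMeasure d)
      = ∫ z, (∫ x, Φ (-z) (v (x + toTorus z)) (w x)) ∂(ballMeasure d) := by
  rw [← integral_ballMeasure_neg]
  refine integral_congr_ae (Eventually.of_forall fun z => ?_)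
  simp only
  rw [← integral_add_right_eq_self _ (toTorus z)]
  refine integral_congr_ae (Eventually.of_forall fun x => ?_)
  simp [toTorus_neg]

/-- The average of `v` around `x` with respect to the matrix kernel `K`. -/
def smear (K : E d → E d →L[ℝ] E d) (v : Torus d → E d) (x : Torus d) : E d :=
  ∫ z, K z (v (x + toTorus z))

namespace IsSmoothKernel

variable {K : E d → E d →L[ℝ] E d} (hK : IsSmoothKernel K)
include hK

lemma continuous : Continuous K := hK.smooth.continuous

lemma hasCompactSupport : HasCompactSupport K :=
  HasCompactSupport.intro (isCompact_closedBall (0 : E d) (1 / 4)) fun z hz => hK.supp z (by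
    simpa using hz)

lemma exists_bound : ∃ C, 0 ≤ C ∧ ∀ z, ‖K z‖ ≤ C := by
  obtain ⟨C, hC⟩ := hK.hasCompactSupport.exists_bound_of_continuous hK.continuous
  exact ⟨C, (norm_nonneg _).trans (hC 0), hC⟩

lemma fderiv_apply (e : E d) : IsSmoothKernel fun z => fderiv ℝ K z e where
  smooth := by
    have h : ContDiff ℝ (⊤ : ℕ∞) (fderiv ℝ K) := hK.smooth.fderiv_right (by simp)
    exact (ContinuousLinearMap.apply ℝ (E d →L[ℝ] E d) e).contDiff.comp h
  supp z hz := by rw [fderiv_eq_zero_of_norm hK.supp hz]; rfl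

lemma exists_bound_fderiv : ∃ C, 0 ≤ C ∧ ∀ z a, ‖fderiv ℝ K z a‖ ≤ C * ‖a‖ := by
  choose C hC0 hC using fun j : Fin d =>
    (hK.fderiv_apply (EuclideanSpace.single j 1)).exists_bound
  refine ⟨∑ j, C j, Finset.sum_nonneg fun j _ => hC0 j, fun z a => ?_⟩
  have ha : a = ∑ j, a j • (EuclideanSpace.single j 1 : E d) := by
    ext i; simp [Pi.single_apply]
  conv_lhs => rw [ha, map_sum]
  rw [Finset.sum_mul]
  refine (norm_sum_le _ _).trans (Finset.sum_le_sum fun j _ => ?_)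
  rw [map_smul, norm_smul, mul_comm]
  exact mul_le_mul (hC j z) (PiLp.norm_apply_le a j) (norm_nonneg _) (hC0 j)

end IsSmoothKernel

open scoped Convolution in
lemma smear_lift (K : E d → E d →L[ℝ] E d) (v : Torus d → E d) (y : E d) :
    smear K v (toTorus y) = ((fun t => v (toTorus t)) ⋆[ContinuousLinearMap.apply ℝ (E d), volume]
      fun w => K (-w)) y := by
  rw [smear, convolution, ← integral_sub_right_eq_self _ y]
  refine integral_congr_ae (Eventually.of_forall fun z => ?_)
  simp only [ContinuousLinearMap.apply_apply, neg_sub]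
  rw [← toTorus_add, add_sub_cancel]

lemma IsSmoothKernel.comp_neg {K : E d → E d →L[ℝ] E d} (hK : IsSmoothKernel K) :
    IsSmoothKernel fun w => K (-w) where
  smooth := hK.smooth.comp contDiff_neg
  supp z hz := hK.supp _ (by simpa using hz)

lemma smoothOnTorus_smear {K : E d → E d →L[ℝ] E d} (hK : IsSmoothKernel K) {v : Torus d → E d}
    (hv : Integrable v) : SmoothOnTorus (smear K v) := by
  unfold SmoothOnTorus
  simp_rw [smear_lift]
  exact hK.comp_neg.hasCompactSupport.contDiff_convolution_right _ (locallyIntegrable_lift hv)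
    hK.comp_neg.smooth

lemma hasFDerivAt_smear_lift {K : E d → E d →L[ℝ] E d} (hK : IsSmoothKernel K) {v : Torus d → E d}
    (hv : Integrable v) (y : E d) : ∃ D : E d →L[ℝ] E d,
      HasFDerivAt (fun y => smear K v (toTorus y)) D y ∧
      ∀ e, D e = - smear (fun z => fderiv ℝ K z e) v (toTorus y) := by
  have h := hK.comp_neg.hasCompactSupport.hasFDerivAt_convolution_right
    (ContinuousLinearMap.apply ℝ (E d)) (locallyIntegrable_lift hv)
    (hK.comp_neg.smooth.of_le (by simp)) y
  simp_rw [smear_lift]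
  refine ⟨_, h, fun e => ?_⟩
  rw [convolution_precompR_apply _ (locallyIntegrable_lift hv)
    (hK.comp_neg.hasCompactSupport.fderiv ℝ)
    (hK.comp_neg.smooth.continuous_fderiv (by simp))]
  rw [convolution, convolution, ← integral_neg]
  refine integral_congr_ae (Eventually.of_forall fun t => ?_)
  have h1 : HasFDerivAt (fun w => K (-w)) ((fderiv ℝ K (-(y - t))).comp
      (-ContinuousLinearMap.id ℝ (E d))) (y - t) :=
    ((hK.smooth.differentiable (by simp)) _).hasFDerivAt.comp (y - t) (hasFDerivAt_id _).neg
  simp [h1.fderiv]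

lemma partialDeriv_smear {K : E d → E d →L[ℝ] E d} (hK : IsSmoothKernel K) {v : Torus d → E d}
    (hv : Integrable v) (j : Fin d) (x : Torus d) :
    partialDeriv j (smear K v) x
      = - smear (fun z => fderiv ℝ K z (EuclideanSpace.single j 1)) v x := by
  set y₀ := torusRepr x with hy₀
  have hx : toTorus y₀ = x := toTorus_torusRepr x
  obtain ⟨D, hD, hDe⟩ := hasFDerivAt_smear_lift hK hv (y₀ + EuclideanSpace.single j (0 : ℝ))
  have h0 : y₀ + EuclideanSpace.single j (0 : ℝ) = y₀ := by
    have : (EuclideanSpace.single j (0 : ℝ) : E d) = 0 := by ext i; simp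
    rw [this, add_zero]
  have h := hD.comp_hasDerivAt (0 : ℝ) (hasDerivAt_line y₀ j)
  unfold partialDeriv
  rw [hDe, h0, hx] at h
  rw [← h.deriv]
  congr 1
  funext s
  simp only [Function.comp]
  rw [toTorus_add, hx]

lemma smear_eq_torus {K : E d → E d →L[ℝ] E d} (hK : IsSmoothKernel K) {v : Torus d → E d}
    (hv : Integrable v) (x : Torus d) :
    smear K v x = ∫ w, K (torusRepr (w - x)) (v w) := by
  rw [smear, integral_eq_integral_torusRepr (F := fun w => v (x + w)) hK.continuous hK.supp
    (integrable_translate hv x).1, ← integral_add_left_eq_self (μ := volume)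
    (fun w => K (torusRepr (w - x)) (v w)) x]
  simp_rw [add_sub_cancel_left]

lemma norm_smear_le {K : E d → E d →L[ℝ] E d} (hK : IsSmoothKernel K) {C : ℝ}
    (hC : ∀ z, ‖K z‖ ≤ C) {v : Torus d → E d} (hv : Integrable v) (x : Torus d) :
    ‖smear K v x‖ ≤ C * ∫ w, ‖v w‖ := by
  rw [smear_eq_torus hK hv, ← integral_const_mul]
  refine norm_integral_le_of_norm_le (hv.norm.const_mul C) (Eventually.of_forall fun w => ?_)
  exact ContinuousLinearMap.le_of_opNorm_le _ (hC _) _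

lemma integrable_smear_integrand {K : E d → E d →L[ℝ] E d} (hK : IsSmoothKernel K)
    {v : Torus d → E d} (hv : Integrable v) (x : Torus d) :
    Integrable fun z => K z (v (x + toTorus z)) := by
  have h := (locallyIntegrable_lift (integrable_translate hv x))
  obtain ⟨C, hC0, hC⟩ := hK.exists_bound
  have h1 := (h.integrableOn_isCompact (isCompact_closedBall (0 : E d) (1 / 4)))
  rw [← integrableOn_iff_integrable_of_support_subset (s := Metric.closedBall 0 (1 / 4))]
  · refine Integrable.mono' (h1.norm.const_mul C) ?_ (Eventually.of_forall fun z =>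
      ContinuousLinearMap.le_of_opNorm_le _ (hC _) _)
    exact (ContinuousLinearMap.apply ℝ (E d)).flip.aestronglyMeasurable_comp₂
      hK.continuous.aestronglyMeasurable h1.1
  · intro z hz
    by_contra hcon
    refine hz ?_
    simp only
    rw [hK.supp z (by simpa using hcon)]
    rfl

lemma smear_eq_ballMeasure {K : E d → E d →L[ℝ] E d} (hK : IsSmoothKernel K)
    (v : Torus d → E d) (x : Torus d) :
    smear K v x = ∫ z, K z (v (x + toTorus z)) ∂(ballMeasure d) := by
  rw [integral_ballMeasure]
  · rfl
  · intro z hz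
    rw [hK.supp z hz]; rfl

/-- A kernel whose divergence is a gradient maps divergence-free fields to such fields. -/
lemma sum_partialDeriv_smear {K : E d → E d →L[ℝ] E d} (hK : IsSmoothKernel K) {Θ : E d → ℝ}
    (hΘ : ContDiff ℝ (⊤ : ℕ∞) Θ) (hΘs : ∀ z, 1 / 4 < ‖z‖ → Θ z = 0)
    (hiso : ∀ z c, ∑ j, (fderiv ℝ K z (EuclideanSpace.single j 1) c) j = fderiv ℝ Θ z c)
    {v : Torus d → E d} (hv : Integrable v) (hdiv : WeakDivFree v) (x : Torus d) :
    ∑ j, (partialDeriv j (smear K v) x) j = 0 := by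
  have h := integral_fderiv_eq_zero_of_weakDivFree hΘ hΘs hv hdiv x
  simp_rw [← hiso] at h
  rw [integral_finsetSum _ fun j _ => ?_] at h
  · rw [← neg_eq_zero, ← h, ← Finset.sum_neg_distrib]
    refine Finset.sum_congr rfl fun j _ => ?_
    rw [partialDeriv_smear hK hv, PiLp.neg_apply, neg_neg, smear]
    exact ((EuclideanSpace.proj (𝕜 := ℝ) j).integral_comp_comm
      (integrable_smear_integrand (hK.fderiv_apply _) hv x)).symm
  · exact (EuclideanSpace.proj (𝕜 := ℝ) j).integrable_comp
      (integrable_smear_integrand (hK.fderiv_apply _) hv x)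

/-- Smearing turns weak continuity in time into pointwise continuity. -/
lemma continuousOn_smear {K : E d → E d →L[ℝ] E d} (hK : IsSmoothKernel K)
    {u : ℝ → Torus d → E d} {s : Set ℝ} (hu : ∀ t ∈ s, Integrable (u t))
    (hw : ∀ v : Torus d → E d, MemLp v 2 volume →
      ContinuousOn (fun t => ∫ x, inner ℝ (u t x) (v x)) s) (x : Torus d) :
    ContinuousOn (fun t => smear K (u t) x) s := by
  obtain ⟨C, hC0, hC⟩ := hK.exists_bound
  have hcoord : ∀ i, ContinuousOn (fun t => smear K (u t) x i) s := by
    intro i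
    let e : E d := EuclideanSpace.single i 1
    let v : Torus d → E d := fun w => ContinuousLinearMap.adjoint (K (torusRepr (w - x))) e
    have hv : MemLp v 2 volume := by
      refine MemLp.of_bound (C := C * ‖e‖) ?_ (Eventually.of_forall fun w => ?_)
      · have h1 : Continuous fun z => ContinuousLinearMap.adjoint (K z) e :=
          (ContinuousLinearMap.apply ℝ (E d) e).continuous.comp
            ((ContinuousLinearMap.adjoint (𝕜 := ℝ) (E := E d) (F := E d)).continuous.comp hK.continuous)
        exact (h1.comp_stronglyMeasurable ((measurable_torusRepr.comp
          (measurable_id.sub_const x)).stronglyMeasurable)).aestronglyMeasurable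
      · refine ContinuousLinearMap.le_of_opNorm_le _ ?_ _
        rw [LinearIsometryEquiv.norm_map]
        exact hC _
    refine (hw v hv).congr fun t ht => ?_
    have h2 : Integrable fun w => K (torusRepr (w - x)) (u t w) := by
      refine ((hu t ht).norm.const_mul C).mono' ?_ (Eventually.of_forall fun w =>
        ContinuousLinearMap.le_of_opNorm_le _ (hC _) _)
      exact (ContinuousLinearMap.apply ℝ (E d)).flip.aestronglyMeasurable_comp₂
        (hK.continuous.comp_stronglyMeasurable ((measurable_torusRepr.comp
          (measurable_id.sub_const x)).stronglyMeasurable)).aestronglyMeasurable (hu t ht).1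
    rw [smear_eq_torus hK (hu t ht)]
    refine ((EuclideanSpace.proj (𝕜 := ℝ) i).integral_comp_comm h2).symm.trans ?_
    refine integral_congr_ae (Eventually.of_forall fun w => ?_)
    simp only [v]
    rw [ContinuousLinearMap.adjoint_inner_right]
    simp [e, EuclideanSpace.inner_single_right]
  have : (fun t => smear K (u t) x)
      = fun t => WithLp.toLp 2 fun i => smear K (u t) x i := rfl
  rw [this]
  exact (PiLp.continuous_toLp 2 _).comp_continuousOn (continuousOn_pi.2 hcoord)

/-! ### Integrals over pairs of points -/

/-- The pairs `(x, x + z)` with `z` in the closed ball of radius `1/4`. -/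
abbrev pairMeasure (d : ℕ) : Measure (Torus d × E d) :=
  (volume : Measure (Torus d)).prod (ballMeasure d)

lemma memLp_pair_fst {F' : Type*} [NormedAddCommGroup F'] {p : ℝ≥0∞} {v : Torus d → F'}
    (hv : MemLp v p volume) : MemLp (fun q : Torus d × E d => v q.1) p (pairMeasure d) :=
  hv.comp_fst _

lemma memLp_pair_shift {F' : Type*} [NormedAddCommGroup F'] {p : ℝ≥0∞} {v : Torus d → F'}
    (hv : MemLp v p volume) :
    MemLp (fun q : Torus d × E d => v (q.1 + toTorus q.2)) p (pairMeasure d) :=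
  memLp_shift (measurable_torusShift measurable_toTorus) (fun z => measurePreserving_translate (toTorus z)) hv

lemma integrable_of_bilinear_bound {X F₁ F₂ : Type*} [MeasurableSpace X] {μ : Measure X}
    [NormedAddCommGroup F₁] [NormedAddCommGroup F₂] {a : X → F₁} {b : X → F₂} {F : X → ℝ} {C : ℝ}
    (ha : MemLp a 2 μ) (hb : MemLp b 2 μ) (hF : AEStronglyMeasurable F μ)
    (hle : ∀ x, |F x| ≤ C * (‖a x‖ * ‖b x‖)) : Integrable F μ :=
  ((MemLp.integrable_mul ha.norm hb.norm).const_mul C).mono' hF (Eventually.of_forall hle)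

lemma integrable_pair_inner {K : E d → E d →L[ℝ] E d} (hK : IsSmoothKernel K) {w : Torus d → E d}
    {v : Torus d × E d → E d} (hw : MemLp w 2 volume) (hv : MemLp v 2 (pairMeasure d)) :
    Integrable (fun q : Torus d × E d => inner ℝ (w q.1) (K q.2 (v q))) (pairMeasure d) := by
  obtain ⟨C, hC0, hC⟩ := hK.exists_bound
  refine integrable_of_bilinear_bound (C := C) (memLp_pair_fst hw) hv ?_ fun q => ?_
  · refine (memLp_pair_fst hw).1.inner ?_
    exact (ContinuousLinearMap.apply ℝ (E d)).flip.aestronglyMeasurable_comp₂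
      ((hK.continuous.comp continuous_snd).aestronglyMeasurable) hv.1
  · refine (abs_real_inner_le_norm _ _).trans ?_
    calc _ ≤ ‖w q.1‖ * (C * ‖v q‖) := by
          gcongr; exact ContinuousLinearMap.le_of_opNorm_le _ (hC _) _
      _ = _ := by ring

lemma integral_inner_smear {K : E d → E d →L[ℝ] E d} (hK : IsSmoothKernel K) {w v : Torus d → E d}
    (hw : MemLp w 2 volume) (hv : MemLp v 2 volume) :
    ∫ x, inner ℝ (w x) (smear K v x)
      = ∫ z, (∫ x, inner ℝ (w x) (K z (v (x + toTorus z)))) ∂(ballMeasure d) := by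
  have h := integrable_pair_inner hK hw (memLp_pair_shift hv)
  rw [← integral_integral_swap h]
  refine integral_congr_ae (Eventually.of_forall fun x => ?_)
  simp only
  rw [smear_eq_ballMeasure hK, ← integral_inner]
  exact (integrable_smear_integrand hK (hv.integrable (by norm_num)) x).restrict

/-- A symmetric kernel: even, with symmetric matrix values. -/
structure IsSymmKernel (K : E d → E d →L[ℝ] E d) : Prop extends IsSmoothKernel K where
  even : ∀ z, K (-z) = K z
  symm : ∀ z a b, inner ℝ a (K z b) = inner ℝ (K z a) b

lemma integral_inner_smear_comm {K : E d → E d →L[ℝ] E d} (hK : IsSymmKernel K)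
    {w v : Torus d → E d} (hw : MemLp w 2 volume) (hv : MemLp v 2 volume) :
    ∫ x, inner ℝ (w x) (smear K v x) = ∫ x, inner ℝ (v x) (smear K w x) := by
  rw [integral_inner_smear hK.toIsSmoothKernel hw hv, integral_inner_smear hK.toIsSmoothKernel hv hw,
    integral_integral_flip (fun z a b => inner ℝ a (K z b)) w v]
  refine integral_congr_ae (Eventually.of_forall fun z => ?_)
  refine integral_congr_ae (Eventually.of_forall fun x => ?_)
  simp only
  rw [hK.even, hK.symm, real_inner_comm]

/-! ### A product rule for weakly continuous bilinear quantities -/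

/-- If the increments of `B` over `[s, s']` are `∫ (H r s + H r s') dr`, where `H r` is continuous,
then the increments of `B` are the integrals of `2 H r r`: the product rule for `B t = b (x t, x t)`
with `b` symmetric and `x` only weakly continuous. -/
lemma sub_eq_integral_diag {B : ℝ → ℝ} {H : ℝ → ℝ → ℝ} {M : ℝ → ℝ} {T : ℝ} (hT : 0 ≤ T)
    (hM : IntervalIntegrable M volume 0 T)
    (hH : ∀ τ ∈ Icc 0 T, IntervalIntegrable (fun r => H r τ) volume 0 T)
    (hbd : ∀ᵐ r ∂(volume.restrict (Icc 0 T)), ∀ τ ∈ Icc 0 T, |H r τ| ≤ M r)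
    (hc : ∀ᵐ r ∂(volume.restrict (Icc 0 T)), ContinuousOn (H r) (Icc 0 T))
    (hB : ∀ s ∈ Icc 0 T, ∀ s' ∈ Icc 0 T, s ≤ s' → B s' - B s = ∫ r in s..s', (H r s + H r s')) :
    B T - B 0 = ∫ r in (0 : ℝ)..T, 2 * H r r := by
  rcases hT.eq_or_lt with rfl | hT
  · simp
  -- `lo n r` and `hi n r` are the endpoints of the cell containing `r` when `[0, T]` is divided into
  -- `n + 1` equal cells; the minimum with `T` matters only at `r = T`
  let lo : ℕ → ℝ → ℝ := fun n r => T * ⌊(n + 1) * r / T⌋₊ / (n + 1)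
  let hi : ℕ → ℝ → ℝ := fun n r => min T (T * (⌊(n + 1) * r / T⌋₊ + 1) / (n + 1))
  let F : ℕ → ℝ → ℝ := fun n r => H r (lo n r) + H r (hi n r)
  let g : ℕ → ℕ → ℝ := fun n i => T * i / (n + 1)
  have hg0 : ∀ n, g n 0 = 0 := fun n => by simp [g]
  have hgT : ∀ n, g n (n + 1) = T := fun n => by
    simp only [g]; push_cast; field_simp
  have hgm : ∀ n, Monotone (g n) := fun n i j hij => by
    simp only [g]; gcongr
  have hgmem : ∀ n i, i ≤ n + 1 → g n i ∈ Icc 0 T := fun n i hi => by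
    constructor
    · rw [← hg0 n]; exact hgm n (Nat.zero_le _)
    · rw [← hgT n]; exact hgm n hi
  have hFeq : ∀ n i, i < n + 1 → ∀ r ∈ Ioo (g n i) (g n (i + 1)),
      H r (g n i) + H r (g n (i + 1)) = F n r := by
    intro n i hi' r hr
    have hn : (0 : ℝ) < n + 1 := by positivity
    have hfl : ⌊(n + 1) * r / T⌋₊ = i := by
      rw [Nat.floor_eq_iff]
      · constructor
        · rw [le_div_iff₀ hT]
          have := hr.1.le
          simp only [g] at this
          rw [div_le_iff₀ hn] at this
          linarith
        · rw [div_lt_iff₀ hT]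
          have := hr.2
          simp only [g] at this
          rw [lt_div_iff₀ hn] at this
          push_cast at this
          linarith
      · have : 0 ≤ r := (hgmem n i hi'.le).1.trans hr.1.le
        positivity
    have h1 : lo n r = g n i := by simp only [lo, hfl, g]
    have h2 : hi n r = g n (i + 1) := by
      simp only [hi, hfl]
      rw [min_eq_right]
      · simp [g]
      · have := (hgmem n (i + 1) hi').2
        simpa [g] using this
    simp only [F, h1, h2]
  have hsub : ∀ n i, i < n + 1 → uIcc (g n i) (g n (i + 1)) ⊆ uIcc 0 T := by
    intro n i hi'
    rw [uIcc_of_le hT.le, uIcc_of_le (hgm n (Nat.le_succ i))]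
    exact Icc_subset_Icc (hgmem n i hi'.le).1 (hgmem n (i + 1) hi').2
  have hHi : ∀ n i, i < n + 1 → IntervalIntegrable
      (fun r => H r (g n i) + H r (g n (i + 1))) volume (g n i) (g n (i + 1)) := by
    intro n i hi'
    exact ((hH _ (hgmem n i hi'.le)).mono_set (hsub n i hi')).add
      ((hH _ (hgmem n (i + 1) hi')).mono_set (hsub n i hi'))
  have hFi : ∀ n i, i < n + 1 → IntervalIntegrable (F n) volume (g n i) (g n (i + 1)) := by
    intro n i hi'
    refine (hHi n i hi').congr_ae ?_
    rw [uIoc_of_le (hgm n (Nat.le_succ i)), ← restrict_Ioo_eq_restrict_Ioc]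
    exact (ae_restrict_iff' measurableSet_Ioo).2 (Eventually.of_forall (hFeq n i hi'))
  have hFint : ∀ n, IntervalIntegrable (F n) volume 0 T := by
    intro n
    have := IntervalIntegrable.trans_iterate (a := g n) (n := n + 1) (hFi n)
    rwa [hg0, hgT] at this
  -- the hypothesis on each cell, summed over the cells, telescopes
  have hFval : ∀ n, ∫ r in (0 : ℝ)..T, F n r = B T - B 0 := by
    intro n
    have h1 := intervalIntegral.sum_integral_adjacent_intervals (a := g n) (n := n + 1) (hFi n)
    rw [hg0, hgT] at h1
    rw [← h1]
    have h2 := Finset.sum_range_sub (fun i => B (g n i)) (n + 1)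
    rw [hg0, hgT] at h2
    rw [← h2]
    refine Finset.sum_congr rfl fun i hi' => ?_
    have hi' := Finset.mem_range.1 hi'
    rw [hB _ (hgmem n i hi'.le) _ (hgmem n (i + 1) hi') (hgm n (Nat.le_succ i)),
      intervalIntegral.integral_of_le (hgm n (Nat.le_succ i)),
      intervalIntegral.integral_of_le (hgm n (Nat.le_succ i)),
      ← restrict_Ioo_eq_restrict_Ioc]
    exact setIntegral_congr_fun measurableSet_Ioo fun r hr => (hFeq n i hi' r hr).symm
  -- both endpoints converge to `r`, so that `F n r` converges to `2 H r r`
  have hlo : ∀ n r, r ∈ Icc 0 T → lo n r ∈ Icc 0 T ∧ |lo n r - r| ≤ T * (1 / ((n : ℝ) + 1)) := by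
    intro n r hr
    have hn : (0 : ℝ) < n + 1 := by positivity
    have h0 : 0 ≤ (n + 1) * r / T := by have := hr.1; positivity
    have h1 := Nat.floor_le h0
    have h2 := Nat.lt_floor_add_one ((n + 1) * r / T)
    rw [le_div_iff₀ hT] at h1
    rw [div_lt_iff₀ hT] at h2
    have e1 : lo n r ≤ r := by
      simp only [lo]; rw [div_le_iff₀ hn]; linarith
    have e2 : r - T * (1 / ((n : ℝ) + 1)) ≤ lo n r := by
      have : r - T * (1 / ((n : ℝ) + 1)) = (r * (n + 1) - T) / (n + 1) := by field_simp
      rw [this]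
      simp only [lo]
      gcongr
      linarith
    refine ⟨⟨by simp only [lo]; positivity, e1.trans hr.2⟩, ?_⟩
    rw [abs_le]
    have : 0 ≤ T * (1 / ((n : ℝ) + 1)) := by positivity
    constructor <;> linarith
  have hhi : ∀ n r, r ∈ Icc 0 T → hi n r ∈ Icc 0 T ∧ |hi n r - r| ≤ T * (1 / ((n : ℝ) + 1)) := by
    intro n r hr
    have hn : (0 : ℝ) < n + 1 := by positivity
    have h0 : 0 ≤ (n + 1) * r / T := by have := hr.1; positivity
    have h1 := Nat.floor_le h0
    have h2 := Nat.lt_floor_add_one ((n + 1) * r / T)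
    rw [le_div_iff₀ hT] at h1
    rw [div_lt_iff₀ hT] at h2
    have e1 : r ≤ hi n r := by
      refine le_min hr.2 ?_
      rw [le_div_iff₀ hn]; linarith
    have e2 : hi n r ≤ r + T * (1 / ((n : ℝ) + 1)) := by
      refine (min_le_right _ _).trans ?_
      have : r + T * (1 / ((n : ℝ) + 1)) = (r * (n + 1) + T) / (n + 1) := by field_simp
      rw [this]
      gcongr
      linarith
    refine ⟨⟨hr.1.trans e1, min_le_left _ _⟩, ?_⟩
    rw [abs_le]
    have : 0 ≤ T * (1 / ((n : ℝ) + 1)) := by positivity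
    constructor <;> linarith
  have hsmall : Tendsto (fun n : ℕ => T * (1 / ((n : ℝ) + 1))) atTop (𝓝 0) := by
    simpa using tendsto_one_div_add_atTop_nhds_zero_nat.const_mul T
  have hconv : ∀ (a : ℕ → ℝ → ℝ), (∀ n r, r ∈ Icc 0 T → a n r ∈ Icc 0 T ∧
      |a n r - r| ≤ T * (1 / ((n : ℝ) + 1))) → ∀ r ∈ Icc 0 T,
      Tendsto (fun n => a n r) atTop (𝓝[Icc 0 T] r) := by
    intro a ha r hr
    refine tendsto_nhdsWithin_iff.2 ⟨?_, Eventually.of_forall fun n => (ha n r hr).1⟩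
    rw [tendsto_iff_norm_sub_tendsto_zero]
    exact squeeze_zero (fun n => norm_nonneg _) (fun n => (ha n r hr).2) hsmall
  have hIoc : volume.restrict (uIoc 0 T) = volume.restrict (Icc 0 T) := by
    rw [uIoc_of_le hT.le, restrict_Ioc_eq_restrict_Icc]
  have hlim : Tendsto (fun n => ∫ r in (0 : ℝ)..T, F n r) atTop
      (𝓝 (∫ r in (0 : ℝ)..T, 2 * H r r)) := by
    refine intervalIntegral.tendsto_integral_filter_of_dominated_convergence (fun r => 2 * M r)
      (Eventually.of_forall fun n => ?_) (Eventually.of_forall fun n => ?_) (hM.const_mul 2) ?_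
    · exact (intervalIntegrable_iff.1 (hFint n)).1
    · rw [← ae_restrict_iff' measurableSet_uIoc, hIoc]
      filter_upwards [hbd, ae_restrict_mem measurableSet_Icc] with r hr hrm
      have h1 := hr _ (hlo n r hrm).1
      have h2 := hr _ (hhi n r hrm).1
      simp only [F, Real.norm_eq_abs]
      linarith [abs_add_le (H r (lo n r)) (H r (hi n r))]
    · rw [← ae_restrict_iff' measurableSet_uIoc, hIoc]
      filter_upwards [hc, ae_restrict_mem measurableSet_Icc] with r hr hrm
      have h1 := (hr r hrm).tendsto.comp (hconv lo hlo r hrm)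
      have h2 := (hr r hrm).tendsto.comp (hconv hi hhi r hrm)
      rw [two_mul]
      exact h1.add h2
  simp_rw [hFval] at hlim
  exact tendsto_nhds_unique tendsto_const_nhds hlim

/-! ### Slices of space-time functions -/

lemma aemeasurable_eLpNorm_two_slice {X Y F' : Type*} [MeasurableSpace X] [MeasurableSpace Y]
    [NormedAddCommGroup F'] {μ : Measure X} {ν : Measure Y} [SFinite ν] {g : X × Y → F'}
    (hg : AEStronglyMeasurable g (μ.prod ν)) :
    AEMeasurable (fun t => eLpNorm (fun x => g (t, x)) 2 ν) μ := by
  simp_rw [eLpNorm_eq_lintegral_rpow_enorm_toReal (p := 2) (by norm_num) (by norm_num)]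
  exact ((hg.enorm.pow_const _).lintegral_prod_right').pow_const _

lemma intervalIntegrable_of_timeMeasure {F' : Type*} [NormedAddCommGroup F'] {F : ℝ → F'}
    (hF : Integrable F timeMeasure) {s t : ℝ} (hs : s ∈ Icc (0 : ℝ) 1) (ht : t ∈ Icc (0 : ℝ) 1) :
    IntervalIntegrable F volume s t := by
  have : IntegrableOn F (Icc 0 1) volume := hF
  rw [intervalIntegrable_iff]
  refine this.mono_set (uIoc_subset_uIcc.trans ?_)
  exact uIcc_subset_Icc hs ht

lemma ae_restrict_Icc_of_timeMeasure {p : ℝ → Prop} (h : ∀ᵐ t ∂timeMeasure, p t) {t : ℝ}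
    (ht : t ∈ Icc (0 : ℝ) 1) : ∀ᵐ r ∂(volume.restrict (Icc 0 t)), p r :=
  ae_restrict_of_ae_restrict_of_subset (Icc_subset_Icc_right ht.2) h

lemma ae_uIoc_of_timeMeasure {p : ℝ → Prop} (h : ∀ᵐ t ∂timeMeasure, p t) {s t : ℝ}
    (hs : s ∈ Icc (0 : ℝ) 1) (ht : t ∈ Icc (0 : ℝ) 1) : ∀ᵐ r, r ∈ uIoc s t → p r := by
  rw [← ae_restrict_iff' measurableSet_uIoc]
  exact ae_restrict_of_ae_restrict_of_subset
    (uIoc_subset_uIcc.trans (uIcc_subset_Icc hs ht)) h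

namespace IsLerayHopfWith

variable {ν : ℝ} {u₀ : Torus d → E d} {f u : ℝ → Torus d → E d} {G : ℝ → Torus d → Fin d → E d}
  (h : IsLerayHopfWith ν u₀ f u G)
include h

lemma integrable_slice {t : ℝ} (ht : t ∈ Icc (0 : ℝ) 1) : Integrable (u t) :=
  (h.memLp t ht).integrable (by norm_num)

lemma memLp_force : ∀ᵐ t ∂timeMeasure, MemLp (f t) 2 volume := by
  have h1 : ∀ᵐ t ∂timeMeasure, eLpNorm (f t) 2 volume < ⊤ := by
    refine ae_lt_top' (aemeasurable_eLpNorm_two_slice (μ := timeMeasure) (ν := volume)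
      (g := fun z : ℝ × Torus d => f z.1 z.2) h.force_meas) ?_
    have := h.force_L1L2
    rw [normLqL2, eLpNorm_one_eq_lintegral_enorm] at this
    simpa using this.ne
  filter_upwards [h1, h.force_meas.prodMk_left] with t h1 h2
  exact ⟨h2, h1⟩

lemma integrable_force : Integrable (fun z : ℝ × Torus d => f z.1 z.2) (spaceTime d) := by
  refine ⟨h.force_meas, ?_⟩
  rw [hasFiniteIntegral_iff_enorm, spaceTime, lintegral_prod _ h.force_meas.enorm]
  have := h.force_L1L2
  rw [normLqL2, eLpNorm_one_eq_lintegral_enorm] at this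
  refine lt_of_le_of_lt (lintegral_mono_ae ?_) this
  filter_upwards [h.force_meas.prodMk_left] with t ht
  simp only [enorm_eq_self]
  rw [← eLpNorm_one_eq_lintegral_enorm]
  exact eLpNorm_le_eLpNorm_of_exponent_le (by norm_num) ht

lemma memLp_spaceTime : MemLp (fun z : ℝ × Torus d => u z.1 z.2) 2 (spaceTime d) := by
  refine ⟨h.meas, ?_⟩
  obtain ⟨M, hM⟩ := h.bounded
  rw [eLpNorm_lt_top_iff_lintegral_rpow_enorm_lt_top (by norm_num) (by norm_num), spaceTime,
    lintegral_prod _ (h.meas.enorm.pow_const _)]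
  have : ∀ t ∈ Icc (0 : ℝ) 1, ∫⁻ x, ‖u t x‖ₑ ^ (2 : ℝ≥0∞).toReal ≤ (M : ℝ≥0∞) ^ (2 : ℝ) := by
    intro t ht
    have h1 := hM t ht
    rw [eLpNorm_eq_lintegral_rpow_enorm_toReal (by norm_num) (by norm_num)] at h1
    rw [one_div, ENNReal.rpow_inv_le_iff (by norm_num)] at h1
    exact h1
  refine (lintegral_mono_ae (g := fun _ => (M : ℝ≥0∞) ^ (2 : ℝ)) ?_).trans_lt ?_
  · exact (ae_restrict_iff' measurableSet_Icc).2 (Eventually.of_forall this)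
  · rw [lintegral_const]
    exact ENNReal.mul_lt_top (by simp) (measure_lt_top _ _)

lemma memLp_gradient (j : Fin d) : ∀ᵐ t ∂timeMeasure, MemLp (fun x => G t x j) 2 volume := by
  have h1 := (h.grad_memLp j).2
  rw [eLpNorm_lt_top_iff_lintegral_rpow_enorm_lt_top (by norm_num) (by norm_num), spaceTime,
    lintegral_prod _ ((h.grad_memLp j).1.enorm.pow_const _)] at h1
  have h2 := ae_lt_top' (((h.grad_memLp j).1.enorm.pow_const _).lintegral_prod_right') h1.ne
  filter_upwards [h2, (h.grad_memLp j).1.prodMk_left] with t h3 h4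
  exact ⟨h4, by
    rwa [eLpNorm_lt_top_iff_lintegral_rpow_enorm_lt_top (by norm_num) (by norm_num)]⟩

end IsLerayHopfWith

/-! ### The momentum balance against a smeared field -/

/-- The integrand of the momentum balance: `a` stands for the test field and `b j` for its `j`-th
partial derivative. -/
def momentumIntegrand (ν : ℝ) (a : E d) (b : Fin d → E d) (F U : E d) (g : Fin d → E d) : ℝ :=
  inner ℝ a F + (∑ i, ∑ j, b j i * U i * U j) - ν * ∑ j, inner ℝ (b j) (g j)

/-- The rate of change of `⟨φ, u⟩` for a steady divergence-free field `φ`. -/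
def momentumForm (ν : ℝ) (f u : Torus d → E d) (G : Torus d → Fin d → E d) (φ : Torus d → E d) : ℝ :=
  ∫ x, momentumIntegrand ν (φ x) (fun j => partialDeriv j φ x) (f x) (u x) (G x)

/-- A bound for `momentumIntegrand` with unit test data. -/
def momentumBound (ν : ℝ) (F U : E d) (g : Fin d → E d) : ℝ :=
  ‖F‖ + d * (d * ‖U‖ ^ 2) + |ν| * ∑ j, ‖g j‖

lemma abs_momentumIntegrand_le {ν C : ℝ} (hC : 0 ≤ C) {a : E d} {b : Fin d → E d} (ha : ‖a‖ ≤ C)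
    (hb : ∀ j, ‖b j‖ ≤ C) (F U : E d) (g : Fin d → E d) :
    |momentumIntegrand ν a b F U g| ≤ C * momentumBound ν F U g := by
  have h1 : |inner ℝ a F| ≤ C * ‖F‖ :=
    (abs_real_inner_le_norm _ _).trans (by gcongr)
  have h2 : |∑ i, ∑ j, b j i * U i * U j| ≤ C * (d * (d * ‖U‖ ^ 2)) := by
    refine (Finset.abs_sum_le_sum_abs _ _).trans ?_
    calc _ ≤ ∑ i : Fin d, ∑ j : Fin d, C * ‖U‖ ^ 2 := by
          refine Finset.sum_le_sum fun i _ => (Finset.abs_sum_le_sum_abs _ _).trans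
            (Finset.sum_le_sum fun j _ => ?_)
          rw [abs_mul, abs_mul]
          have e1 := (PiLp.norm_apply_le (b j) i).trans (hb j)
          have e2 := PiLp.norm_apply_le U i
          have e3 := PiLp.norm_apply_le U j
          rw [Real.norm_eq_abs] at e1 e2 e3
          calc _ ≤ C * ‖U‖ * ‖U‖ := by gcongr
            _ = _ := by ring
      _ = _ := by simp; ring
  have h3 : |∑ j, inner ℝ (b j) (g j)| ≤ C * ∑ j, ‖g j‖ := by
    refine (Finset.abs_sum_le_sum_abs _ _).trans ?_
    rw [Finset.mul_sum]
    refine Finset.sum_le_sum fun j _ => (abs_real_inner_le_norm _ _).trans ?_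
    gcongr
    exact hb j
  unfold momentumIntegrand momentumBound
  have h4 : |ν * ∑ j, inner ℝ (b j) (g j)| ≤ |ν| * (C * ∑ j, ‖g j‖) := by
    rw [abs_mul]; gcongr
  refine (abs_sub _ _).trans ?_
  have h5 := abs_add_le (inner ℝ a F) (∑ i, ∑ j, b j i * U i * U j)
  linarith

lemma aestronglyMeasurable_momentumIntegrand {X : Type*} [MeasurableSpace X] {μ : Measure X}
    (ν : ℝ) {a F U : X → E d} {b g : X → Fin d → E d} (ha : AEStronglyMeasurable a μ)
    (hb : ∀ j, AEStronglyMeasurable (fun x => b x j) μ) (hF : AEStronglyMeasurable F μ)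
    (hU : AEStronglyMeasurable U μ) (hg : ∀ j, AEStronglyMeasurable (fun x => g x j) μ) :
    AEStronglyMeasurable (fun x => momentumIntegrand ν (a x) (b x) (F x) (U x) (g x)) μ := by
  unfold momentumIntegrand
  have hcoord : ∀ {V : X → E d}, AEStronglyMeasurable V μ → ∀ i,
      AEStronglyMeasurable (fun x => V x i) μ := fun hV i =>
    (EuclideanSpace.proj (𝕜 := ℝ) i).continuous.comp_aestronglyMeasurable hV
  refine ((ha.inner hF).add (Finset.aestronglyMeasurable_fun_sum _ fun i _ =>
    Finset.aestronglyMeasurable_fun_sum _ fun j _ => ?_)).sub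
      ((Finset.aestronglyMeasurable_fun_sum _ fun j _ => (hb j).inner (hg j)).const_mul ν)
  exact ((hcoord (hb j) i).mul (hcoord hU i)).mul (hcoord hU j)

lemma measurable_of_smoothOnTorus {φ : Torus d → E d} (hφ : SmoothOnTorus φ) : Measurable φ := by
  have : φ = (fun y => φ (toTorus y)) ∘ torusRepr := by
    ext1 x; simp [toTorus_torusRepr]
  rw [this]
  exact (ContDiff.continuous hφ).measurable.comp measurable_torusRepr

lemma measurable_smear {K : E d → E d →L[ℝ] E d} (hK : IsSmoothKernel K) {v : Torus d → E d}
    (hv : Integrable v) : Measurable (smear K v) :=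
  measurable_of_smoothOnTorus (smoothOnTorus_smear hK hv)

lemma measurable_partialDeriv_smear {K : E d → E d →L[ℝ] E d} (hK : IsSmoothKernel K)
    {v : Torus d → E d} (hv : Integrable v) (j : Fin d) :
    Measurable (partialDeriv j (smear K v)) := by
  have : partialDeriv j (smear K v)
      = fun x => - smear (fun z => fderiv ℝ K z (EuclideanSpace.single j 1)) v x :=
    funext (partialDeriv_smear hK hv j)
  rw [this]
  exact (measurable_smear (hK.fderiv_apply _) hv).neg

lemma exists_bound_smear {K : E d → E d →L[ℝ] E d} (hK : IsSmoothKernel K) (S : ℝ) (hS : 0 ≤ S) :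
    ∃ C, 0 ≤ C ∧ ∀ v : Torus d → E d, Integrable v → ∫ x, ‖v x‖ ≤ S → ∀ x,
      ‖smear K v x‖ ≤ C ∧ ∀ j, ‖partialDeriv j (smear K v) x‖ ≤ C := by
  obtain ⟨C, hC0, hC⟩ := hK.exists_bound
  choose D hD0 hD using fun j : Fin d =>
    (hK.fderiv_apply (EuclideanSpace.single j 1)).exists_bound
  have hsum : ∀ j, D j ≤ ∑ j, D j := fun j =>
    Finset.single_le_sum (f := D) (fun i _ => hD0 i) (Finset.mem_univ j)
  have hsum0 : 0 ≤ ∑ j, D j := Finset.sum_nonneg fun i _ => hD0 i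
  refine ⟨(C + ∑ j, D j) * S, by positivity, fun v hv hvS x => ⟨?_, fun j => ?_⟩⟩
  · refine (norm_smear_le hK hC hv x).trans ?_
    have : 0 ≤ ∫ x, ‖v x‖ := integral_nonneg fun _ => norm_nonneg _
    gcongr
    linarith
  · rw [partialDeriv_smear hK hv, norm_neg]
    refine (norm_smear_le (hK.fderiv_apply _) (hD j) hv x).trans ?_
    have : 0 ≤ ∫ x, ‖v x‖ := integral_nonneg fun _ => norm_nonneg _
    gcongr
    linarith [hsum j]

/-- A symmetric kernel whose divergence is a gradient; it preserves divergence-free fields. -/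
structure IsSolenoidalKernel (K : E d → E d →L[ℝ] E d) : Prop extends IsSymmKernel K where
  div_eq_grad : ∃ Θ : E d → ℝ, ContDiff ℝ (⊤ : ℕ∞) Θ ∧ (∀ z, 1 / 4 < ‖z‖ → Θ z = 0) ∧
    ∀ z c, ∑ j, (fderiv ℝ K z (EuclideanSpace.single j 1) c) j = fderiv ℝ Θ z c

namespace IsLerayHopfWith

variable {ν : ℝ} {u₀ : Torus d → E d} {f u : ℝ → Torus d → E d} {G : ℝ → Torus d → Fin d → E d}
  (h : IsLerayHopfWith ν u₀ f u G)
include h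

lemma integrable_momentumBound :
    Integrable (fun z : ℝ × Torus d => momentumBound ν (f z.1 z.2) (u z.1 z.2) (G z.1 z.2))
      (spaceTime d) := by
  unfold momentumBound
  refine (h.integrable_force.norm.add ?_).add ((integrable_finsetSum _ fun j _ => ?_).const_mul _)
  · exact ((h.memLp_spaceTime.integrable_norm_pow (by norm_num)).const_mul _).const_mul _
  · exact ((h.grad_memLp j).integrable (by norm_num)).norm

lemma exists_integral_norm_le : ∃ S : ℝ, 0 ≤ S ∧ ∀ t ∈ Icc (0 : ℝ) 1, ∫ x, ‖u t x‖ ≤ S := by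
  obtain ⟨M, hM⟩ := h.bounded
  refine ⟨M, M.2, fun t ht => ?_⟩
  have h1 : eLpNorm (u t) 1 volume ≤ M :=
    (eLpNorm_le_eLpNorm_of_exponent_le (by norm_num) (h.memLp t ht).1).trans (hM t ht)
  rw [integral_norm_eq_lintegral_enorm (h.memLp t ht).1, ← eLpNorm_one_eq_lintegral_enorm]
  exact ENNReal.toReal_le_of_le_ofReal M.2 (by simpa using h1)

lemma integrable_momentumIntegrand {φ : Torus d → E d} {C : ℝ} (hC : 0 ≤ C) (hm : Measurable φ)
    (hm' : ∀ j, Measurable (partialDeriv j φ))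
    (hφ : ∀ x, ‖φ x‖ ≤ C ∧ ∀ j, ‖partialDeriv j φ x‖ ≤ C) :
    Integrable (fun z : ℝ × Torus d => momentumIntegrand ν (φ z.2) (fun j => partialDeriv j φ z.2)
      (f z.1 z.2) (u z.1 z.2) (G z.1 z.2)) (spaceTime d) := by
  refine (h.integrable_momentumBound.const_mul C).mono' ?_ (Eventually.of_forall fun z =>
    abs_momentumIntegrand_le hC (hφ _).1 (hφ _).2 _ _ _)
  exact aestronglyMeasurable_momentumIntegrand ν (hm.comp measurable_snd).aestronglyMeasurable
    (fun j => ((hm' j).comp measurable_snd).aestronglyMeasurable) h.force_meas h.meas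
    fun j => (h.grad_memLp j).1

/-- The momentum equation tested with a smooth divergence-free field that does not depend on time. -/
lemma momentum_steady {φ : Torus d → E d} {C : ℝ} (hC : 0 ≤ C) (hs : SmoothOnTorus φ)
    (hdiv : ∀ x, ∑ j, (partialDeriv j φ x) j = 0) (hm' : ∀ j, Measurable (partialDeriv j φ))
    (hφ : ∀ x, ‖φ x‖ ≤ C ∧ ∀ j, ‖partialDeriv j φ x‖ ≤ C) {t : ℝ} (ht : t ∈ Icc (0 : ℝ) 1) :
    (∫ x, inner ℝ (φ x) (u t x)) - (∫ x, inner ℝ (φ x) (u₀ x))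
      = ∫ r in (0 : ℝ)..t, momentumForm ν (f r) (u r) (G r) φ := by
  have hm := measurable_of_smoothOnTorus hs
  have hS : SmoothSpaceTime (fun _ : ℝ => φ) := hs.comp contDiff_snd
  have hmom := h.momentum (fun _ => φ) hS (fun _ x => hdiv x) t ht
  have hI := h.integrable_momentumIntegrand hC hm hm' hφ
  have hf : Integrable (fun z : ℝ × Torus d => inner ℝ (φ z.2) (f z.1 z.2)) (spaceTime d) := by
    refine (h.integrable_force.norm.const_mul C).mono'
      ((hm.comp measurable_snd).aestronglyMeasurable.inner h.force_meas)
      (Eventually.of_forall fun z => ?_)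
    exact (abs_real_inner_le_norm _ _).trans (by gcongr; exact (hφ _).1)
  have e : ∀ r, ∀ᵐ x ∂(volume : Measure (Torus d)), (- inner ℝ (deriv (fun _ : ℝ => φ x) r) (u r x)
              - (∑ i, ∑ j, partialDeriv j φ x i * u r x i * u r x j)
              + ν * ∑ j, inner ℝ (partialDeriv j φ x) (G r x j))
      = inner ℝ (φ x) (f r x) - momentumIntegrand ν (φ x) (fun j => partialDeriv j φ x)
        (f r x) (u r x) (G r x) := fun r => Eventually.of_forall fun x => by
    simp only [deriv_const, inner_zero_left, momentumIntegrand]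
    ring
  have hr : ∀ᵐ r ∂timeMeasure, (∫ x, (- inner ℝ (deriv (fun _ : ℝ => φ x) r) (u r x)
              - (∑ i, ∑ j, partialDeriv j φ x i * u r x i * u r x j)
              + ν * ∑ j, inner ℝ (partialDeriv j φ x) (G r x j)))
      = (∫ x, inner ℝ (φ x) (f r x)) - momentumForm ν (f r) (u r) (G r) φ := by
    filter_upwards [hI.prod_right_ae, hf.prod_right_ae] with r h1 h2
    rw [integral_congr_ae (e r), integral_sub h2 h1]
    rfl
  have h0 : (0 : ℝ) ∈ Icc (0 : ℝ) 1 := by simp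
  have hi1 : IntervalIntegrable (fun r => ∫ x, inner ℝ (φ x) (f r x)) volume 0 t :=
    intervalIntegrable_of_timeMeasure hf.integral_prod_left h0 ht
  have hi2 : IntervalIntegrable (fun r => momentumForm ν (f r) (u r) (G r) φ) volume 0 t :=
    intervalIntegrable_of_timeMeasure hI.integral_prod_left h0 ht
  rw [intervalIntegral.integral_congr_ae (ae_uIoc_of_timeMeasure hr h0 ht),
    intervalIntegral.integral_sub hi1 hi2] at hmom
  linarith

/-- The balance of the smeared kinetic energy. The test field is `smear K (u τ)` with `τ` frozen at an
endpoint of a time interval; the two endpoints are combined by the symmetry of `K`. -/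
theorem smeared_energy_balance {K : E d → E d →L[ℝ] E d} (hK : IsSolenoidalKernel K) {t : ℝ}
    (ht : t ∈ Icc (0 : ℝ) 1) :
    (∫ x, inner ℝ (u t x) (smear K (u t) x)) - (∫ x, inner ℝ (u 0 x) (smear K (u 0) x))
      = ∫ r in (0 : ℝ)..t, 2 * momentumForm ν (f r) (u r) (G r) (smear K (u r)) := by
  have hsub : Icc (0 : ℝ) t ⊆ Icc 0 1 := Icc_subset_Icc_right ht.2
  have h0 : (0 : ℝ) ∈ Icc (0 : ℝ) 1 := by simp
  obtain ⟨S, hS0, hS⟩ := h.exists_integral_norm_le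
  obtain ⟨C, hC0, hC⟩ := exists_bound_smear hK.toIsSmoothKernel S hS0
  obtain ⟨Θ, hΘ, hΘs, hiso⟩ := hK.div_eq_grad
  have hb : ∀ τ ∈ Icc (0 : ℝ) 1, ∀ x, ‖smear K (u τ) x‖ ≤ C ∧
      ∀ j, ‖partialDeriv j (smear K (u τ)) x‖ ≤ C := fun τ hτ =>
    hC _ (h.integrable_slice hτ) (hS τ hτ)
  have hmes := fun τ (hτ : τ ∈ Icc (0 : ℝ) 1) =>
    measurable_smear hK.toIsSmoothKernel (h.integrable_slice hτ)
  have hmes' := fun τ (hτ : τ ∈ Icc (0 : ℝ) 1) =>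
    measurable_partialDeriv_smear hK.toIsSmoothKernel (h.integrable_slice hτ)
  have hint := fun τ (hτ : τ ∈ Icc (0 : ℝ) 1) =>
    h.integrable_momentumIntegrand hC0 (hmes τ hτ) (hmes' τ hτ) (hb τ hτ)
  have hcross : ∀ s ∈ Icc (0 : ℝ) 1, ∀ τ ∈ Icc (0 : ℝ) 1,
      (∫ x, inner ℝ (smear K (u τ) x) (u s x)) - (∫ x, inner ℝ (smear K (u τ) x) (u₀ x))
        = ∫ r in (0 : ℝ)..s, momentumForm ν (f r) (u r) (G r) (smear K (u τ)) := by
    intro s hs τ hτ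
    exact h.momentum_steady hC0 (smoothOnTorus_smear hK.toIsSmoothKernel (h.integrable_slice hτ))
      (sum_partialDeriv_smear hK.toIsSmoothKernel hΘ hΘs hiso (h.integrable_slice hτ)
        (h.div_free τ hτ)) (hmes' τ hτ) (hb τ hτ) hs
  have hii : ∀ τ ∈ Icc (0 : ℝ) 1, ∀ s ∈ Icc (0 : ℝ) 1, ∀ s' ∈ Icc (0 : ℝ) 1, IntervalIntegrable
      (fun r => momentumForm ν (f r) (u r) (G r) (smear K (u τ))) volume s s' :=
    fun τ hτ s hs s' hs' =>
      intervalIntegrable_of_timeMeasure (hint τ hτ).integral_prod_left hs hs'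
  have hcross2 : ∀ s ∈ Icc (0 : ℝ) 1, ∀ s' ∈ Icc (0 : ℝ) 1, ∀ τ ∈ Icc (0 : ℝ) 1,
      (∫ x, inner ℝ (u s' x) (smear K (u τ) x)) - (∫ x, inner ℝ (u s x) (smear K (u τ) x))
        = ∫ r in s..s', momentumForm ν (f r) (u r) (G r) (smear K (u τ)) := by
    intro s hs s' hs' τ hτ
    rw [← intervalIntegral.integral_interval_sub_left (hii τ hτ 0 h0 s' hs') (hii τ hτ 0 h0 s hs),
      ← hcross s hs τ hτ, ← hcross s' hs' τ hτ]
    simp_rw [real_inner_comm]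
    ring
  refine sub_eq_integral_diag (B := fun t => ∫ x, inner ℝ (u t x) (smear K (u t) x))
    (H := fun r τ => momentumForm ν (f r) (u r) (G r) (smear K (u τ)))
    (M := fun r => ∫ x, C * momentumBound ν (f r x) (u r x) (G r x)) ht.1 ?_ ?_ ?_ ?_ ?_
  · exact intervalIntegrable_of_timeMeasure
      (h.integrable_momentumBound.const_mul C).integral_prod_left h0 ht
  · exact fun τ hτ => hii τ (hsub hτ) 0 h0 t ht
  · refine ae_restrict_Icc_of_timeMeasure ?_ ht
    filter_upwards [(h.integrable_momentumBound.const_mul C).prod_right_ae] with r hr τ hτ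
    rw [← Real.norm_eq_abs, momentumForm]
    exact norm_integral_le_of_norm_le hr (Eventually.of_forall fun x => by
      rw [Real.norm_eq_abs]
      exact abs_momentumIntegrand_le hC0 (hb τ (hsub hτ) x).1 (hb τ (hsub hτ) x).2 _ _ _)
  · refine ae_restrict_Icc_of_timeMeasure ?_ ht
    have hgm : ∀ᵐ r ∂timeMeasure, ∀ j, AEStronglyMeasurable (fun x => G r x j) volume :=
      ae_all_iff.2 fun j => (h.grad_memLp j).1.prodMk_left
    filter_upwards [(h.integrable_momentumBound.const_mul C).prod_right_ae,
      h.force_meas.prodMk_left, h.meas.prodMk_left, hgm] with r hr hrf hru hrG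
    refine continuousOn_of_dominated (bound := fun x => C * momentumBound ν (f r x) (u r x) (G r x))
      (fun τ hτ => ?_) (fun τ hτ => Eventually.of_forall fun x =>
        abs_momentumIntegrand_le hC0 (hb τ (hsub hτ) x).1 (hb τ (hsub hτ) x).2 _ _ _) hr
      (Eventually.of_forall fun x => ?_)
    · exact aestronglyMeasurable_momentumIntegrand ν (hmes τ (hsub hτ)).aestronglyMeasurable
        (fun j => (hmes' τ (hsub hτ) j).aestronglyMeasurable) hrf hru hrG
    · have hw : ∀ v : Torus d → E d, MemLp v 2 volume →
          ContinuousOn (fun t => ∫ x, inner ℝ (u t x) (v x)) (Icc 0 t) := fun v hv =>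
        (h.weak_cont v hv).mono hsub
      have c1 := continuousOn_smear hK.toIsSmoothKernel
        (fun τ hτ => h.integrable_slice (hsub hτ)) hw x
      have c2 : ∀ j, ContinuousOn (fun τ => partialDeriv j (smear K (u τ)) x) (Icc 0 t) := by
        intro j
        refine (continuousOn_smear (hK.fderiv_apply (EuclideanSpace.single j 1))
          (fun τ hτ => h.integrable_slice (hsub hτ)) hw x).neg.congr fun τ hτ => ?_
        exact partialDeriv_smear hK.toIsSmoothKernel (h.integrable_slice (hsub hτ)) j x
      unfold momentumIntegrand
      have c3 : ∀ i j, ContinuousOn (fun τ => partialDeriv j (smear K (u τ)) x i) (Icc 0 t) :=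
        fun i j => (EuclideanSpace.proj (𝕜 := ℝ) i).continuous.comp_continuousOn (c2 j)
      refine ((c1.inner continuousOn_const).add (continuousOn_finsetSum _ fun i _ =>
        continuousOn_finsetSum _ fun j _ => ?_)).sub (continuousOn_const.mul
          (continuousOn_finsetSum _ fun j _ => (c2 j).inner continuousOn_const))
      exact ((c3 i j).mul continuousOn_const).mul continuousOn_const
  · intro s hs s' hs' _
    have hs1 := hsub hs
    have hs1' := hsub hs'
    rw [intervalIntegral.integral_add (hii s hs1 s hs1 s' hs1') (hii s' hs1' s hs1 s' hs1'),
      ← hcross2 s hs1 s' hs1' s hs1, ← hcross2 s hs1 s' hs1' s' hs1',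
      integral_inner_smear_comm hK.toIsSymmKernel (h.memLp s hs1) (h.memLp s' hs1')]
    ring

end IsLerayHopfWith

/-! ### Kernel integrals of a fixed field -/

/-- The increment `v(· + z) - v`. -/
def incr (z : E d) (v : Torus d → E d) (x : Torus d) : E d := v (x + toTorus z) - v x

lemma memLp_incr {p : ℝ≥0∞} {v : Torus d → E d} (hv : MemLp v p volume) (z : E d) :
    MemLp (incr z v) p volume :=
  (memLp_translate hv _).sub hv

lemma memLp_pair_incr {p : ℝ≥0∞} {v : Torus d → E d} (hv : MemLp v p volume) :
    MemLp (fun q : Torus d × E d => incr q.2 v q.1) p (pairMeasure d) :=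
  (memLp_pair_shift hv).sub (memLp_pair_fst hv)

lemma integrable_apply_const {K : E d → E d →L[ℝ] E d} (hK : IsSmoothKernel K) (b : E d) :
    Integrable (fun z => K z b) (ballMeasure d) := by
  obtain ⟨C, hC0, hC⟩ := hK.exists_bound
  refine Integrable.of_bound (C := C * ‖b‖) ?_ (Eventually.of_forall fun z =>
    ContinuousLinearMap.le_of_opNorm_le _ (hC _) _)
  exact (hK.continuous.clm_apply continuous_const).aestronglyMeasurable

/-- Splitting off the mean of the kernel. -/
lemma smear_eq_add_incr {K : E d → E d →L[ℝ] E d} (hK : IsSmoothKernel K) {c : ℝ}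
    (hc : ∀ b, ∫ z, K z b ∂(ballMeasure d) = c • b) {v : Torus d → E d} (hv : Integrable v)
    (x : Torus d) : smear K v x = c • v x + ∫ z, K z (incr z v x) ∂(ballMeasure d) := by
  rw [smear_eq_ballMeasure hK, ← hc (v x), ← integral_add (integrable_apply_const hK _)]
  · refine integral_congr_ae (Eventually.of_forall fun z => ?_)
    simp [incr]
  · simp only [incr, map_sub]
    exact (integrable_smear_integrand hK hv x).restrict.sub (integrable_apply_const hK _)

lemma integral_inner_smear_eq_add_incr {K : E d → E d →L[ℝ] E d} (hK : IsSmoothKernel K) {c : ℝ}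
    (hc : ∀ b, ∫ z, K z b ∂(ballMeasure d) = c • b) {w v : Torus d → E d}
    (hw : MemLp w 2 volume) (hv : MemLp v 2 volume) :
    ∫ x, inner ℝ (w x) (smear K v x) = c * (∫ x, inner ℝ (w x) (v x))
      + ∫ z, (∫ x, inner ℝ (w x) (K z (incr z v x))) ∂(ballMeasure d) := by
  have hv1 : Integrable v := hv.integrable (by norm_num)
  have h := integrable_pair_inner hK hw (memLp_pair_incr hv)
  have hwv : Integrable fun x => inner ℝ (w x) (v x) :=
    integrable_of_bilinear_bound (C := 1) hw hv (hw.1.inner hv.1) fun x => by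
      rw [one_mul]; exact abs_real_inner_le_norm _ _
  rw [← integral_integral_swap h, ← integral_const_mul, ← integral_add (hwv.const_mul c)
    h.integral_prod_left]
  refine integral_congr_ae (Eventually.of_forall fun x => ?_)
  simp only
  rw [smear_eq_add_incr hK hc hv1, inner_add_right, inner_smul_right, ← integral_inner]
  simp only [incr, map_sub]
  exact (integrable_smear_integrand hK hv1 x).restrict.sub (integrable_apply_const hK _)

/-- The smeared energy in terms of the quadratic increments. -/
lemma integral_inner_smear_self {K : E d → E d →L[ℝ] E d} (hK : IsSymmKernel K) {c : ℝ}
    (hc : ∀ b, ∫ z, K z b ∂(ballMeasure d) = c • b) {v : Torus d → E d} (hv : MemLp v 2 volume) :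
    ∫ x, inner ℝ (v x) (smear K v x) = c * (∫ x, ‖v x‖ ^ 2)
      - (1 / 2) * ∫ z, (∫ x, inner ℝ (incr z v x) (K z (incr z v x))) ∂(ballMeasure d) := by
  have hS := hK.toIsSmoothKernel
  rw [integral_inner_smear_eq_add_incr hS hc hv hv]
  simp_rw [real_inner_self_eq_norm_sq]
  have key : ∫ z, (∫ x, inner ℝ (incr z v x) (K z (incr z v x))) ∂(ballMeasure d)
      = ∫ z, (-2) * (∫ x, inner ℝ (v x) (K z (incr z v x))) ∂(ballMeasure d) := by
    refine integral_congr_ae (Eventually.of_forall fun z => ?_)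
    simp only
    have hb : ∀ {a b : Torus d → E d}, MemLp a 2 volume → MemLp b 2 volume →
        Integrable fun x => inner ℝ (a x) (K z (b x)) := fun {a b} ha hb => by
      refine integrable_of_bilinear_bound (C := ‖K z‖) ha hb
        (ha.1.inner ((K z).continuous.comp_aestronglyMeasurable hb.1)) fun x => ?_
      refine (abs_real_inner_le_norm _ _).trans ?_
      calc _ ≤ ‖a x‖ * (‖K z‖ * ‖b x‖) := by gcongr; exact (K z).le_opNorm _
        _ = _ := by ring
    have hT := memLp_translate hv (toTorus z)
    have e1 : ∫ x, inner ℝ (v (x + toTorus z)) (K z (v (x + toTorus z)))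
        = ∫ x, inner ℝ (v x) (K z (v x)) :=
      integral_add_right_eq_self (fun x => inner ℝ (v x) (K z (v x))) (toTorus z)
    have e2 : ∀ x, inner ℝ (incr z v x) (K z (incr z v x))
        = (inner ℝ (v (x + toTorus z)) (K z (v (x + toTorus z))) - inner ℝ (v x) (K z (v x)))
          + (-2) * inner ℝ (v x) (K z (incr z v x)) := by
      intro x
      simp only [incr, map_sub, inner_sub_left, inner_sub_right]
      rw [hK.symm z (v (x + toTorus z)) (v x), real_inner_comm (v x) (K z (v (x + toTorus z)))]
      ring
    simp_rw [e2]
    rw [integral_add ((hb hT hT).sub' (hb hv hv)) ((hb hv (memLp_incr hv z)).const_mul _),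
      integral_sub (hb hT hT) (hb hv hv), e1, sub_self, zero_add, integral_const_mul]
  rw [key, integral_const_mul]
  ring

lemma IsSymmKernel.fderiv_neg {K : E d → E d →L[ℝ] E d} (hK : IsSymmKernel K) (z a : E d) :
    fderiv ℝ K (-z) a = - fderiv ℝ K z a := by
  have h1 : HasFDerivAt (fun w => K (-w)) ((fderiv ℝ K (-z)).comp
      (-ContinuousLinearMap.id ℝ (E d))) z :=
    ((hK.smooth.differentiable (by simp)) _).hasFDerivAt.comp z (hasFDerivAt_id _).neg
  have h2 : (fun w => K (-w)) = K := funext hK.even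
  rw [h2] at h1
  rw [h1.fderiv]
  simp

lemma IsSymmKernel.inner_fderiv_symm {K : E d → E d →L[ℝ] E d} (hK : IsSymmKernel K)
    (z a b c : E d) : inner ℝ b (fderiv ℝ K z a c) = inner ℝ c (fderiv ℝ K z a b) := by
  have hd := ((hK.smooth.differentiable (by simp)) z).hasFDerivAt
  have h1 : ∀ b c : E d, HasFDerivAt (fun w => inner ℝ b (K w c))
      ((innerSL ℝ b).comp ((ContinuousLinearMap.apply ℝ (E d) c).comp (fderiv ℝ K z))) z := by
    intro b c
    exact (innerSL ℝ b).hasFDerivAt.comp z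
      ((ContinuousLinearMap.apply ℝ (E d) c).hasFDerivAt.comp z hd)
  have h2 : (fun w => inner ℝ b (K w c)) = fun w => inner ℝ c (K w b) := by
    funext w
    rw [hK.symm, real_inner_comm]
  have h3 := h1 b c
  rw [h2] at h3
  have := congrArg (fun D : E d →L[ℝ] ℝ => D a) (h3.unique (h1 c b))
  simpa using this

lemma IsSymmKernel.integral_fderiv_apply {K : E d → E d →L[ℝ] E d} (hK : IsSymmKernel K)
    (e b : E d) : ∫ z, fderiv ℝ K z e b ∂(ballMeasure d) = (0 : ℝ) • b := by
  have h := integral_ballMeasure_neg (fun z => fderiv ℝ K z e b)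
  simp_rw [hK.fderiv_neg, neg_apply, integral_neg] at h
  rw [zero_smul]
  have h2 : (2 : ℝ) • ∫ z, fderiv ℝ K z e b ∂(ballMeasure d) = 0 := by
    rw [two_smul]
    nth_rewrite 1 [← h]
    exact neg_add_cancel _
  simpa using h2

/-- The trilinear form `⟨b, (∂_a K)(z) c⟩`. -/
def kernelForm (K : E d → E d →L[ℝ] E d) (z a b c : E d) : ℝ := inner ℝ b (fderiv ℝ K z a c)

lemma integrable_of_trilinear_bound {X F₁ F₂ F₃ : Type*} [MeasurableSpace X] {μ : Measure X}
    [NormedAddCommGroup F₁] [NormedAddCommGroup F₂] [NormedAddCommGroup F₃] {a : X → F₁} {b : X → F₂}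
    {c : X → F₃} {F : X → ℝ} {C : ℝ}
    (ha : MemLp a 3 μ) (hb : MemLp b 3 μ) (hc : MemLp c 3 μ) (hF : AEStronglyMeasurable F μ)
    (hC : 0 ≤ C) (hle : ∀ᵐ x ∂μ, |F x| ≤ C * (‖a x‖ * ‖b x‖ * ‖c x‖)) : Integrable F μ := by
  refine ((((ha.integrable_norm_pow (p := 3) (by norm_num)).add
    (hb.integrable_norm_pow (p := 3) (by norm_num))).add
    (hc.integrable_norm_pow (p := 3) (by norm_num))).const_mul C).mono' hF ?_
  filter_upwards [hle] with x hx
  refine hx.trans ?_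
  refine mul_le_mul_of_nonneg_left ?_ hC
  simp only [Pi.add_apply]
  have h1 := norm_nonneg (a x)
  have h2 := norm_nonneg (b x)
  have h3 := norm_nonneg (c x)
  set p := ‖a x‖
  set q := ‖b x‖
  set r := ‖c x‖
  have hm : p * q * r ≤ (max p (max q r)) ^ 3 := by
    have := le_max_left p (max q r)
    have h4 := (le_max_left q r).trans (le_max_right p (max q r))
    have h5 := (le_max_right q r).trans (le_max_right p (max q r))
    calc p * q * r ≤ max p (max q r) * max p (max q r) * max p (max q r) := by gcongr
      _ = _ := by ring
  refine hm.trans ?_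
  have hp3 : 0 ≤ p ^ 3 := by positivity
  have hq3 : 0 ≤ q ^ 3 := by positivity
  have hr3 : 0 ≤ r ^ 3 := by positivity
  rcases max_choice p (max q r) with h | h
  · rw [h]; linarith
  · rw [h]
    rcases max_choice q r with h | h <;> rw [h] <;> linarith

lemma kernelForm_eq_sum (K : E d → E d →L[ℝ] E d) (z a b c : E d) :
    kernelForm K z a b c
      = ∑ j, a j * inner ℝ b (fderiv ℝ K z (EuclideanSpace.single j 1) c) := by
  have ha : a = ∑ j, a j • (EuclideanSpace.single j 1 : E d) := by
    ext i; simp [Pi.single_apply]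
  unfold kernelForm
  conv_lhs => rw [ha, map_sum, sum_apply, inner_sum]
  refine Finset.sum_congr rfl fun j _ => ?_
  rw [map_smul, smul_apply, inner_smul_right]

lemma aestronglyMeasurable_kernelForm {X : Type*} [MeasurableSpace X] {μ : Measure X}
    {K : E d → E d →L[ℝ] E d} (hK : IsSmoothKernel K) {ζ : X → E d} (hζ : Measurable ζ)
    {a b c : X → E d} (ha : AEStronglyMeasurable a μ)
    (hb : AEStronglyMeasurable b μ) (hc : AEStronglyMeasurable c μ) :
    AEStronglyMeasurable (fun q => kernelForm K (ζ q) (a q) (b q) (c q)) μ := by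
  simp_rw [kernelForm_eq_sum]
  refine Finset.aestronglyMeasurable_fun_sum _ fun j _ => ?_
  refine ((EuclideanSpace.proj (𝕜 := ℝ) j).continuous.comp_aestronglyMeasurable ha).mul
    (hb.inner ?_)
  exact (ContinuousLinearMap.apply ℝ (E d)).flip.aestronglyMeasurable_comp₂
    (((hK.fderiv_apply (EuclideanSpace.single j 1)).continuous.comp_stronglyMeasurable
      hζ.stronglyMeasurable).aestronglyMeasurable) hc

lemma integrable_kernelForm {X : Type*} [MeasurableSpace X] {μ : Measure X}
    {K : E d → E d →L[ℝ] E d} (hK : IsSmoothKernel K) {ζ : X → E d} (hζ : Measurable ζ)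
    {a b c : X → E d} (ha : MemLp a 3 μ) (hb : MemLp b 3 μ) (hc : MemLp c 3 μ) :
    Integrable (fun q => kernelForm K (ζ q) (a q) (b q) (c q)) μ := by
  obtain ⟨C, hC0, hC⟩ := hK.exists_bound_fderiv
  refine integrable_of_trilinear_bound (C := C) ha hb hc
    (aestronglyMeasurable_kernelForm hK hζ ha.1 hb.1 hc.1) hC0 (Eventually.of_forall fun q => ?_)
  refine (abs_real_inner_le_norm _ _).trans ?_
  calc ‖b q‖ * ‖fderiv ℝ K (ζ q) (a q) (c q)‖ ≤ ‖b q‖ * (C * ‖a q‖ * ‖c q‖) := by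
        gcongr
        exact ContinuousLinearMap.le_of_opNorm_le _ (hC _ _) _
    _ = _ := by ring

/-- The transport term, in terms of third-order increments of a divergence-free field: of the eight
terms in the expansion of the cube, two cancel by translation invariance, two vanish by
incompressibility, and the other four are equal by the symmetries of `K`. -/
lemma integral_kernelForm_incr {K : E d → E d →L[ℝ] E d} (hK : IsSymmKernel K) {v : Torus d → E d}
    (hv : MemLp v 3 volume) (hdiv : WeakDivFree v) :
    ∫ z, (∫ x, kernelForm K z (incr z v x) (incr z v x) (incr z v x)) ∂(ballMeasure d)
      = 4 * ∫ z, (∫ x, kernelForm K z (v x) (v x) (v (x + toTorus z))) ∂(ballMeasure d) := by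
  have hS := hK.toIsSmoothKernel
  have h0 := memLp_pair_fst (d := d) hv
  have h1 := memLp_pair_shift hv
  have hodd : ∀ z a b c, kernelForm K (-z) a b c = - kernelForm K z a b c := fun z a b c => by
    simp only [kernelForm, hK.fderiv_neg, neg_apply, inner_neg_right]
  have hsymm : ∀ z a b c, kernelForm K z a b c = kernelForm K z a c b := fun z a b c =>
    hK.inner_fderiv_symm z a b c
  have hi := fun {a b c : Torus d × E d → E d} (ha : MemLp a 3 (pairMeasure d))
    (hb : MemLp b 3 (pairMeasure d)) (hc : MemLp c 3 (pairMeasure d)) =>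
      integrable_kernelForm hS measurable_snd ha hb hc
  have i100 := hi h1 h0 h0
  have i110 := hi h1 h1 h0
  have i001 := hi h0 h0 h1
  have i011 := hi h0 h1 h1
  have i111 := hi h1 h1 h1
  have i000 := hi h0 h0 h0
  -- for fixed `x` this tests the divergence-free field with the gradient of `z ↦ ⟨v x, K z (v x)⟩`
  have z100 : ∫ z, (∫ x, kernelForm K z (v (x + toTorus z)) (v x) (v x)) ∂(ballMeasure d) = 0 := by
    rw [← integral_integral_swap i100]
    refine integral_eq_zero_of_ae (Eventually.of_forall fun x => ?_)
    simp only [Pi.zero_apply]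
    let Θ : E d → ℝ := fun z => inner ℝ (v x) (K z (v x))
    have hΘ : ContDiff ℝ (⊤ : ℕ∞) Θ :=
      contDiff_const.inner ℝ ((ContinuousLinearMap.apply ℝ (E d) (v x)).contDiff.comp hS.smooth)
    have hΘs : ∀ z, 1 / 4 < ‖z‖ → Θ z = 0 := fun z hz => by simp [Θ, hS.supp z hz]
    have hder : ∀ z a, fderiv ℝ Θ z a = kernelForm K z a (v x) (v x) := fun z a => by
      have : HasFDerivAt Θ ((innerSL ℝ (v x)).comp
          ((ContinuousLinearMap.apply ℝ (E d) (v x)).comp (fderiv ℝ K z))) z :=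
        (innerSL ℝ (v x)).hasFDerivAt.comp z
          ((ContinuousLinearMap.apply ℝ (E d) (v x)).hasFDerivAt.comp z
            ((hS.smooth.differentiable (by simp)) z).hasFDerivAt)
      rw [this.fderiv]; rfl
    have := integral_fderiv_eq_zero_of_weakDivFree hΘ hΘs (hv.integrable (by norm_num)) hdiv x
    simp_rw [hder] at this
    rw [integral_ballMeasure, this]
    intro z hz
    simp only [kernelForm]
    rw [fderiv_eq_zero_of_norm hS.supp hz]
    simp
  -- exchanging `x` and `x + z` changes the sign, because the derivative of the even kernel is odd
  have z011 : ∫ z, (∫ x, kernelForm K z (v x) (v (x + toTorus z)) (v (x + toTorus z)))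
      ∂(ballMeasure d) = 0 := by
    rw [integral_integral_flip (fun z a b => kernelForm K z a b b) v v]
    simp_rw [hodd, integral_neg]
    rw [z100, neg_zero]
  have f110 : ∫ z, (∫ x, kernelForm K z (v (x + toTorus z)) (v (x + toTorus z)) (v x))
      ∂(ballMeasure d)
      = - ∫ z, (∫ x, kernelForm K z (v x) (v x) (v (x + toTorus z))) ∂(ballMeasure d) := by
    rw [integral_integral_flip (fun z a b => kernelForm K z b b a) v v]
    simp_rw [hodd, integral_neg]
  have f111 : ∫ z, (∫ x, kernelForm K z (v (x + toTorus z)) (v (x + toTorus z))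
      (v (x + toTorus z))) ∂(ballMeasure d)
      = ∫ z, (∫ x, kernelForm K z (v x) (v x) (v x)) ∂(ballMeasure d) := by
    refine integral_congr_ae (Eventually.of_forall fun z => ?_)
    exact integral_add_right_eq_self (fun x => kernelForm K z (v x) (v x) (v x)) (toTorus z)
  have hexp : ∀ z x, kernelForm K z (incr z v x) (incr z v x) (incr z v x)
      = ((kernelForm K z (v (x + toTorus z)) (v (x + toTorus z)) (v (x + toTorus z))
        - kernelForm K z (v x) (v x) (v x))
        + (kernelForm K z (v (x + toTorus z)) (v x) (v x)
        - kernelForm K z (v x) (v (x + toTorus z)) (v (x + toTorus z))))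
        + (2 * kernelForm K z (v x) (v x) (v (x + toTorus z))
        - 2 * kernelForm K z (v (x + toTorus z)) (v (x + toTorus z)) (v x)) := by
    intro z x
    have e1 := hsymm z (v (x + toTorus z)) (v x) (v (x + toTorus z))
    have e2 := hsymm z (v x) (v (x + toTorus z)) (v x)
    simp only [kernelForm, incr, map_sub, sub_apply, inner_sub_left,
      inner_sub_right] at e1 e2 ⊢
    linarith
  simp_rw [hexp]
  have s1 := i111.sub' i000
  have s2 := i100.sub' i011
  have s3 := (i001.const_mul 2).sub' (i110.const_mul 2)
  have hs : ∀ {F : Torus d × E d → ℝ}, Integrable F (pairMeasure d) →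
      ∫ z, (∫ x, F (x, z)) ∂(ballMeasure d) = ∫ q, F q ∂(pairMeasure d) := fun hF =>
    (integral_prod_symm _ hF).symm
  have t1 := hs ((s1.fun_add s2).fun_add s3)
  have t2 := hs i100
  have t3 := hs i110
  have t4 := hs i001
  have t5 := hs i011
  have t6 := hs i111
  have t7 := hs i000
  simp only at t1 t2 t3 t4 t5 t6 t7
  rw [t1]
  rw [integral_add (s1.fun_add s2) s3, integral_add s1 s2, integral_sub (i001.const_mul 2)
    (i110.const_mul 2), integral_sub i111 i000, integral_sub i100 i011, integral_const_mul,
    integral_const_mul, ← t2, ← t3, ← t4, ← t5, ← t6, ← t7, z100, z011, f110, f111]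
  ring

/-! ### The smoothed balance law -/

lemma enorm_inner_le_enorm {F' : Type*} [NormedAddCommGroup F'] [InnerProductSpace ℝ F'] (a b : F') :
    ‖(inner ℝ a b : ℝ)‖ₑ ≤ ‖a‖ₑ * ‖b‖ₑ := by
  rw [← ofReal_norm, ← ofReal_norm, ← ofReal_norm, ← ENNReal.ofReal_mul (norm_nonneg _)]
  exact ENNReal.ofReal_le_ofReal (norm_inner_le_norm a b)

lemma lintegral_enorm_mul_le_eLpNorm_two {X F₁ F₂ : Type*} [MeasurableSpace X] {μ : Measure X}
    [NormedAddCommGroup F₁] [NormedAddCommGroup F₂] {a : X → F₁} {b : X → F₂}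
    (ha : AEStronglyMeasurable a μ) (hb : AEStronglyMeasurable b μ) :
    ∫⁻ x, ‖a x‖ₑ * ‖b x‖ₑ ∂μ ≤ eLpNorm a 2 μ * eLpNorm b 2 μ := by
  have h := ENNReal.lintegral_mul_le_Lp_mul_Lq μ (p := 2) (q := 2)
    Real.HolderConjugate.two_two ha.enorm hb.enorm
  rw [eLpNorm_eq_lintegral_rpow_enorm_toReal (by norm_num) (by norm_num),
    eLpNorm_eq_lintegral_rpow_enorm_toReal (by norm_num) (by norm_num)]
  simpa using h

lemma aestronglyMeasurable_incr {v : Torus d → E d} (hv : AEStronglyMeasurable v volume) (z : E d) :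
    AEStronglyMeasurable (incr z v) volume :=
  (hv.comp_measurePreserving (measurePreserving_translate (toTorus z))).sub hv

lemma enorm_kernel_pairing_le (K : E d → E d →L[ℝ] E d) {w v : Torus d → E d}
    (hw : AEStronglyMeasurable w volume) (hv : AEStronglyMeasurable v volume) :
    ‖∫ z, (∫ x, inner ℝ (w x) (K z (incr z v x))) ∂(ballMeasure d)‖ₑ
      ≤ ∫⁻ z, ‖K z‖ₑ * (eLpNorm w 2 volume * eLpNorm (incr z v) 2 volume) ∂(ballMeasure d) := by
  refine (enorm_integral_le_lintegral_enorm _).trans (lintegral_mono fun z => ?_)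
  refine (enorm_integral_le_lintegral_enorm _).trans ?_
  refine le_trans ?_ (mul_le_mul_right (lintegral_enorm_mul_le_eLpNorm_two hw
    (aestronglyMeasurable_incr hv z)) _)
  rw [← lintegral_const_mul' _ _ enorm_ne_top]
  refine lintegral_mono fun x => ?_
  refine (enorm_inner_le_enorm _ _).trans ?_
  calc ‖w x‖ₑ * ‖K z (incr z v x)‖ₑ ≤ ‖w x‖ₑ * (‖K z‖ₑ * ‖incr z v x‖ₑ) := by
        gcongr; exact (K z).le_opENorm _
    _ = _ := by ring

lemma enorm_kernel_energy_le (K : E d → E d →L[ℝ] E d) {v : Torus d → E d}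
    (hv : AEStronglyMeasurable v volume) :
    ‖∫ z, (∫ x, inner ℝ (incr z v x) (K z (incr z v x))) ∂(ballMeasure d)‖ₑ
      ≤ ∫⁻ z, ‖K z‖ₑ * (eLpNorm (incr z v) 2 volume) ^ 2 ∂(ballMeasure d) := by
  refine (enorm_integral_le_lintegral_enorm _).trans (lintegral_mono fun z => ?_)
  refine (enorm_integral_le_lintegral_enorm _).trans ?_
  rw [sq]
  refine le_trans ?_ (mul_le_mul_right (lintegral_enorm_mul_le_eLpNorm_two
    (aestronglyMeasurable_incr hv z) (aestronglyMeasurable_incr hv z)) _)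
  rw [← lintegral_const_mul' _ _ enorm_ne_top]
  refine lintegral_mono fun x => ?_
  refine (enorm_inner_le_enorm _ _).trans ?_
  calc ‖incr z v x‖ₑ * ‖K z (incr z v x)‖ₑ
      ≤ ‖incr z v x‖ₑ * (‖K z‖ₑ * ‖incr z v x‖ₑ) := by
        gcongr; exact (K z).le_opENorm _
    _ = _ := by ring

/-- The momentum balance against the smeared field, in terms of increments. -/
lemma momentumForm_smear {K : E d → E d →L[ℝ] E d} (hK : IsSymmKernel K) (ν : ℝ)
    {f v : Torus d → E d} {G : Torus d → Fin d → E d} (hf : MemLp f 2 volume)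
    (hv : MemLp v 3 volume) (hdiv : WeakDivFree v) (hG : ∀ j, MemLp (fun x => G x j) 2 volume) :
    momentumForm ν f v G (smear K v) = (∫ x, inner ℝ (f x) (smear K v x))
      - (1 / 4) * (∫ z, (∫ x, kernelForm K z (incr z v x) (incr z v x) (incr z v x))
          ∂(ballMeasure d))
      + ν * ∑ j, ∫ x, inner ℝ (G x j)
          (smear (fun z => fderiv ℝ K z (EuclideanSpace.single j 1)) v x) := by
  have hS := hK.toIsSmoothKernel
  have hv2 : MemLp v 2 volume := hv.mono_exponent (by norm_num)
  have hv1 : Integrable v := hv.integrable (by norm_num)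
  have i001 : Integrable (fun q : Torus d × E d =>
      kernelForm K q.2 (v q.1) (v q.1) (v (q.1 + toTorus q.2))) (pairMeasure d) :=
    integrable_kernelForm hS measurable_snd (memLp_pair_fst hv) (memLp_pair_fst hv)
      (memLp_pair_shift hv)
  have hpt : ∀ x, momentumIntegrand ν (smear K v x) (fun j => partialDeriv j (smear K v) x) (f x)
      (v x) (G x) = (inner ℝ (f x) (smear K v x)
        - ∫ z, kernelForm K z (v x) (v x) (v (x + toTorus z)) ∂(ballMeasure d))
        + ν * ∑ j, inner ℝ (G x j)
          (smear (fun z => fderiv ℝ K z (EuclideanSpace.single j 1)) v x) := by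
    intro x
    have e1 : ∫ z, kernelForm K z (v x) (v x) (v (x + toTorus z)) ∂(ballMeasure d)
        = ∑ j, v x j * inner ℝ (v x)
          (smear (fun z => fderiv ℝ K z (EuclideanSpace.single j 1)) v x) := by
      simp_rw [kernelForm_eq_sum]
      rw [integral_finsetSum]
      · refine Finset.sum_congr rfl fun j _ => ?_
        rw [integral_const_mul, integral_inner, smear_eq_ballMeasure (hS.fderiv_apply _)]
        exact (integrable_smear_integrand (hS.fderiv_apply _) hv1 x).restrict
      · intro j _
        exact (((integrable_smear_integrand (hS.fderiv_apply _) hv1 x).restrict).const_inner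
          _).const_mul _
    rw [e1]
    unfold momentumIntegrand
    simp_rw [partialDeriv_smear hS hv1, inner_neg_left, Finset.sum_neg_distrib]
    have e2 : ∑ i, ∑ j, (-smear (fun z => fderiv ℝ K z (EuclideanSpace.single j 1)) v x) i
        * v x i * v x j = - ∑ j, v x j * inner ℝ (v x)
          (smear (fun z => fderiv ℝ K z (EuclideanSpace.single j 1)) v x) := by
      rw [Finset.sum_comm, ← Finset.sum_neg_distrib]
      refine Finset.sum_congr rfl fun j _ => ?_
      rw [PiLp.inner_apply, Finset.mul_sum, ← Finset.sum_neg_distrib]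
      refine Finset.sum_congr rfl fun i _ => ?_
      simp only [PiLp.neg_apply, RCLike.inner_apply, conj_trivial]
      ring
    rw [e2, real_inner_comm]
    simp_rw [real_inner_comm]
    ring
  have hbdd : ∀ {K' : E d → E d →L[ℝ] E d}, IsSmoothKernel K' → ∀ {g : Torus d → E d},
      MemLp g 2 volume → Integrable fun x => inner ℝ (g x) (smear K' v x) := by
    intro K' hK' g hg
    obtain ⟨C, hC0, hC⟩ := hK'.exists_bound
    refine ((hg.integrable (by norm_num)).norm.mul_const (C * ∫ w, ‖v w‖)).mono'
      (hg.1.inner (measurable_smear hK' hv1).aestronglyMeasurable) (Eventually.of_forall fun x => ?_)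
    refine (abs_real_inner_le_norm _ _).trans ?_
    gcongr
    exact norm_smear_le hK' hC hv1 x
  unfold momentumForm
  simp_rw [hpt]
  have j1 := hbdd hS hf
  have j3 := fun j => hbdd (hS.fderiv_apply (EuclideanSpace.single j 1)) (hG j)
  rw [integral_add (j1.sub' i001.integral_prod_left)
    ((integrable_finsetSum _ fun j _ => j3 j).const_mul ν), integral_sub j1 i001.integral_prod_left,
    integral_const_mul, integral_finsetSum _ fun j _ => j3 j, integral_kernelForm_incr hK hv hdiv,
    integral_integral_swap i001]
  ring

/-! ### Integrability in time -/

lemma measurePreserving_reorder :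
    MeasurePreserving (fun q : (ℝ × E d) × Torus d => ((q.1.1, q.2), q.1.2))
      ((timeMeasure.prod (ballMeasure d)).prod volume) ((spaceTime d).prod (ballMeasure d)) := by
  have h1 := measurePreserving_prodAssoc timeMeasure (ballMeasure d) (volume : Measure (Torus d))
  have h2 := (MeasurePreserving.id timeMeasure).prod
    (Measure.measurePreserving_swap (μ := ballMeasure d) (ν := (volume : Measure (Torus d))))
  have h3 := (measurePreserving_prodAssoc timeMeasure (volume : Measure (Torus d))
    (ballMeasure d)).symm
  exact h3.comp (h2.comp h1)

lemma integrable_integral_torus {F : (ℝ × Torus d) × E d → ℝ}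
    (hF : Integrable F ((spaceTime d).prod (ballMeasure d))) :
    Integrable (fun p : ℝ × E d => ∫ x, F ((p.1, x), p.2)) (timeMeasure.prod (ballMeasure d)) :=
  (measurePreserving_reorder.integrable_comp_of_integrable hF).integral_prod_left

lemma measurable_spaceTimeShift' :
    Measurable (fun q : (ℝ × Torus d) × E d => (q.1.1, q.1.2 + toTorus q.2)) :=
  measurable_spaceTimeShift measurable_toTorus

lemma aestronglyMeasurable_incr_spaceTime {u : ℝ → Torus d → E d}
    (hu : AEStronglyMeasurable (fun z : ℝ × Torus d => u z.1 z.2) (spaceTime d)) :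
    AEStronglyMeasurable (fun q : (ℝ × Torus d) × E d => incr q.2 (u q.1.1) q.1.2)
      ((spaceTime d).prod (ballMeasure d)) :=
  (aestronglyMeasurable_shift measurable_spaceTimeShift'
    (fun z => measurePreserving_spaceTime_translate (toTorus z)) hu).sub hu.comp_fst

lemma memLp_incr_spaceTime {p : ℝ≥0∞} {u : ℝ → Torus d → E d}
    (hu : MemLp (fun z : ℝ × Torus d => u z.1 z.2) p (spaceTime d)) :
    MemLp (fun q : (ℝ × Torus d) × E d => incr q.2 (u q.1.1) q.1.2) p
      ((spaceTime d).prod (ballMeasure d)) :=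
  (memLp_shift measurable_spaceTimeShift'
    (fun z => measurePreserving_spaceTime_translate (toTorus z)) hu).sub (hu.comp_fst _)

lemma aemeasurable_eLpNorm_incr {u : ℝ → Torus d → E d}
    (hu : AEStronglyMeasurable (fun z : ℝ × Torus d => u z.1 z.2) (spaceTime d)) :
    AEMeasurable (fun p : ℝ × E d => eLpNorm (incr p.2 (u p.1)) 2 volume)
      (timeMeasure.prod (ballMeasure d)) :=
  aemeasurable_eLpNorm_two_slice (μ := timeMeasure.prod (ballMeasure d))
    (ν := (volume : Measure (Torus d)))
    (g := fun q : (ℝ × E d) × Torus d => incr q.1.2 (u q.1.1) q.2)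
    ((aestronglyMeasurable_incr_spaceTime hu).comp_measurePreserving measurePreserving_reorder)

lemma aestronglyMeasurable_smear_spaceTime {K : E d → E d →L[ℝ] E d} (hK : IsSmoothKernel K)
    {u : ℝ → Torus d → E d}
    (hu : AEStronglyMeasurable (fun z : ℝ × Torus d => u z.1 z.2) (spaceTime d)) :
    AEStronglyMeasurable (fun z : ℝ × Torus d => smear K (u z.1) z.2) (spaceTime d) := by
  simp_rw [smear_eq_ballMeasure hK]
  have h : AEStronglyMeasurable (fun q : (ℝ × Torus d) × E d =>
      K q.2 (u q.1.1 (q.1.2 + toTorus q.2))) ((spaceTime d).prod (ballMeasure d)) :=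
    (ContinuousLinearMap.apply ℝ (E d)).flip.aestronglyMeasurable_comp₂
      (hK.continuous.comp_stronglyMeasurable measurable_snd.stronglyMeasurable).aestronglyMeasurable
      (aestronglyMeasurable_shift measurable_spaceTimeShift'
        (fun z => measurePreserving_spaceTime_translate (toTorus z)) hu)
  exact h.integral_prod_right'

lemma ae_spaceTime_of_ae_time {p : ℝ → Prop} (h : ∀ᵐ t ∂timeMeasure, p t) :
    ∀ᵐ z ∂(spaceTime d), p z.1 :=
  Measure.quasiMeasurePreserving_fst.ae h

lemma ae_mem_Icc_timeMeasure : ∀ᵐ t ∂timeMeasure, t ∈ Icc (0 : ℝ) 1 :=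
  ae_restrict_mem measurableSet_Icc

lemma enorm_intervalIntegral_le {F' : Type*} [NormedAddCommGroup F'] [NormedSpace ℝ F'] (F : ℝ → F')
    {t : ℝ} (ht : t ∈ Icc (0 : ℝ) 1) : ‖∫ r in (0 : ℝ)..t, F r‖ₑ ≤ ∫⁻ r, ‖F r‖ₑ ∂timeMeasure := by
  rw [intervalIntegral.integral_of_le ht.1]
  refine (enorm_integral_le_lintegral_enorm _).trans ?_
  exact lintegral_mono_set (Ioc_subset_Icc_self.trans (Icc_subset_Icc_right ht.2))

namespace IsLerayHopfWith

variable {ν : ℝ} {u₀ : Torus d → E d} {f u : ℝ → Torus d → E d} {G : ℝ → Torus d → Fin d → E d}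
  (h : IsLerayHopfWith ν u₀ f u G)
include h

lemma integrable_inner_smear {K : E d → E d →L[ℝ] E d} (hK : IsSmoothKernel K)
    {g : ℝ × Torus d → E d} (hg : Integrable g (spaceTime d)) :
    Integrable (fun z : ℝ × Torus d => inner ℝ (g z) (smear K (u z.1) z.2)) (spaceTime d) := by
  obtain ⟨S, hS0, hS⟩ := h.exists_integral_norm_le
  obtain ⟨C, hC0, hC⟩ := hK.exists_bound
  refine (hg.norm.mul_const (C * S)).mono'
    (hg.1.inner (aestronglyMeasurable_smear_spaceTime hK h.meas)) ?_
  filter_upwards [ae_spaceTime_of_ae_time ae_mem_Icc_timeMeasure] with z hz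
  refine (abs_real_inner_le_norm _ _).trans ?_
  gcongr
  exact (norm_smear_le hK hC (h.integrable_slice hz) _).trans (by gcongr; exact hS _ hz)

lemma integrable_inner_force :
    Integrable (fun z : ℝ × Torus d => inner ℝ (f z.1 z.2) (u z.1 z.2)) (spaceTime d) := by
  have hm := h.force_meas.inner (𝕜 := ℝ) h.meas
  refine ⟨hm, ?_⟩
  obtain ⟨M, hM⟩ := h.bounded
  rw [hasFiniteIntegral_iff_enorm, spaceTime, lintegral_prod _ hm.enorm]
  have hfin := h.force_L1L2
  rw [normLqL2, eLpNorm_one_eq_lintegral_enorm] at hfin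
  simp only [enorm_eq_self] at hfin
  have : ∀ᵐ t ∂timeMeasure, ∫⁻ x, ‖(inner ℝ (f t x) (u t x) : ℝ)‖ₑ
      ≤ eLpNorm (f t) 2 volume * M := by
    filter_upwards [h.force_meas.prodMk_left, ae_mem_Icc_timeMeasure] with t ht ht1
    calc _ ≤ ∫⁻ x, ‖f t x‖ₑ * ‖u t x‖ₑ := lintegral_mono fun x => enorm_inner_le_enorm _ _
      _ ≤ eLpNorm (f t) 2 volume * eLpNorm (u t) 2 volume :=
          lintegral_enorm_mul_le_eLpNorm_two ht (h.memLp t ht1).1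
      _ ≤ _ := by gcongr; exact hM t ht1
  refine (lintegral_mono_ae this).trans_lt ?_
  rw [lintegral_mul_const' _ _ ENNReal.coe_ne_top]
  exact ENNReal.mul_lt_top hfin ENNReal.coe_lt_top

lemma memLp_three_slice (h3 : MemLp (fun z : ℝ × Torus d => u z.1 z.2) 3 (spaceTime d)) :
    ∀ᵐ t ∂timeMeasure, MemLp (u t) 3 volume := by
  have h1 := h3.2
  rw [eLpNorm_lt_top_iff_lintegral_rpow_enorm_lt_top (by norm_num) (by norm_num), spaceTime,
    lintegral_prod _ (h.meas.enorm.pow_const _)] at h1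
  have h2 := ae_lt_top' ((h.meas.enorm.pow_const _).lintegral_prod_right') h1.ne
  filter_upwards [h2, h.meas.prodMk_left] with t h4 h5
  exact ⟨h5, by
    rwa [eLpNorm_lt_top_iff_lintegral_rpow_enorm_lt_top (by norm_num) (by norm_num)]⟩

/-- The remainder bound for one pairing with an increment, after integration in time. -/
lemma lintegral_enorm_kernel_pairing_le {K : E d → E d →L[ℝ] E d} (hK : IsSmoothKernel K)
    {g : ℝ → Torus d → E d}
    (hg : AEStronglyMeasurable (fun z : ℝ × Torus d => g z.1 z.2) (spaceTime d)) :
    ∫⁻ r, ‖∫ z, (∫ x, inner ℝ (g r x) (K z (incr z (u r) x))) ∂(ballMeasure d)‖ₑ ∂timeMeasure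
      ≤ ∫⁻ z, ‖K z‖ₑ * ∫⁻ r, eLpNorm (g r) 2 volume * eLpNorm (incr z (u r)) 2 volume ∂timeMeasure
          ∂(ballMeasure d) := by
  have hgN : AEMeasurable (fun t => eLpNorm (g t) 2 volume) timeMeasure :=
    aemeasurable_eLpNorm_two_slice (μ := timeMeasure) (ν := (volume : Measure (Torus d)))
      (g := fun z : ℝ × Torus d => g z.1 z.2) hg
  have hKm : Measurable fun z => ‖K z‖ₑ := hK.continuous.enorm.measurable
  have hm : AEMeasurable (fun p : ℝ × E d => ‖K p.2‖ₑ *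
      (eLpNorm (g p.1) 2 volume * eLpNorm (incr p.2 (u p.1)) 2 volume))
      (timeMeasure.prod (ballMeasure d)) :=
    (hKm.comp measurable_snd).aemeasurable.mul (hgN.comp_fst.mul (aemeasurable_eLpNorm_incr h.meas))
  calc _ ≤ ∫⁻ r, ∫⁻ z, ‖K z‖ₑ * (eLpNorm (g r) 2 volume * eLpNorm (incr z (u r)) 2 volume)
          ∂(ballMeasure d) ∂timeMeasure := by
        refine lintegral_mono_ae ?_
        filter_upwards [hg.prodMk_left, h.meas.prodMk_left] with r h1 h2
        exact enorm_kernel_pairing_le K h1 h2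
    _ = ∫⁻ z, ∫⁻ r, ‖K z‖ₑ * (eLpNorm (g r) 2 volume * eLpNorm (incr z (u r)) 2 volume)
          ∂timeMeasure ∂(ballMeasure d) := lintegral_lintegral_swap hm
    _ = _ := by
        refine lintegral_congr fun z => ?_
        rw [lintegral_const_mul' _ _ enorm_ne_top]

lemma dissipation_zero_eq (t : ℝ) : dissipation u₀ f u t = (1 / 2) * (∫ x, ‖u 0 x‖ ^ 2)
    - (1 / 2) * (∫ x, ‖u t x‖ ^ 2) + ∫ r in (0 : ℝ)..t, ∫ x, inner ℝ (f r x) (u r x) := by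
  unfold dissipation
  congr 3
  refine integral_congr_ae ?_
  filter_upwards [h.initial] with x hx
  rw [hx]

/-- The energy balance smoothed by a solenoidal kernel of mean `c`: up to controlled remainders,
the dissipation is the integral of the third-order increments against the gradient of the kernel. -/
theorem enorm_dissipation_sub_le {K : E d → E d →L[ℝ] E d} (hK : IsSolenoidalKernel K) {c : ℝ}
    (hc : ∀ b, ∫ z, K z b ∂(ballMeasure d) = c • b)
    (h3 : MemLp (fun z : ℝ × Torus d => u z.1 z.2) 3 (spaceTime d)) {t : ℝ}
    (ht : t ∈ Icc (0 : ℝ) 1) :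
    ‖c * dissipation u₀ f u t - (1 / 4) * ∫ r in (0 : ℝ)..t,
        ∫ z, (∫ x, kernelForm K z (incr z (u r) x) (incr z (u r) x) (incr z (u r) x))
          ∂(ballMeasure d)‖ₑ
      ≤ (∫⁻ z, ‖K z‖ₑ * (eLpNorm (incr z (u t)) 2 volume) ^ 2 ∂(ballMeasure d))
        + (∫⁻ z, ‖K z‖ₑ * (eLpNorm (incr z (u 0)) 2 volume) ^ 2 ∂(ballMeasure d))
        + (∫⁻ z, ‖K z‖ₑ * ∫⁻ r, eLpNorm (f r) 2 volume * eLpNorm (incr z (u r)) 2 volume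
            ∂timeMeasure ∂(ballMeasure d))
        + ‖ν‖ₑ * ∑ j, ∫⁻ z, ‖fderiv ℝ K z (EuclideanSpace.single j 1)‖ₑ *
            ∫⁻ r, eLpNorm (fun x => G r x j) 2 volume * eLpNorm (incr z (u r)) 2 volume
            ∂timeMeasure ∂(ballMeasure d) := by
  have hS := hK.toIsSmoothKernel
  have h0 : (0 : ℝ) ∈ Icc (0 : ℝ) 1 := by simp
  let A : ℝ → ℝ := fun r => ∫ x, inner ℝ (f r x) (smear K (u r) x)
  let P : ℝ → ℝ := fun r => ∫ x, inner ℝ (f r x) (u r x)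
  let W : ℝ → ℝ := fun r => ∫ z, (∫ x, kernelForm K z (incr z (u r) x) (incr z (u r) x)
    (incr z (u r) x)) ∂(ballMeasure d)
  let V : Fin d → ℝ → ℝ := fun j r => ∫ x, inner ℝ (G r x j)
    (smear (fun z => fderiv ℝ K z (EuclideanSpace.single j 1)) (u r) x)
  let D : ℝ → ℝ := fun s => ∫ z, (∫ x, inner ℝ (incr z (u s) x) (K z (incr z (u s) x)))
    ∂(ballMeasure d)
  have hA : IntervalIntegrable A volume 0 t := intervalIntegrable_of_timeMeasure
    (h.integrable_inner_smear hS h.integrable_force).integral_prod_left h0 ht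
  have hP : IntervalIntegrable P volume 0 t := intervalIntegrable_of_timeMeasure
    h.integrable_inner_force.integral_prod_left h0 ht
  have hV : ∀ j, IntervalIntegrable (V j) volume 0 t := fun j => intervalIntegrable_of_timeMeasure
    (h.integrable_inner_smear (hS.fderiv_apply _)
      ((h.grad_memLp j).integrable (by norm_num))).integral_prod_left h0 ht
  have hW : IntervalIntegrable W volume 0 t := by
    have hi := memLp_incr_spaceTime h3
    have := integrable_kernelForm hS (measurable_snd (α := ℝ × Torus d)) hi hi hi
    exact intervalIntegrable_of_timeMeasure
      (integrable_integral_torus this).integral_prod_left h0 ht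
  have hform : ∀ᵐ r ∂timeMeasure, 2 * momentumForm ν (f r) (u r) (G r) (smear K (u r))
      = 2 * (A r - (1 / 4) * W r + ν * ∑ j, V j r) := by
    filter_upwards [h.memLp_force, h.memLp_three_slice h3, ae_mem_Icc_timeMeasure,
      ae_all_iff.2 h.memLp_gradient] with r hr1 hr2 hr3 hr4
    rw [momentumForm_smear hK.toIsSymmKernel ν hr1 hr2 (h.div_free r hr3) hr4]
  have hbal := h.smeared_energy_balance hK ht
  rw [integral_inner_smear_self hK.toIsSymmKernel hc (h.memLp t ht),
    integral_inner_smear_self hK.toIsSymmKernel hc (h.memLp 0 h0),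
    intervalIntegral.integral_congr_ae (ae_uIoc_of_timeMeasure hform h0 ht),
    intervalIntegral.integral_const_mul] at hbal
  have hVsum : IntervalIntegrable (fun r => ν * ∑ j, V j r) volume 0 t := by
    refine IntervalIntegrable.const_mul ?_ ν
    have := IntervalIntegrable.sum Finset.univ (f := V) (fun j _ => hV j)
    refine this.congr_ae (Eventually.of_forall fun r => ?_)
    simp
  rw [intervalIntegral.integral_add (hA.sub (hW.const_mul _)) hVsum,
    intervalIntegral.integral_sub hA (hW.const_mul _), intervalIntegral.integral_const_mul,
    intervalIntegral.integral_const_mul, intervalIntegral.integral_finsetSum fun j _ => hV j]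
    at hbal
  have hAP : ∫ r in (0 : ℝ)..t, (A r - c * P r)
      = (∫ r in (0 : ℝ)..t, A r) - c * ∫ r in (0 : ℝ)..t, P r := by
    rw [intervalIntegral.integral_sub hA (hP.const_mul c), intervalIntegral.integral_const_mul]
  -- the remainders: quadratic increments at the times `t` and `0`, the force and the viscosity
  have hid : c * dissipation u₀ f u t - (1 / 4) * ∫ r in (0 : ℝ)..t, W r
      = -((1 / 4) * D t) + (1 / 4) * D 0 + (-(∫ r in (0 : ℝ)..t, (A r - c * P r)))
        + (-(ν * ∑ j, ∫ r in (0 : ℝ)..t, V j r)) := by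
    rw [h.dissipation_zero_eq, hAP]
    simp only [D, P]
    linarith
  change ‖c * dissipation u₀ f u t - (1 / 4) * ∫ r in (0 : ℝ)..t, W r‖ₑ ≤ _
  rw [hid]
  have hquarter : ∀ y : ℝ, ‖(1 / 4) * y‖ₑ ≤ ‖y‖ₑ := fun y => by
    rw [enorm_le_iff_norm_le, norm_mul]
    have : ‖(1 / 4 : ℝ)‖ ≤ 1 := by norm_num
    nlinarith [norm_nonneg y]
  refine (enorm_add_le _ _).trans (add_le_add ((enorm_add_le _ _).trans (add_le_add
    ((enorm_add_le _ _).trans (add_le_add ?_ ?_)) ?_)) ?_)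
  · rw [enorm_neg]
    exact (hquarter _).trans (enorm_kernel_energy_le K (h.memLp t ht).1)
  · exact (hquarter _).trans (enorm_kernel_energy_le K (h.memLp 0 h0).1)
  · rw [enorm_neg]
    refine (enorm_intervalIntegral_le _ ht).trans (le_trans (lintegral_mono_ae ?_)
      (h.lintegral_enorm_kernel_pairing_le hS h.force_meas))
    filter_upwards [h.memLp_force, ae_mem_Icc_timeMeasure] with r hr1 hr2
    simp only [A, P]
    rw [integral_inner_smear_eq_add_incr hS hc hr1 (h.memLp r hr2), add_sub_cancel_left]
  -- derivatives of the kernel have mean zero, so smearing with them only involves increments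
  · rw [enorm_neg, enorm_mul]
    gcongr
    refine (enorm_sum_le _ _).trans (Finset.sum_le_sum fun j _ => ?_)
    refine (enorm_intervalIntegral_le _ ht).trans (le_trans (lintegral_mono_ae ?_)
      (h.lintegral_enorm_kernel_pairing_le (hS.fderiv_apply _) (g := fun r x => G r x j)
        (h.grad_memLp j).1))
    filter_upwards [h.memLp_gradient j, ae_mem_Icc_timeMeasure] with r hr1 hr2
    simp only [V]
    rw [integral_inner_smear_eq_add_incr (hS.fderiv_apply _)
      (hK.toIsSymmKernel.integral_fderiv_apply _) hr1 (h.memLp r hr2), zero_mul, zero_add]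

end IsLerayHopfWith

/-! ### Radial profiles -/

/-- A probability density on `(0, b)`, smooth on the line. -/
structure IsProfile (b : ℝ) (g : ℝ → ℝ) : Prop where
  smooth : ContDiff ℝ (⊤ : ℕ∞) g
  nonneg : ∀ s, 0 ≤ g s
  zero_left : ∀ s ≤ 0, g s = 0
  zero_right : ∀ s, b ≤ s → g s = 0
  integral_eq_one : ∫ s, g s = 1

/-- The antiderivative of `-g` that vanishes at `b`. -/
def tail (g : ℝ → ℝ) (b s : ℝ) : ℝ := ∫ x in s..b, g x

lemma hasDerivAt_tail {g : ℝ → ℝ} (hg : Continuous g) (b s : ℝ) :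
    HasDerivAt (tail g b) (-g s) s :=
  intervalIntegral.integral_hasDerivAt_left (hg.intervalIntegrable _ _)
    (hg.stronglyMeasurableAtFilter _ _) hg.continuousAt

lemma contDiff_tail {g : ℝ → ℝ} (hg : ContDiff ℝ (⊤ : ℕ∞) g) (b : ℝ) :
    ContDiff ℝ (⊤ : ℕ∞) (tail g b) := by
  rw [contDiff_infty_iff_deriv]
  refine ⟨fun s => (hasDerivAt_tail hg.continuous b s).differentiableAt, ?_⟩
  have : deriv (tail g b) = fun s => -g s :=
    funext fun s => (hasDerivAt_tail hg.continuous b s).deriv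
  rw [this]
  exact hg.neg

lemma tail_eq_zero {g : ℝ → ℝ} {b : ℝ} (hg : ∀ s, b ≤ s → g s = 0) {s : ℝ} (hs : b ≤ s) :
    tail g b s = 0 := by
  unfold tail
  rw [intervalIntegral.integral_symm, intervalIntegral.integral_of_le hs, neg_eq_zero]
  exact setIntegral_eq_zero_of_forall_eq_zero fun x hx => hg x hx.1.le

lemma tail_nonneg {g : ℝ → ℝ} {b : ℝ} (hg0 : ∀ s, 0 ≤ g s) (hg : ∀ s, b ≤ s → g s = 0) (s : ℝ) :
    0 ≤ tail g b s := by
  rcases le_total b s with hs | hs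
  · rw [tail_eq_zero hg hs]
  · exact intervalIntegral.integral_nonneg hs fun x _ => hg0 x

lemma IsProfile.hasCompactSupport {b : ℝ} {g : ℝ → ℝ} (hg : IsProfile b g) :
    HasCompactSupport g := by
  refine HasCompactSupport.intro (isCompact_Icc (a := 0) (b := b)) fun s hs => ?_
  by_cases h : s ≤ 0
  · exact hg.zero_left s h
  · refine hg.zero_right s ?_
    by_contra! h'
    exact hs ⟨(not_le.1 h).le, h'.le⟩

lemma IsProfile.integrable {b : ℝ} {g : ℝ → ℝ} (hg : IsProfile b g) : Integrable g :=
  hg.smooth.continuous.integrable_of_hasCompactSupport hg.hasCompactSupport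

lemma IsProfile.tail_le_one {b : ℝ} {g : ℝ → ℝ} (hg : IsProfile b g) (s : ℝ) :
    tail g b s ≤ 1 := by
  rcases le_total b s with hs | hs
  · rw [tail_eq_zero hg.zero_right hs]; exact zero_le_one
  · rw [← hg.integral_eq_one, tail, intervalIntegral.integral_of_le hs]
    exact setIntegral_le_integral hg.integrable (Eventually.of_forall hg.nonneg)

lemma IsProfile.tail_tail_le {b : ℝ} (hb : 0 ≤ b) {g : ℝ → ℝ} (hg : IsProfile b g) {s : ℝ}
    (hs : 0 ≤ s) : tail (tail g b) b s ≤ b := by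
  rcases le_total b s with hsb | hsb
  · rw [tail_eq_zero (fun s hs => tail_eq_zero hg.zero_right hs) hsb]; exact hb
  · calc tail (tail g b) b s ≤ ∫ _ in s..b, (1 : ℝ) := by
          refine intervalIntegral.integral_mono_on hsb
            ((contDiff_tail hg.smooth b).continuous.intervalIntegrable _ _) (by simp)
            fun x _ => hg.tail_le_one x
      _ = b - s := by simp
      _ ≤ b := by linarith

/-- Radial integration by parts: in polar coordinates it is the fundamental theorem of calculus for
`y ↦ y ^ (d + 2 m) * B (y ^ 2)`. -/
lemma integral_radial_parts (hd : 0 < d) {B : ℝ → ℝ} (hB : ContDiff ℝ (⊤ : ℕ∞) B) {b : ℝ}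
    (hBs : ∀ s, b ≤ s → B s = 0) (m : ℕ) :
    (d + 2 * m) * ∫ z : E d, B (‖z‖ ^ 2) * ‖z‖ ^ (2 * m)
      = -2 * ∫ z : E d, deriv B (‖z‖ ^ 2) * ‖z‖ ^ (2 * m + 2) := by
  have : Nonempty (Fin d) := ⟨⟨0, hd⟩⟩
  have hdim : Module.finrank ℝ (E d) = d := by simp
  let F : ℝ → ℝ := fun y => y ^ (d + 2 * m) * B (y ^ 2)
  have hF : ContDiff ℝ 1 F := by
    have h1 : ContDiff ℝ 1 B := hB.of_le (by simp)
    fun_prop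
  have hFs : HasCompactSupport F := by
    refine HasCompactSupport.intro (isCompact_Icc (a := -(|b| + 1)) (b := |b| + 1)) fun y hy => ?_
    have : |b| + 1 < |y| := by
      by_contra! h
      exact hy (abs_le.1 h)
    change y ^ (d + 2 * m) * B (y ^ 2) = 0
    rw [hBs, mul_zero]
    have h1 : 0 ≤ |b| := abs_nonneg b
    have h2 := le_abs_self b
    rw [← sq_abs]
    nlinarith
  have hFd : ∀ y, deriv F y = (d + 2 * m) * (y ^ (d - 1) * (B (y ^ 2) * y ^ (2 * m)))
      + 2 * (y ^ (d - 1) * (deriv B (y ^ 2) * y ^ (2 * m + 2))) := by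
    intro y
    have h1 : HasDerivAt F ((↑(d + 2 * m) * y ^ (d + 2 * m - 1)) * B (y ^ 2)
        + y ^ (d + 2 * m) * (deriv B (y ^ 2) * (2 * y))) y := by
      have h2 : HasDerivAt (fun y : ℝ => y ^ 2) (2 * y) y := by simpa using hasDerivAt_pow 2 y
      exact (hasDerivAt_pow _ y).mul
        (((hB.differentiable (by simp)) (y ^ 2)).hasDerivAt.comp y h2)
    rw [h1.deriv]
    obtain ⟨e, rfl⟩ : ∃ e, d = e + 1 := ⟨d - 1, by omega⟩
    have e1 : e + 1 + 2 * m - 1 = e + 2 * m := by omega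
    rw [e1]
    push_cast
    ring
  have hint := hFs.integral_Ioi_deriv_eq hF 0
  have hF0 : F 0 = 0 := by
    simp only [F]
    rw [zero_pow (by omega), zero_mul]
  rw [hF0, neg_zero] at hint
  have hcs : ∀ {H : ℝ → ℝ}, Continuous H → (∀ s, b < s → H s = 0) → ∀ n : ℕ,
      IntegrableOn (fun y => y ^ (d - 1) * (H (y ^ 2) * y ^ n)) (Ioi 0) := by
    intro H hH hHs n
    refine (Continuous.integrable_of_hasCompactSupport (by fun_prop) ?_).integrableOn
    refine HasCompactSupport.intro (isCompact_Icc (a := -(|b| + 1)) (b := |b| + 1)) fun y hy => ?_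
    have : |b| + 1 < |y| := by
      by_contra! h
      exact hy (abs_le.1 h)
    rw [hHs, zero_mul, mul_zero]
    have h1 : 0 ≤ |b| := abs_nonneg b
    have h2 := le_abs_self b
    rw [← sq_abs]
    nlinarith
  have hdB : ∀ s, b < s → deriv B s = 0 := by
    intro s hs
    have : B =ᶠ[𝓝 s] fun _ => 0 := by
      filter_upwards [lt_mem_nhds hs] with x hx
      exact hBs x hx.le
    rw [this.deriv_eq, deriv_const]
  simp_rw [hFd] at hint
  rw [integral_add ((hcs hB.continuous (fun s hs => hBs s hs.le) _).const_mul _)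
    ((hcs (hB.continuous_deriv (by simp)) hdB _).const_mul _), integral_const_mul,
    integral_const_mul] at hint
  have p1 := integral_fun_norm_addHaar (volume : Measure (E d)) fun y => B (y ^ 2) * y ^ (2 * m)
  have p2 := integral_fun_norm_addHaar (volume : Measure (E d))
    fun y => deriv B (y ^ 2) * y ^ (2 * m + 2)
  rw [p1, p2]
  simp only [hdim, smul_eq_mul, nsmul_eq_mul]
  linear_combination (d * volume.real (Metric.ball (0 : E d) 1)) * hint

lemma integrable_of_continuous_of_norm {F : E d → ℝ} (hF : Continuous F)
    (hs : ∀ z, 1 / 4 < ‖z‖ → F z = 0) : Integrable F :=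
  hF.integrable_of_hasCompactSupport (HasCompactSupport.intro
    (isCompact_closedBall (0 : E d) (1 / 4)) fun z hz => hs z (by simpa using hz))

/-! ### The kernels of the two laws -/

/-- `β(|z|²) Id`, the kernel whose balance involves the full energy flux. -/
def scalarKernel (β : ℝ → ℝ) (z : E d) : E d →L[ℝ] E d :=
  β (‖z‖ ^ 2) • ContinuousLinearMap.id ℝ (E d)

/-- `A(|z|²) Id + β(|z|²) z ⊗ z`; when `A' = -β` its balance involves only longitudinal increments. -/
def longitudinalKernel (A β : ℝ → ℝ) (z : E d) : E d →L[ℝ] E d :=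
  A (‖z‖ ^ 2) • ContinuousLinearMap.id ℝ (E d) + β (‖z‖ ^ 2) • (innerSL ℝ z).smulRight z

lemma scalarKernel_apply (β : ℝ → ℝ) (z c : E d) : scalarKernel β z c = β (‖z‖ ^ 2) • c := rfl

lemma longitudinalKernel_apply (A β : ℝ → ℝ) (z c : E d) :
    longitudinalKernel A β z c = A (‖z‖ ^ 2) • c + (β (‖z‖ ^ 2) * inner ℝ z c) • z := by
  simp [longitudinalKernel, smul_smul]

lemma contDiff_radial {β : ℝ → ℝ} (hβ : ContDiff ℝ (⊤ : ℕ∞) β) :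
    ContDiff ℝ (⊤ : ℕ∞) fun z : E d => β (‖z‖ ^ 2) :=
  hβ.comp (contDiff_norm_sq ℝ)

lemma radial_eq_zero {β : ℝ → ℝ} {b : ℝ} (hb : b ≤ 1 / 16) (hβ : ∀ s, b ≤ s → β s = 0) {z : E d}
    (hz : 1 / 4 < ‖z‖) : β (‖z‖ ^ 2) = 0 :=
  hβ _ (by nlinarith)

lemma isSmoothKernel_scalarKernel {β : ℝ → ℝ} {b : ℝ} (hb : b ≤ 1 / 16)
    (hβ : ContDiff ℝ (⊤ : ℕ∞) β) (hβs : ∀ s, b ≤ s → β s = 0) :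
    IsSmoothKernel (scalarKernel β : E d → _) where
  smooth := (contDiff_radial hβ).smul contDiff_const
  supp z hz := by
    ext1 c
    rw [scalarKernel_apply, radial_eq_zero hb hβs hz, zero_smul, zero_apply]

lemma isSmoothKernel_longitudinalKernel {A β : ℝ → ℝ} {b : ℝ} (hb : b ≤ 1 / 16)
    (hA : ContDiff ℝ (⊤ : ℕ∞) A) (hAs : ∀ s, b ≤ s → A s = 0)
    (hβ : ContDiff ℝ (⊤ : ℕ∞) β) (hβs : ∀ s, b ≤ s → β s = 0) :
    IsSmoothKernel (longitudinalKernel A β : E d → _) where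
  smooth := ((contDiff_radial hA).smul contDiff_const).add
    ((contDiff_radial hβ).smul ((innerSL ℝ).contDiff.smulRight contDiff_id))
  supp z hz := by
    ext1 c
    rw [longitudinalKernel_apply, radial_eq_zero hb hβs hz, radial_eq_zero hb hAs hz, zero_smul,
      zero_mul, zero_smul, add_zero, zero_apply]

lemma fderiv_apply_eq_of_hasDerivAt {K : E d → E d →L[ℝ] E d} (hK : IsSmoothKernel K) {z a c D : E d}
    (h : HasDerivAt (fun s : ℝ => K (z + s • a) c) D 0) : fderiv ℝ K z a c = D := by
  have h1 : HasDerivAt (fun s : ℝ => z + s • a) a 0 := by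
    simpa using ((hasDerivAt_id (0 : ℝ)).smul_const a).const_add z
  have h2 : HasFDerivAt K (fderiv ℝ K z) (z + (0 : ℝ) • a) := by
    simpa using ((hK.smooth.differentiable (by simp)) z).hasFDerivAt
  have h3 := (ContinuousLinearMap.apply ℝ (E d) c).hasFDerivAt.comp_hasDerivAt (0 : ℝ)
    (h2.comp_hasDerivAt (0 : ℝ) h1)
  exact h3.unique h

lemma hasDerivAt_add_smul (z a : E d) : HasDerivAt (fun s : ℝ => z + s • a) a 0 := by
  simpa using ((hasDerivAt_id (0 : ℝ)).smul_const a).const_add z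

lemma hasDerivAt_radial_line {β : ℝ → ℝ} {β' : ℝ} (z a : E d) (h : HasDerivAt β β' (‖z‖ ^ 2)) :
    HasDerivAt (fun s : ℝ => β (‖z + s • a‖ ^ 2)) (β' * (2 * inner ℝ z a)) 0 := by
  have h1 := (hasDerivAt_add_smul z a).norm_sq
  have h2 : HasDerivAt β β' (‖z + (0 : ℝ) • a‖ ^ 2) := by simpa using h
  have h3 := h2.comp (0 : ℝ) h1
  rw [zero_smul, add_zero] at h3
  exact h3

lemma fderiv_scalarKernel {β : ℝ → ℝ} {b : ℝ} (hb : b ≤ 1 / 16)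
    (hβ : ContDiff ℝ (⊤ : ℕ∞) β) (hβs : ∀ s, b ≤ s → β s = 0) {β' : ℝ → ℝ}
    (hd : ∀ s, HasDerivAt β (β' s) s) (z a c : E d) :
    fderiv ℝ (scalarKernel β) z a c = (β' (‖z‖ ^ 2) * (2 * inner ℝ z a)) • c := by
  refine fderiv_apply_eq_of_hasDerivAt (isSmoothKernel_scalarKernel hb hβ hβs) ?_
  simp_rw [scalarKernel_apply]
  exact (hasDerivAt_radial_line z a (hd _)).smul_const c

lemma fderiv_longitudinalKernel {A β : ℝ → ℝ} {b : ℝ} (hb : b ≤ 1 / 16)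
    (hA : ContDiff ℝ (⊤ : ℕ∞) A) (hAs : ∀ s, b ≤ s → A s = 0)
    (hβ : ContDiff ℝ (⊤ : ℕ∞) β) (hβs : ∀ s, b ≤ s → β s = 0) {A' β' : ℝ → ℝ}
    (hdA : ∀ s, HasDerivAt A (A' s) s) (hdβ : ∀ s, HasDerivAt β (β' s) s) (z a c : E d) :
    fderiv ℝ (longitudinalKernel A β) z a c = (A' (‖z‖ ^ 2) * (2 * inner ℝ z a)) • c
      + ((β (‖z‖ ^ 2) * inner ℝ z c) • a
        + (β' (‖z‖ ^ 2) * (2 * inner ℝ z a) * inner ℝ z c + β (‖z‖ ^ 2) * inner ℝ a c) • z) := by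
  refine fderiv_apply_eq_of_hasDerivAt (isSmoothKernel_longitudinalKernel hb hA hAs hβ hβs) ?_
  simp_rw [longitudinalKernel_apply]
  have h1 : HasDerivAt (fun s : ℝ => inner ℝ (z + s • a) c) (inner ℝ a c) 0 := by
    simpa using (hasDerivAt_add_smul z a).inner ℝ (hasDerivAt_const (0 : ℝ) c)
  have h2 := ((hasDerivAt_radial_line z a (hdβ _)).mul h1).smul (hasDerivAt_add_smul z a)
  have h3 := ((hasDerivAt_radial_line z a (hdA _)).smul_const c).add h2
  refine h3.congr_deriv ?_
  simp only [zero_smul, add_zero, Pi.mul_apply]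

/-- The exponent by which the kernel of the law of kind `k` scales: its size is `|z|^(2m)`.
The value at `T` is a convention: the transversal law is deduced from the other two. -/
def kindPow : Kind → ℕ
  | Kind.I => 0
  | Kind.L => 1
  | Kind.T => 0

/-- The cubic form `|z|^(2m) ⟨z, v⟩ |T_k(z) v|²`, as a polynomial in `z` and `v` for
`k = I, L`. The value at `T` is a convention: the transversal law is deduced from the other two. -/
def cubicForm : Kind → E d → E d → ℝ
  | Kind.I, z, v => inner ℝ z v * ‖v‖ ^ 2
  | Kind.L, z, v => inner ℝ z v ^ 3
  | Kind.T, _, _ => 0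

/-- A kernel whose smoothed balance law is the law of kind `k` averaged with the profile `g`.
The value of the mean makes `form` consistent with the normalization `coeff d k`; the remaining fields
bound the kernel and its derivative in terms of the scale `b` of `|z|²`. -/
structure IsLawKernel (k : Kind) (b : ℝ) (g : ℝ → ℝ) (K : E d → E d →L[ℝ] E d) : Prop
    extends IsSolenoidalKernel K where
  mean : ∀ a, ∫ z, K z a ∂(ballMeasure d)
    = (1 / (2 * coeff d k) * ∫ z : E d, g (‖z‖ ^ 2) * ‖z‖ ^ (2 * kindPow k + 2)) • a
  form : ∀ z v, kernelForm K z v v v = -2 * g (‖z‖ ^ 2) * cubicForm k z v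
  supp_ball : ∀ z, b < ‖z‖ ^ 2 → K z = 0
  norm_le : ∀ z, ‖K z‖ ≤ 2 * b ^ kindPow k
  supp_fderiv : ∀ z, b < ‖z‖ ^ 2 → ∀ a, fderiv ℝ K z a = 0
  norm_fderiv_le : ∀ z a, ‖fderiv ℝ K z a‖
    ≤ (4 * kindPow k * ‖z‖ + 2 * (g (‖z‖ ^ 2) * ‖z‖ ^ (2 * kindPow k + 1))) * ‖a‖

lemma inner_single_right_eq (z : E d) (j : Fin d) :
    inner ℝ z (EuclideanSpace.single j 1 : E d) = z j := by
  simp [EuclideanSpace.inner_single_right]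

lemma inner_eq_sum (z c : E d) : inner ℝ z c = ∑ j, z j * c j := by
  rw [PiLp.inner_apply]
  refine Finset.sum_congr rfl fun j _ => ?_
  simp [mul_comm]

lemma fderiv_radial {β : ℝ → ℝ} {β' : ℝ → ℝ} (hd : ∀ s, HasDerivAt β (β' s) s) (z a : E d) :
    fderiv ℝ (fun z : E d => β (‖z‖ ^ 2)) z a = β' (‖z‖ ^ 2) * (2 * inner ℝ z a) := by
  have h1 : HasFDerivAt (fun z : E d => ‖z‖ ^ 2) (2 • innerSL ℝ z) z :=
    (hasStrictFDerivAt_norm_sq z).hasFDerivAt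
  have h2 := (hd (‖z‖ ^ 2)).hasFDerivAt.comp z h1
  have h3 : HasFDerivAt (fun z : E d => β (‖z‖ ^ 2)) _ z := h2
  rw [h3.fderiv]
  simp
  ring

/-- The divergence of `β(|z|²) Id` is the gradient of `β(|z|²)`. -/
lemma isSolenoidalKernel_scalarKernel {β : ℝ → ℝ} {b : ℝ} (hb : b ≤ 1 / 16)
    (hβ : ContDiff ℝ (⊤ : ℕ∞) β) (hβs : ∀ s, b ≤ s → β s = 0) :
    IsSolenoidalKernel (scalarKernel β : E d → _) where
  toIsSmoothKernel := isSmoothKernel_scalarKernel hb hβ hβs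
  even z := by simp [scalarKernel]
  symm z a c := by
    rw [scalarKernel_apply, scalarKernel_apply, inner_smul_left, inner_smul_right]; rfl
  div_eq_grad := by
    have hd : ∀ s, HasDerivAt β (deriv β s) s := fun s =>
      ((hβ.differentiable (by simp)) s).hasDerivAt
    refine ⟨fun z => β (‖z‖ ^ 2), contDiff_radial hβ, fun z hz => radial_eq_zero hb hβs hz,
      fun z c => ?_⟩
    rw [fderiv_radial hd, inner_eq_sum, Finset.mul_sum, Finset.mul_sum]
    refine Finset.sum_congr rfl fun j _ => ?_
    rw [fderiv_scalarKernel hb hβ hβs hd, inner_single_right_eq, PiLp.smul_apply, smul_eq_mul]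
    ring

/-- The kernel with `-β' = g` gives the law for the full increments. -/
lemma IsProfile.isLawKernel_scalarKernel (hd : 0 < d) {b : ℝ} {g : ℝ → ℝ}
    (hb : b ≤ 1 / 16) (hg : IsProfile b g) :
    IsLawKernel Kind.I b g (scalarKernel (tail g b) : E d → _) := by
  have hβ := contDiff_tail hg.smooth b
  have hβs : ∀ s, b ≤ s → tail g b s = 0 := fun s hs => tail_eq_zero hg.zero_right hs
  have hdβ := hasDerivAt_tail hg.smooth.continuous b
  have hf := fderiv_scalarKernel (d := d) hb hβ hβs hdβ
  have hd0 : (d : ℝ) ≠ 0 := by positivity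
  refine { isSolenoidalKernel_scalarKernel hb hβ hβs with
    mean := fun a => ?_, form := fun z v => ?_, supp_ball := fun z hz => ?_,
    norm_le := fun z => ?_, supp_fderiv := fun z hz a => ?_, norm_fderiv_le := fun z a => ?_ }
  · rw [integral_ballMeasure]
    · simp_rw [scalarKernel_apply]
      rw [integral_smul_const]
      congr 1
      have h := integral_radial_parts hd hβ hβs 0
      have hder : deriv (tail g b) = fun s => - g s := funext fun s => (hdβ s).deriv
      simp only [hder, mul_zero, pow_zero, mul_one, zero_add, CharP.cast_eq_zero, add_zero, neg_mul,
        integral_neg, mul_neg, neg_neg] at h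
      simp only [kindPow, coeff, mul_zero, zero_add]
      have hd4 : 1 / (2 * ((d : ℝ) / 4)) = 2 / d := by field_simp; norm_num
      rw [hd4, div_mul_eq_mul_div, eq_div_iff hd0]
      linarith
    · intro z hz
      rw [scalarKernel_apply, radial_eq_zero hb hβs hz, zero_smul]
  · rw [kernelForm, hf, inner_smul_right, real_inner_self_eq_norm_sq, cubicForm]
    ring
  · ext1 c
    rw [scalarKernel_apply, hβs _ hz.le, zero_smul, zero_apply]
  · refine ContinuousLinearMap.opNorm_le_bound _ (by simp [kindPow]) fun c => ?_
    rw [scalarKernel_apply, norm_smul, Real.norm_of_nonneg (tail_nonneg hg.nonneg hg.zero_right _)]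
    simp only [kindPow, pow_zero, mul_one]
    gcongr
    linarith [hg.tail_le_one (‖z‖ ^ 2)]
  · ext1 c
    rw [hf, hg.zero_right _ hz.le]
    simp
  · refine ContinuousLinearMap.opNorm_le_bound _ ?_ fun c => ?_
    · have := hg.nonneg (‖z‖ ^ 2)
      positivity
    · rw [hf, norm_smul, norm_mul, norm_neg, Real.norm_of_nonneg (hg.nonneg _), norm_mul]
      have h1 := norm_inner_le_norm (𝕜 := ℝ) z a
      have h2 := hg.nonneg (‖z‖ ^ 2)
      simp only [kindPow, CharP.cast_eq_zero, mul_zero, zero_mul, zero_add, pow_one, Real.norm_ofNat]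
      gcongr ?_ * _
      calc g (‖z‖ ^ 2) * (2 * ‖(inner ℝ z a : ℝ)‖) ≤ g (‖z‖ ^ 2) * (2 * (‖z‖ * ‖a‖)) := by gcongr
        _ = _ := by ring

lemma isSolenoidalKernel_longitudinalKernel {A β β' : ℝ → ℝ} {b : ℝ} (hb : b ≤ 1 / 16)
    (hA : ContDiff ℝ (⊤ : ℕ∞) A) (hAs : ∀ s, b ≤ s → A s = 0)
    (hβ : ContDiff ℝ (⊤ : ℕ∞) β) (hβs : ∀ s, b ≤ s → β s = 0)
    (hdA : ∀ s, HasDerivAt A (-β s) s) (hdβ : ∀ s, HasDerivAt β (β' s) s) :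
    IsSolenoidalKernel (longitudinalKernel A β : E d → _) where
  toIsSmoothKernel := isSmoothKernel_longitudinalKernel hb hA hAs hβ hβs
  even z := by
    ext1 c
    rw [longitudinalKernel_apply, longitudinalKernel_apply, norm_neg, inner_neg_left, smul_neg,
      mul_neg, neg_smul, neg_neg]
  symm z a c := by
    rw [longitudinalKernel_apply, longitudinalKernel_apply, inner_add_left, inner_add_right,
      real_inner_smul_left, real_inner_smul_left, inner_smul_right, inner_smul_right,
      real_inner_comm z a]
    ring
  div_eq_grad := by
    -- the potential is `θ(|z|²)` with `θ(s) = s β(s) - ((d - 3) / 2) A(s)`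
    have hdθ : ∀ s, HasDerivAt (fun s => s * β s - ((d : ℝ) - 3) / 2 * A s)
        ((1 * β s + s * β' s) - ((d : ℝ) - 3) / 2 * (-β s)) s := fun s =>
      ((hasDerivAt_id s).mul (hdβ s)).sub ((hdA s).const_mul _)
    have hθ : ContDiff ℝ (⊤ : ℕ∞) (fun s => s * β s - ((d : ℝ) - 3) / 2 * A s) :=
      (contDiff_id.mul hβ).sub (contDiff_const.mul hA)
    have hθs : ∀ s, b ≤ s → s * β s - ((d : ℝ) - 3) / 2 * A s = 0 := fun s hs => by
      rw [hβs s hs, hAs s hs]; ring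
    refine ⟨_, contDiff_radial hθ, fun z hz => radial_eq_zero hb hθs hz, fun z c => ?_⟩
    rw [fderiv_radial hdθ]
    have hterm : ∀ j : Fin d, (fderiv ℝ (longitudinalKernel A β) z (EuclideanSpace.single j 1) c) j
        = (-2 * β (‖z‖ ^ 2)) * (z j * c j) + (2 * β' (‖z‖ ^ 2) * inner ℝ z c) * (z j * z j)
          + β (‖z‖ ^ 2) * (z j * c j) + β (‖z‖ ^ 2) * inner ℝ z c := fun j => by
      rw [fderiv_longitudinalKernel hb hA hAs hβ hβs hdA hdβ, inner_single_right_eq,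
        real_inner_comm c (EuclideanSpace.single j 1), inner_single_right_eq]
      simp only [PiLp.add_apply, PiLp.smul_apply, smul_eq_mul, PiLp.single_apply, if_true]
      ring
    simp_rw [hterm, Finset.sum_add_distrib, ← Finset.mul_sum, ← inner_eq_sum,
      real_inner_self_eq_norm_sq]
    simp only [Finset.sum_const, Finset.card_univ, Fintype.card_fin, nsmul_eq_mul]
    ring

lemma integral_longitudinalKernel_apply {A β : ℝ → ℝ} {b : ℝ} (hb : b ≤ 1 / 16)
    (hA : ContDiff ℝ (⊤ : ℕ∞) A) (hAs : ∀ s, b ≤ s → A s = 0)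
    (hβ : ContDiff ℝ (⊤ : ℕ∞) β) (hβs : ∀ s, b ≤ s → β s = 0)
    (hdA : ∀ s, HasDerivAt A (-β s) s) (a : E d) :
    ∫ z, longitudinalKernel A β z a = (3 / 2 * ∫ z : E d, A (‖z‖ ^ 2)) • a := by
  have hK := isSmoothKernel_longitudinalKernel (d := d) hb hA hAs hβ hβs
  have cA := (contDiff_radial (d := d) hA).continuous
  have cβ := (contDiff_radial (d := d) hβ).continuous
  have iK : Integrable fun z => longitudinalKernel A β z a := by
    refine (hK.continuous.clm_apply continuous_const).integrable_of_hasCompactSupport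
      (HasCompactSupport.intro (isCompact_closedBall (0 : E d) (1 / 4)) fun z hz => ?_)
    rw [hK.supp z (by simpa using hz)]; rfl
  refine ext_inner_left ℝ fun e => ?_
  rw [← integral_inner iK, inner_smul_right]
  have i1 : Integrable fun z : E d => A (‖z‖ ^ 2) * inner ℝ e a :=
    integrable_of_continuous_of_norm (by fun_prop) fun z hz => by
      rw [radial_eq_zero hb hAs hz, zero_mul]
  have i2 : Integrable fun z : E d => β (‖z‖ ^ 2) * inner ℝ z a * inner ℝ e z :=
    integrable_of_continuous_of_norm (by fun_prop) fun z hz => by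
      rw [radial_eq_zero hb hβs hz, zero_mul, zero_mul]
  have hparts := integral_mul_fderiv_eq_neg_fderiv_mul_of_integrable (μ := (volume : Measure (E d)))
    (f := fun z : E d => inner ℝ a z) (g := fun z : E d => A (‖z‖ ^ 2)) (v := e)
    (by
      refine integrable_of_continuous_of_norm ?_ fun z hz => ?_
      · simp_rw [show (fun z : E d => inner ℝ a z) = innerSL ℝ a from rfl,
          ContinuousLinearMap.fderiv]
        fun_prop
      · rw [radial_eq_zero hb hAs hz, mul_zero])
    (by
      simp_rw [fderiv_radial hdA]
      refine integrable_of_continuous_of_norm (by fun_prop) fun z hz => ?_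
      rw [radial_eq_zero hb hβs hz]; ring)
    (integrable_of_continuous_of_norm (by fun_prop) fun z hz => by
      rw [radial_eq_zero hb hAs hz, mul_zero])
    (fun x _ => (innerSL ℝ a).differentiableAt)
    (fun x _ => ((contDiff_radial hA).differentiable (by simp)) x)
  simp_rw [fderiv_radial hdA, show (fun z : E d => inner ℝ a z) = innerSL ℝ a from rfl,
    ContinuousLinearMap.fderiv, innerSL_apply_apply] at hparts
  have e1 : ∫ z : E d, inner ℝ a z * (-β (‖z‖ ^ 2) * (2 * inner ℝ z e))
      = -2 * ∫ z : E d, β (‖z‖ ^ 2) * inner ℝ z a * inner ℝ e z := by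
    rw [← integral_const_mul]
    refine integral_congr_ae (Eventually.of_forall fun z => ?_)
    simp only
    rw [real_inner_comm z a, real_inner_comm e z]
    ring
  rw [e1, integral_const_mul] at hparts
  have e2 : ∀ z : E d, inner ℝ e (longitudinalKernel A β z a)
      = A (‖z‖ ^ 2) * inner ℝ e a + β (‖z‖ ^ 2) * inner ℝ z a * inner ℝ e z := fun z => by
    rw [longitudinalKernel_apply, inner_add_right, inner_smul_right, inner_smul_right]
  simp_rw [e2]
  rw [integral_add i1 i2, integral_mul_const]
  rw [real_inner_comm e a] at hparts
  linarith

/-- The kernel with `-β' = g` and `-A' = β` gives the law for the longitudinal increments. -/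
lemma IsProfile.isLawKernel_longitudinalKernel (hd : 0 < d) {b : ℝ} {g : ℝ → ℝ} (hb0 : 0 ≤ b)
    (hb : b ≤ 1 / 16) (hg : IsProfile b g) :
    IsLawKernel Kind.L b g (longitudinalKernel (tail (tail g b) b) (tail g b) : E d → _) := by
  have hβ := contDiff_tail hg.smooth b
  have hβs : ∀ s, b ≤ s → tail g b s = 0 := fun s hs => tail_eq_zero hg.zero_right hs
  have hdβ := hasDerivAt_tail hg.smooth.continuous b
  have hA := contDiff_tail hβ b
  have hAs : ∀ s, b ≤ s → tail (tail g b) b s = 0 := fun s hs => tail_eq_zero hβs hs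
  have hdA := hasDerivAt_tail hβ.continuous b
  have hf := fderiv_longitudinalKernel (d := d) hb hA hAs hβ hβs hdA hdβ
  have hd0 : (d : ℝ) ≠ 0 := by positivity
  have hβ0 := tail_nonneg hg.nonneg hg.zero_right
  have hA0 := tail_nonneg hβ0 hβs
  have hsupp : ∀ z : E d, b < ‖z‖ ^ 2 →
      longitudinalKernel (tail (tail g b) b) (tail g b) z = 0 := fun z hz => by
    ext1 c
    rw [longitudinalKernel_apply, hβs _ hz.le, hAs _ hz.le, zero_smul, zero_mul, zero_smul,
      add_zero, zero_apply]
  refine { isSolenoidalKernel_longitudinalKernel hb hA hAs hβ hβs hdA hdβ with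
    mean := fun a => ?_, form := fun z v => ?_, supp_ball := hsupp,
    norm_le := fun z => ?_, supp_fderiv := fun z hz a => ?_, norm_fderiv_le := fun z a => ?_ }
  · rw [integral_ballMeasure]
    · rw [integral_longitudinalKernel_apply hb hA hAs hβ hβs hdA]
      congr 1
      have h0 := integral_radial_parts hd hA hAs 0
      have h1 := integral_radial_parts hd hβ hβs 1
      have hder : deriv (tail g b) = fun s => - g s := funext fun s => (hdβ s).deriv
      have hder' : deriv (tail (tail g b) b) = fun s => - tail g b s :=
        funext fun s => (hdA s).deriv
      simp only [hder, hder', mul_zero, pow_zero, mul_one, zero_add, CharP.cast_eq_zero, add_zero,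
        neg_mul, integral_neg, mul_neg, neg_neg, Nat.cast_one] at h0 h1
      simp only [kindPow, coeff]
      have hd2 : (d : ℝ) + 2 ≠ 0 := by positivity
      have e : ∫ z : E d, tail (tail g b) b (‖z‖ ^ 2)
          = 4 / (d * (d + 2)) * ∫ z : E d, g (‖z‖ ^ 2) * ‖z‖ ^ (2 * 1 + 2) := by
        have e1 : ∫ z : E d, tail g b (‖z‖ ^ 2) * ‖z‖ ^ 2
            = 2 / (d + 2) * ∫ z : E d, g (‖z‖ ^ 2) * ‖z‖ ^ (2 * 1 + 2) := by
          rw [div_mul_eq_mul_div, eq_div_iff hd2]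
          linarith [h1]
        rw [e1] at h0
        generalize ∫ z : E d, g (‖z‖ ^ 2) * ‖z‖ ^ (2 * 1 + 2) = I at *
        field_simp at h0 ⊢
        linarith
      rw [e]
      generalize ∫ z : E d, g (‖z‖ ^ 2) * ‖z‖ ^ (2 * 1 + 2) = I
      field_simp
      ring
    · intro z hz
      rw [hsupp z (by nlinarith)]; rfl
  -- `A' = -β` cancels the terms with `|v|²`
  · rw [kernelForm, hf, cubicForm, inner_add_right, inner_add_right, inner_smul_right,
      inner_smul_right, inner_smul_right, real_inner_self_eq_norm_sq, real_inner_comm z v]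
    ring
  · simp only [kindPow, pow_one]
    rcases le_or_gt (‖z‖ ^ 2) b with hz | hz
    · refine ContinuousLinearMap.opNorm_le_bound _ (by linarith) fun c => ?_
      rw [longitudinalKernel_apply]
      have h1 : ‖(tail (tail g b) b (‖z‖ ^ 2)) • c‖ ≤ b * ‖c‖ := by
        rw [norm_smul, Real.norm_of_nonneg (hA0 _)]
        gcongr
        exact hg.tail_tail_le hb0 (by positivity)
      have h2 : ‖(tail g b (‖z‖ ^ 2) * inner ℝ z c) • z‖ ≤ b * ‖c‖ := by
        rw [norm_smul, norm_mul, Real.norm_of_nonneg (hβ0 _)]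
        calc _ ≤ 1 * (‖z‖ * ‖c‖) * ‖z‖ := by
              gcongr
              · exact hg.tail_le_one _
              · exact norm_inner_le_norm z c
          _ = ‖z‖ ^ 2 * ‖c‖ := by ring
          _ ≤ _ := by gcongr
      linarith [norm_add_le ((tail (tail g b) b (‖z‖ ^ 2)) • c)
        ((tail g b (‖z‖ ^ 2) * inner ℝ z c) • z)]
    · rw [hsupp z hz, norm_zero]
      linarith
  · ext1 c
    rw [hf, hg.zero_right _ hz.le, hβs _ hz.le]
    simp
  · have hg0 := hg.nonneg (‖z‖ ^ 2)
    refine ContinuousLinearMap.opNorm_le_bound _ (by positivity) fun c => ?_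
    rw [hf]
    have hβ1 := hg.tail_le_one (‖z‖ ^ 2)
    have hβ0' := hβ0 (‖z‖ ^ 2)
    have iza := norm_inner_le_norm (𝕜 := ℝ) z a
    have izc := norm_inner_le_norm (𝕜 := ℝ) z c
    have iac := norm_inner_le_norm (𝕜 := ℝ) a c
    have t1 : ‖(-tail g b (‖z‖ ^ 2) * (2 * inner ℝ z a)) • c‖ ≤ 1 * (2 * (‖z‖ * ‖a‖)) * ‖c‖ := by
      rw [norm_smul, norm_mul, norm_neg, Real.norm_of_nonneg hβ0', norm_mul, Real.norm_ofNat]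
      gcongr
    have t2 : ‖(tail g b (‖z‖ ^ 2) * inner ℝ z c) • a‖ ≤ 1 * (‖z‖ * ‖c‖) * ‖a‖ := by
      rw [norm_smul, norm_mul, Real.norm_of_nonneg hβ0']
      gcongr
    have t3 : ‖(-g (‖z‖ ^ 2) * (2 * inner ℝ z a) * inner ℝ z c
        + tail g b (‖z‖ ^ 2) * inner ℝ a c) • z‖
        ≤ (g (‖z‖ ^ 2) * (2 * (‖z‖ * ‖a‖)) * (‖z‖ * ‖c‖) + 1 * (‖a‖ * ‖c‖)) * ‖z‖ := by
      rw [norm_smul]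
      gcongr
      refine (norm_add_le _ _).trans (add_le_add ?_ ?_)
      · rw [norm_mul, norm_mul, norm_neg, Real.norm_of_nonneg hg0, norm_mul, Real.norm_ofNat]
        gcongr
      · rw [norm_mul, Real.norm_of_nonneg hβ0']
        gcongr
    refine (norm_add_le _ _).trans ?_
    refine (add_le_add t1 ((norm_add_le _ _).trans (add_le_add t2 t3))).trans (le_of_eq ?_)
    simp only [kindPow, Nat.cast_one]
    ring

lemma IsProfile.exists_isLawKernel (hd : 0 < d) {b : ℝ} {g : ℝ → ℝ} (hb0 : 0 ≤ b)
    (hb : b ≤ 1 / 16) (hg : IsProfile b g) {k : Kind} (hk : k ≠ Kind.T) :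
    ∃ K : E d → E d →L[ℝ] E d, IsLawKernel k b g K := by
  cases k
  · exact ⟨_, hg.isLawKernel_scalarKernel hd hb⟩
  · exact ⟨_, hg.isLawKernel_longitudinalKernel hd hb0 hb⟩
  · exact absurd rfl hk

/-! ### Spherical averages as limits of radial averages -/

instance isFiniteMeasure_sphereMeasure : IsFiniteMeasure (sphereMeasure d) := by
  unfold sphereMeasure; infer_instance

lemma sphereMeasure_real_univ_pos (hd : 0 < d) : 0 < (sphereMeasure d).real univ := by
  have : Nonempty (Fin d) := ⟨⟨0, hd⟩⟩
  have h : sphereMeasure d ≠ 0 := Measure.toSphere_ne_zero _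
  rw [Measure.real, ENNReal.toReal_pos_iff]
  exact ⟨by rwa [pos_iff_ne_zero, Ne, Measure.measure_univ_eq_zero], measure_lt_top _ _⟩

/-- Integration in polar coordinates. -/
lemma integral_eq_integral_polar (hd : 0 < d) {F : E d → ℝ} (hF : Integrable F) :
    ∫ z, F z = ∫ r in Ioi (0 : ℝ),
      r ^ (d - 1) * ∫ y : Metric.sphere (0 : E d) 1, F (r • (y : E d)) ∂(sphereMeasure d) := by
  have : Nonempty (Fin d) := ⟨⟨0, hd⟩⟩
  have hdim : Module.finrank ℝ (E d) = d := by simp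
  have hmp := (volume : Measure (E d)).measurePreserving_homeomorphUnitSphereProd
  have hme := (homeomorphUnitSphereProd (E d)).measurableEmbedding
  let g : Metric.sphere (0 : E d) 1 × Ioi (0 : ℝ) → ℝ := fun p => F (p.2.1 • p.1.1)
  have hg : ∀ x : ({0}ᶜ : Set (E d)), g (homeomorphUnitSphereProd (E d) x) = F x := by
    rintro ⟨x, hx⟩
    have hx' : ‖x‖ ≠ 0 := norm_ne_zero_iff.2 hx
    simp only [g, homeomorphUnitSphereProd_apply_snd_coe, homeomorphUnitSphereProd_apply_fst_coe]
    rw [smul_smul, mul_inv_cancel₀ hx', one_smul]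
  have hgi : Integrable g
      ((volume : Measure (E d)).toSphere.prod (.volumeIoiPow (Module.finrank ℝ (E d) - 1))) := by
    rw [← hmp.integrable_comp_emb hme]
    have : g ∘ homeomorphUnitSphereProd (E d) = F ∘ Subtype.val := funext hg
    rw [this, ← integrableOn_iff_comap_subtypeVal (measurableSet_singleton _).compl]
    exact hF.integrableOn
  calc ∫ z, F z = ∫ x : ({(0)}ᶜ : Set (E d)), F x.1 ∂((volume : Measure (E d)).comap (↑)) := by
        rw [integral_subtype_comap (measurableSet_singleton _).compl F, restrict_compl_singleton]
    _ = ∫ p, g p ∂((volume : Measure (E d)).toSphere.prod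
          (.volumeIoiPow (Module.finrank ℝ (E d) - 1))) := by
        rw [← hmp.integral_comp hme]
        exact integral_congr_ae (Eventually.of_forall fun x => (hg x).symm)
    _ = ∫ r, (∫ y, g (y, r) ∂(volume : Measure (E d)).toSphere)
          ∂(.volumeIoiPow (Module.finrank ℝ (E d) - 1)) := integral_prod_symm _ hgi
    _ = _ := by
        simp only [Measure.volumeIoiPow, ENNReal.ofReal]
        rw [integral_withDensity_eq_integral_smul]
        · rw [integral_subtype_comap measurableSet_Ioi fun a : ℝ =>
            Real.toNNReal (a ^ (Module.finrank ℝ (E d) - 1)) •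
              ∫ y : Metric.sphere (0 : E d) 1, F (a • (y : E d)) ∂(volume : Measure (E d)).toSphere]
          refine setIntegral_congr_fun measurableSet_Ioi fun x hx => ?_
          beta_reduce
          rw [NNReal.smul_def, Real.coe_toNNReal _ (pow_nonneg (le_of_lt hx) _), hdim, smul_eq_mul]
          rfl
        · exact (measurable_subtype_coe.pow_const _).real_toNNReal

/-- Profiles concentrated near the point `ℓ²`. -/
lemma exists_profile {ℓ δ : ℝ} (hδ : 0 < δ) (hδℓ : δ ≤ ℓ ^ 2) :
    ∃ g, IsProfile (4 * ℓ ^ 2) g ∧ ∀ s, δ ≤ |s - ℓ ^ 2| → g s = 0 := by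
  let f : ContDiffBump (ℓ ^ 2 : ℝ) := ⟨δ / 2, δ, by positivity, by linarith⟩
  have hz : ∀ s, δ ≤ |s - ℓ ^ 2| → f.normed volume s = 0 := fun s hs => by
    rw [← Function.notMem_support, f.support_normed_eq, Metric.mem_ball, Real.dist_eq]
    exact not_lt.2 hs
  refine ⟨f.normed volume, ⟨f.contDiff_normed, f.nonneg_normed, fun s hs => hz s ?_,
    fun s hs => hz s ?_, f.integral_normed⟩, hz⟩
  · rw [abs_of_nonpos (by linarith)]; linarith
  · have := sq_nonneg ℓ
    rw [abs_of_nonneg (by linarith)]; linarith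

/-- In the variable `r = √s` a profile becomes the probability density `2 r g(r²)`. -/
lemma IsProfile.integral_radius {b : ℝ} {g : ℝ → ℝ} (hg : IsProfile b g) :
    ∫ r in Ioi (0 : ℝ), 2 * r * g (r ^ 2) = 1 := by
  let F : ℝ → ℝ := fun r => tail g b (r ^ 2)
  have hF : ContDiff ℝ 1 F := by
    have h1 : ContDiff ℝ 1 (tail g b) := (contDiff_tail hg.smooth b).of_le (by simp)
    fun_prop
  have hFs : HasCompactSupport F := by
    refine HasCompactSupport.intro (isCompact_Icc (a := -(|b| + 1)) (b := |b| + 1)) fun y hy => ?_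
    have : |b| + 1 < |y| := by
      by_contra! h
      exact hy (abs_le.1 h)
    refine tail_eq_zero hg.zero_right ?_
    have h1 : 0 ≤ |b| := abs_nonneg b
    have h2 := le_abs_self b
    rw [← sq_abs]
    nlinarith
  have hFd : ∀ r, deriv F r = -(2 * r * g (r ^ 2)) := by
    intro r
    have h2 : HasDerivAt (fun y : ℝ => y ^ 2) (2 * r) r := by simpa using hasDerivAt_pow 2 r
    have h1 := hasDerivAt_tail hg.smooth.continuous b (r ^ 2)
    have h3 : HasDerivAt F (-g (r ^ 2) * (2 * r)) r := HasDerivAt.comp r (h₂ := tail g b) h1 h2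
    rw [h3.deriv]; ring
  have h := hFs.integral_Ioi_deriv_eq hF 0
  simp_rw [hFd, integral_neg] at h
  have hF0 : F 0 = 1 := by
    simp only [F, tail]
    rw [zero_pow (by norm_num)]
    rcases le_total 0 b with hb | hb
    · rw [intervalIntegral.integral_of_le hb, ← hg.integral_eq_one]
      refine setIntegral_eq_integral_of_forall_compl_eq_zero fun s hs => ?_
      by_cases h0 : s ≤ 0
      · exact hg.zero_left s h0
      · refine hg.zero_right s ?_
        by_contra! h'
        exact hs ⟨not_le.1 h0, h'.le⟩
    · exfalso
      have : g = fun _ => 0 := by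
        funext s
        rcases le_total s 0 with h0 | h0
        · exact hg.zero_left s h0
        · exact hg.zero_right s (hb.trans h0)
      have h1 := hg.integral_eq_one
      simp [this] at h1
  linarith [h, hF0]

lemma IsProfile.continuous_weight {b : ℝ} {g : ℝ → ℝ} (hg : IsProfile b g) :
    Continuous fun r : ℝ => 2 * r * g (r ^ 2) := by
  have := hg.smooth.continuous
  fun_prop

lemma IsProfile.integrable_weight_mul {b : ℝ} {g : ℝ → ℝ} (hg : IsProfile b g) {φ : ℝ → ℝ}
    (hφ : Continuous φ) : IntegrableOn (fun r : ℝ => 2 * r * g (r ^ 2) * φ r) (Ioi 0) := by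
  refine ((hg.continuous_weight.mul hφ).integrable_of_hasCompactSupport ?_).integrableOn
  refine HasCompactSupport.intro (isCompact_Icc (a := -(|b| + 1)) (b := |b| + 1)) fun y hy => ?_
  have : |b| + 1 < |y| := by
    by_contra! h
    exact hy (abs_le.1 h)
  have h1 : 0 ≤ |b| := abs_nonneg b
  have h2 := le_abs_self b
  rw [Pi.mul_apply, hg.zero_right (y ^ 2) (by rw [← sq_abs]; nlinarith)]
  ring

/-- Profiles `g n` whose mass concentrates at `ℓ²`. -/
def Concentrates (ℓ : ℝ) (g : ℕ → ℝ → ℝ) : Prop :=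
  ∀ δ > 0, ∀ᶠ n in atTop, ∀ s, δ ≤ |s - ℓ ^ 2| → g n s = 0

lemma exists_concentrating_profiles {ℓ : ℝ} (hℓ : 0 < ℓ) :
    ∃ g : ℕ → ℝ → ℝ, (∀ n, IsProfile (4 * ℓ ^ 2) (g n)) ∧ Concentrates ℓ g := by
  have h : ∀ n : ℕ, ∃ g, IsProfile (4 * ℓ ^ 2) g ∧
      ∀ s, ℓ ^ 2 * (1 / ((n : ℝ) + 1)) ≤ |s - ℓ ^ 2| → g s = 0 := fun n => by
    refine exists_profile (by positivity) ?_
    have : 1 / ((n : ℝ) + 1) ≤ 1 := by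
      rw [div_le_one (by positivity)]; linarith [Nat.cast_nonneg (α := ℝ) n]
    nlinarith [sq_nonneg ℓ]
  choose g hg hs using h
  refine ⟨g, hg, fun δ hδ => ?_⟩
  have ht : Tendsto (fun n : ℕ => ℓ ^ 2 * (1 / ((n : ℝ) + 1))) atTop (𝓝 (ℓ ^ 2 * 0)) :=
    tendsto_one_div_add_atTop_nhds_zero_nat.const_mul _
  rw [mul_zero] at ht
  filter_upwards [ht.eventually_lt_const hδ] with n hn s hsδ
  exact hs n s (hn.le.trans hsδ)

lemma tendsto_integral_weight_mul {ℓ : ℝ} (hℓ : 0 < ℓ) {b : ℝ} {g : ℕ → ℝ → ℝ}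
    (hg : ∀ n, IsProfile b (g n)) (hc : Concentrates ℓ g) {φ : ℝ → ℝ} (hφ : Continuous φ) :
    Tendsto (fun n => ∫ r in Ioi (0 : ℝ), 2 * r * g n (r ^ 2) * φ r) atTop (𝓝 (φ ℓ)) := by
  rw [Metric.tendsto_nhds]
  intro ε hε
  obtain ⟨η, hη, hφη⟩ := Metric.continuousAt_iff.1 (hφ.continuousAt (x := ℓ)) (ε / 2) (by positivity)
  filter_upwards [hc (η * ℓ) (by positivity)] with n hn
  rw [Real.dist_eq]
  have e : (∫ r in Ioi (0 : ℝ), 2 * r * g n (r ^ 2) * φ r) - φ ℓ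
      = ∫ r in Ioi (0 : ℝ), 2 * r * g n (r ^ 2) * (φ r - φ ℓ) := by
    have h1 : φ ℓ = ∫ r in Ioi (0 : ℝ), 2 * r * g n (r ^ 2) * φ ℓ := by
      rw [integral_mul_const, (hg n).integral_radius, one_mul]
    nth_rewrite 1 [h1]
    rw [← integral_sub ((hg n).integrable_weight_mul hφ)
      ((hg n).integrable_weight_mul continuous_const)]
    simp_rw [mul_sub]
  rw [e]
  have hle : |∫ r in Ioi (0 : ℝ), 2 * r * g n (r ^ 2) * (φ r - φ ℓ)|
      ≤ ∫ r in Ioi (0 : ℝ), 2 * r * g n (r ^ 2) * (ε / 2) := by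
    rw [← Real.norm_eq_abs]
    refine norm_integral_le_of_norm_le ((hg n).integrable_weight_mul continuous_const) ?_
    filter_upwards [ae_restrict_mem measurableSet_Ioi] with r hr
    have hr0 : 0 < r := hr
    have hg0 := (hg n).nonneg (r ^ 2)
    rw [norm_mul, Real.norm_of_nonneg (by positivity)]
    by_cases hrη : |r - ℓ| < η
    · gcongr
      exact (hφη hrη).le
    · rw [hn (r ^ 2)]
      · simp
      · rw [sq_sub_sq, abs_mul, abs_of_pos (by positivity), mul_comm]
        exact mul_le_mul (by linarith) (not_lt.1 hrη) hη.le (by positivity)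
  rw [integral_mul_const, (hg n).integral_radius, one_mul] at hle
  linarith

lemma IsProfile.integral_radial_mul (hd : 2 ≤ d) {b : ℝ} {g : ℝ → ℝ} (hg : IsProfile b g)
    {h : E d → ℝ} (hh : Continuous h) :
    ∫ z : E d, g (‖z‖ ^ 2) * h z = ∫ r in Ioi (0 : ℝ), 2 * r * g (r ^ 2) *
      (1 / 2 * r ^ (d - 2) * ∫ y : Metric.sphere (0 : E d) 1, h (r • (y : E d)) ∂(sphereMeasure d)) := by
  have hgc := hg.smooth.continuous
  have hi : Integrable fun z : E d => g (‖z‖ ^ 2) * h z := by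
    refine Continuous.integrable_of_hasCompactSupport (by fun_prop)
      (HasCompactSupport.intro (isCompact_closedBall (0 : E d) (|b| + 1)) fun z hz => ?_)
    have : |b| + 1 < ‖z‖ := by simpa using hz
    have h1 : 0 ≤ |b| := abs_nonneg b
    have h2 := le_abs_self b
    rw [hg.zero_right _ (by nlinarith), zero_mul]
  rw [integral_eq_integral_polar (by omega) hi]
  refine setIntegral_congr_fun measurableSet_Ioi fun r hr => ?_
  have hr0 : 0 < r := hr
  have e : ∀ y : Metric.sphere (0 : E d) 1, g (‖r • (y : E d)‖ ^ 2) * h (r • (y : E d))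
      = g (r ^ 2) * h (r • (y : E d)) := fun y => by
    rw [norm_smul, norm_eq_of_mem_sphere, mul_one, Real.norm_eq_abs, sq_abs]
  beta_reduce
  simp_rw [e]
  rw [integral_const_mul]
  obtain ⟨m, rfl⟩ : ∃ m, d = m + 2 := ⟨d - 2, by omega⟩
  rw [show m + 2 - 1 = m + 1 by omega, show m + 2 - 2 = m by omega]
  ring

lemma continuous_integral_sphere {h : E d → ℝ} (hh : Continuous h) :
    Continuous fun r : ℝ => ∫ y : Metric.sphere (0 : E d) 1, h (r • (y : E d)) ∂(sphereMeasure d) := by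
  have h1 : Continuous (Function.uncurry
      fun (r : ℝ) (y : Metric.sphere (0 : E d) 1) => h (r • (y : E d))) := by
    unfold Function.uncurry
    fun_prop
  simpa using continuous_parametric_integral_of_continuous (μ := sphereMeasure d) h1
    isCompact_univ

/-- Averages against concentrating radial profiles converge to averages over a sphere. -/
lemma tendsto_integral_radial_mul (hd : 2 ≤ d) {ℓ : ℝ} (hℓ : 0 < ℓ) {b : ℝ} {g : ℕ → ℝ → ℝ}
    (hg : ∀ n, IsProfile b (g n)) (hc : Concentrates ℓ g) {h : E d → ℝ} (hh : Continuous h) :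
    Tendsto (fun n => ∫ z : E d, g n (‖z‖ ^ 2) * h z) atTop (𝓝 (1 / 2 * ℓ ^ (d - 2) *
      ∫ y : Metric.sphere (0 : E d) 1, h (ℓ • (y : E d)) ∂(sphereMeasure d))) := by
  simp_rw [fun n => (hg n).integral_radial_mul hd hh]
  have := continuous_integral_sphere hh
  exact tendsto_integral_weight_mul hℓ hg hc (φ := fun r => 1 / 2 * r ^ (d - 2) *
    ∫ y : Metric.sphere (0 : E d) 1, h (r • (y : E d)) ∂(sphereMeasure d)) (by fun_prop)

/-! ### Integrals of cubic forms of increments -/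

lemma continuous_cubicForm (k : Kind) : Continuous fun p : E d × E d => cubicForm k p.1 p.2 := by
  cases k <;> simp only [cubicForm] <;> fun_prop

lemma cubicForm_smul (k : Kind) (a : ℝ) (z v : E d) :
    cubicForm k (a • z) v = a ^ (2 * kindPow k + 1) * cubicForm k z v := by
  cases k <;> simp only [cubicForm, kindPow, real_inner_smul_left] <;> ring

lemma abs_cubicForm_sub_le (k : Kind) (z a b : E d) :
    |cubicForm k z a - cubicForm k z b|
      ≤ ‖z‖ ^ (2 * kindPow k + 1) * (3 * ‖a - b‖ * (‖a‖ + ‖b‖) ^ 2) := by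
  have hz := norm_nonneg z
  have ha := norm_nonneg a
  have hb := norm_nonneg b
  have hab := norm_nonneg (a - b)
  have hia := abs_real_inner_le_norm z a
  have hib := abs_real_inner_le_norm z b
  have hiab : |inner ℝ z a - inner ℝ z b| ≤ ‖z‖ * ‖a - b‖ := by
    rw [← inner_sub_right]; exact abs_real_inner_le_norm _ _
  cases k
  · simp only [cubicForm, kindPow, mul_zero, zero_add, pow_one]
    have e : inner ℝ z a * ‖a‖ ^ 2 - inner ℝ z b * ‖b‖ ^ 2
        = (inner ℝ z a - inner ℝ z b) * ‖a‖ ^ 2 + inner ℝ z b * ((‖a‖ - ‖b‖) * (‖a‖ + ‖b‖)) := by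
      ring
    rw [e]
    refine (abs_add_le _ _).trans ?_
    rw [abs_mul, abs_mul, abs_mul, abs_of_nonneg (by positivity : 0 ≤ ‖a‖ ^ 2),
      abs_of_nonneg (by positivity : 0 ≤ ‖a‖ + ‖b‖)]
    calc _ ≤ ‖z‖ * ‖a - b‖ * ‖a‖ ^ 2 + ‖z‖ * ‖b‖ * (‖a - b‖ * (‖a‖ + ‖b‖)) := by
          gcongr
          exact abs_norm_sub_norm_le a b
      _ = ‖z‖ * (‖a - b‖ * (‖a‖ ^ 2 + ‖b‖ * (‖a‖ + ‖b‖))) := by ring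
      _ ≤ ‖z‖ * (‖a - b‖ * (3 * (‖a‖ + ‖b‖) ^ 2)) := by
          gcongr
          nlinarith [mul_nonneg ha hb]
      _ = _ := by ring
  · simp only [cubicForm, kindPow]
    have e : inner ℝ z a ^ 3 - inner ℝ z b ^ 3 = (inner ℝ z a - inner ℝ z b)
        * (inner ℝ z a * inner ℝ z a + inner ℝ z a * inner ℝ z b + inner ℝ z b * inner ℝ z b) := by
      ring
    rw [e, abs_mul]
    calc _ ≤ ‖z‖ * ‖a - b‖ * (‖z‖ * ‖a‖ * (‖z‖ * ‖a‖) + ‖z‖ * ‖a‖ * (‖z‖ * ‖b‖)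
            + ‖z‖ * ‖b‖ * (‖z‖ * ‖b‖)) := by
          gcongr
          refine (abs_add_le _ _).trans (add_le_add ((abs_add_le _ _).trans (add_le_add ?_ ?_)) ?_)
          all_goals rw [abs_mul]; gcongr
      _ = ‖z‖ ^ (2 * 1 + 1) * (‖a - b‖ * (‖a‖ ^ 2 + ‖a‖ * ‖b‖ + ‖b‖ ^ 2)) := by ring
      _ ≤ ‖z‖ ^ (2 * 1 + 1) * (‖a - b‖ * (3 * (‖a‖ + ‖b‖) ^ 2)) := by
          gcongr
          nlinarith [mul_nonneg ha hb]
      _ = _ := by ring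
  · simp only [cubicForm, sub_zero, abs_zero]
    positivity

lemma abs_cubicForm_le (k : Kind) (z a : E d) :
    |cubicForm k z a| ≤ 3 * ‖z‖ ^ (2 * kindPow k + 1) * ‖a‖ ^ 3 := by
  have h := abs_cubicForm_sub_le k z a 0
  have h0 : cubicForm k z (0 : E d) = 0 := by cases k <;> simp [cubicForm]
  rw [h0, sub_zero, sub_zero, norm_zero, add_zero] at h
  exact h.trans (le_of_eq (by ring))

section Continuity

variable {X : Type*} [MeasurableSpace X] {μ : Measure X}

lemma lintegral_enorm_pow_three {F' : Type*} [NormedAddCommGroup F'] (v : X → F') :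
    ∫⁻ x, ‖v x‖ₑ ^ 3 ∂μ = eLpNorm v 3 μ ^ 3 := by
  have h := eLpNorm_nnreal_pow_eq_lintegral (f := v) (μ := μ) (p := 3) (by norm_num)
  simp only [NNReal.coe_ofNat, ENNReal.coe_ofNat] at h
  norm_cast at h
  exact h.symm

lemma lintegral_enorm_mul_sq_le {F' : Type*} [NormedAddCommGroup F'] {v w : X → F'}
    (hv : AEStronglyMeasurable v μ) (hw : AEStronglyMeasurable w μ) :
    ∫⁻ x, ‖v x‖ₑ * ‖w x‖ₑ ^ 2 ∂μ ≤ eLpNorm v 3 μ * eLpNorm w 3 μ ^ 2 := by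
  have h := ENNReal.lintegral_mul_norm_pow_le (hv.enorm.pow_const 3) (hw.enorm.pow_const 3)
    (p := 1 / 3) (q := 2 / 3) (by norm_num) (by norm_num) (by norm_num)
  have e1 : ∀ a : ℝ≥0∞, (a ^ 3) ^ (1 / 3 : ℝ) = a := fun a => by
    rw [← ENNReal.rpow_natCast, ← ENNReal.rpow_mul]; norm_num
  have e2 : ∀ a : ℝ≥0∞, (a ^ 3) ^ (2 / 3 : ℝ) = a ^ 2 := fun a => by
    rw [← ENNReal.rpow_natCast, ← ENNReal.rpow_mul, ← ENNReal.rpow_natCast]; norm_num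
  simp_rw [lintegral_enorm_pow_three, e1, e2] at h
  exact h

lemma integrable_cubicForm (k : Kind) {ζ : X → E d} (hζ : AEStronglyMeasurable ζ μ) {C : ℝ}
    (hC : ∀ x, ‖ζ x‖ ≤ C) {v : X → E d} (hv : MemLp v 3 μ) :
    Integrable (fun x => cubicForm k (ζ x) (v x)) μ := by
  refine ((hv.integrable_norm_pow (p := 3) (by norm_num)).const_mul
    (3 * C ^ (2 * kindPow k + 1))).mono'
    ((continuous_cubicForm k).comp_aestronglyMeasurable (hζ.prodMk hv.1))
    (Eventually.of_forall fun x => (abs_cubicForm_le k _ _).trans ?_)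
  gcongr
  exact hC x

/-- The integral of a cubic form depends continuously on the field in `L³`. -/
lemma tendsto_integral_cubicForm (k : Kind) {A : E d → X → E d} (hA : ∀ z, MemLp (A z) 3 μ)
    {z₀ : E d} (hlim : Tendsto (fun z => eLpNorm (fun x => A z x - A z₀ x) 3 μ) (𝓝 z₀) (𝓝 0)) :
    Tendsto (fun z => ∫ x, cubicForm k z (A z x) ∂μ) (𝓝 z₀)
      (𝓝 (∫ x, cubicForm k z₀ (A z₀ x) ∂μ)) := by
  have hint : ∀ z z', Integrable (fun x => cubicForm k z (A z' x)) μ := fun z z' =>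
    integrable_cubicForm k aestronglyMeasurable_const (fun _ => le_rfl) (hA z')
  have h1 : Tendsto (fun z => ∫ x, cubicForm k z (A z₀ x) ∂μ) (𝓝 z₀)
      (𝓝 (∫ x, cubicForm k z₀ (A z₀ x) ∂μ)) := by
    refine tendsto_integral_filter_of_dominated_convergence
      (fun x => 3 * (‖z₀‖ + 1) ^ (2 * kindPow k + 1) * ‖A z₀ x‖ ^ 3)
      (Eventually.of_forall fun z => (hint z z₀).1) ?_
      (((hA z₀).integrable_norm_pow (p := 3) (by norm_num)).const_mul _)
      (Eventually.of_forall fun x => ?_)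
    · filter_upwards [Metric.ball_mem_nhds z₀ one_pos] with z hz
      refine Eventually.of_forall fun x => (abs_cubicForm_le k _ _).trans ?_
      gcongr
      have : ‖z - z₀‖ < 1 := by rwa [← dist_eq_norm]
      linarith [norm_le_norm_add_norm_sub' z z₀]
    · exact ((continuous_cubicForm k).comp
        (continuous_id.prodMk continuous_const)).tendsto z₀
  have h2 : Tendsto (fun z => (∫ x, cubicForm k z (A z x) ∂μ) - ∫ x, cubicForm k z (A z₀ x) ∂μ)
      (𝓝 z₀) (𝓝 0) := by
    rw [tendsto_zero_iff_enorm_tendsto_zero]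
    have hle : ∀ z, ‖(∫ x, cubicForm k z (A z x) ∂μ) - ∫ x, cubicForm k z (A z₀ x) ∂μ‖ₑ
        ≤ ENNReal.ofReal (‖z‖ ^ (2 * kindPow k + 1)) *
          (6 * eLpNorm (fun x => A z x - A z₀ x) 3 μ ^ 3
            + 24 * (eLpNorm (fun x => A z x - A z₀ x) 3 μ * eLpNorm (A z₀) 3 μ ^ 2)) := by
      intro z
      have hD := (hA z).sub (hA z₀)
      rw [← integral_sub (hint z z) (hint z z₀)]
      refine (enorm_integral_le_lintegral_enorm _).trans ?_
      calc _ ≤ ∫⁻ x, ENNReal.ofReal (‖z‖ ^ (2 * kindPow k + 1)) *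
            (6 * ‖A z x - A z₀ x‖ₑ ^ 3 + 24 * (‖A z x - A z₀ x‖ₑ * ‖A z₀ x‖ₑ ^ 2)) ∂μ := by
            refine lintegral_mono fun x => ?_
            have ha : ‖A z x‖ ≤ ‖A z x - A z₀ x‖ + ‖A z₀ x‖ := norm_le_norm_sub_add _ _
            have hle := abs_cubicForm_sub_le k z (A z x) (A z₀ x)
            rw [← ofReal_norm, ← ofReal_norm, ← ofReal_norm,
              ← ENNReal.ofReal_pow (norm_nonneg _), ← ENNReal.ofReal_pow (norm_nonneg _),
              ← ENNReal.ofReal_mul (norm_nonneg _), ← ENNReal.ofReal_ofNat 6,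
              ← ENNReal.ofReal_ofNat 24, ← ENNReal.ofReal_mul (by norm_num),
              ← ENNReal.ofReal_mul (by norm_num), ← ENNReal.ofReal_add (by positivity)
              (by positivity), ← ENNReal.ofReal_mul (by positivity)]
            refine ENNReal.ofReal_le_ofReal (hle.trans ?_)
            gcongr
            have h0 := norm_nonneg (A z x)
            set p := ‖A z x - A z₀ x‖
            set q := ‖A z₀ x‖
            have hp : 0 ≤ p := norm_nonneg _
            have hq : 0 ≤ q := norm_nonneg _
            calc 3 * p * (‖A z x‖ + q) ^ 2 ≤ 3 * p * (p + 2 * q) ^ 2 := by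
                  have : ‖A z x‖ + q ≤ p + 2 * q := by linarith
                  gcongr
              _ ≤ 3 * p * (2 * p ^ 2 + 8 * q ^ 2) := by
                  gcongr; nlinarith [sq_nonneg (p - 2 * q)]
              _ = _ := by ring
        _ ≤ _ := by
            have m1 : AEMeasurable (fun x => ‖A z x - A z₀ x‖ₑ) μ := hD.1.enorm
            rw [lintegral_const_mul' _ _ ENNReal.ofReal_ne_top,
              lintegral_add_left' ((m1.pow_const 3).const_mul 6),
              lintegral_const_mul' _ _ (by norm_num), lintegral_const_mul' _ _ (by norm_num),
              lintegral_enorm_pow_three]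
            gcongr
            exact lintegral_enorm_mul_sq_le hD.1 (hA z₀).1
    refine tendsto_of_tendsto_of_tendsto_of_le_of_le tendsto_const_nhds ?_ (fun z => zero_le)
      hle
    have t1 : Tendsto (fun z : E d => ENNReal.ofReal (‖z‖ ^ (2 * kindPow k + 1))) (𝓝 z₀)
        (𝓝 (ENNReal.ofReal (‖z₀‖ ^ (2 * kindPow k + 1)))) :=
      (ENNReal.continuous_ofReal.comp (by fun_prop)).tendsto z₀
    have t2 : Tendsto (fun z => 6 * eLpNorm (fun x => A z x - A z₀ x) 3 μ ^ 3
        + 24 * (eLpNorm (fun x => A z x - A z₀ x) 3 μ * eLpNorm (A z₀) 3 μ ^ 2)) (𝓝 z₀)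
        (𝓝 (6 * 0 ^ 3 + 24 * (0 * eLpNorm (A z₀) 3 μ ^ 2))) :=
      (ENNReal.Tendsto.const_mul (ENNReal.Tendsto.pow hlim) (Or.inr (by norm_num))).add
        (ENNReal.Tendsto.const_mul (ENNReal.Tendsto.mul_const hlim
          (Or.inr (ENNReal.pow_ne_top (hA z₀).2.ne))) (Or.inr (by norm_num)))
    have := ENNReal.Tendsto.mul t1 (Or.inr (by simp)) t2 (Or.inr ENNReal.ofReal_ne_top)
    simpa using this
  simpa using h2.add h1

end Continuity

/-! ### The slab up to time `t` -/

/-- Lebesgue measure on `(0,t] × 𝕋^d`. -/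
def slab (d : ℕ) (t : ℝ) : Measure (ℝ × Torus d) := (volume.restrict (Ioc 0 t)).prod volume

lemma slab_le {t : ℝ} (ht : t ≤ 1) : slab d t ≤ spaceTime d :=
  Measure.prod_mono (Measure.restrict_mono
    (Ioc_subset_Icc_self.trans (Icc_subset_Icc_right ht)) le_rfl) le_rfl

instance isFiniteMeasure_slab (t : ℝ) : IsFiniteMeasure (slab d t) := by
  unfold slab; infer_instance

/-- The flux of a cubic form of the increments through separation `z`, up to time `t`. -/
def cubicFlux (k : Kind) (u : ℝ → Torus d → E d) (t : ℝ) (z : E d) : ℝ :=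
  ∫ q : ℝ × Torus d, cubicForm k z (incr z (u q.1) q.2) ∂(slab d t)

lemma memLp_incr_slab {p : ℝ≥0∞} {u : ℝ → Torus d → E d}
    (hu : MemLp (fun z : ℝ × Torus d => u z.1 z.2) p (spaceTime d)) {t : ℝ} (ht : t ≤ 1) (z : E d) :
    MemLp (fun q : ℝ × Torus d => incr z (u q.1) q.2) p (slab d t) :=
  ((hu.comp_measurePreserving (measurePreserving_spaceTime_translate (toTorus z))).sub
    hu).mono_measure (slab_le ht)

lemma continuous_cubicFlux (k : Kind) {u : ℝ → Torus d → E d}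
    (hu : MemLp (fun z : ℝ × Torus d => u z.1 z.2) 3 (spaceTime d)) {t : ℝ} (ht : t ≤ 1) :
    Continuous (cubicFlux k u t) := by
  rw [continuous_iff_continuousAt]
  intro z₀
  refine tendsto_integral_cubicForm k (A := fun z (q : ℝ × Torus d) => incr z (u q.1) q.2)
    (fun z => memLp_incr_slab hu ht z) ?_
  have h := tendsto_eLpNorm_spaceTime_translate (by norm_num) (by norm_num) hu z₀
  refine tendsto_of_tendsto_of_tendsto_of_le_of_le tendsto_const_nhds h (fun z => zero_le)
    fun z => ?_
  refine le_trans (le_of_eq ?_) (eLpNorm_mono_measure _ (slab_le ht))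
  refine congrArg (fun F => eLpNorm F 3 (slab d t)) (funext fun q => ?_)
  simp [incr]

section Fubini

variable {Z : Type*} [MeasurableSpace Z] {ν : Measure Z} [SFinite ν] {t : ℝ}
  {F : (ℝ × Torus d) × Z → ℝ}

lemma intervalIntegral_integral_swap (ht : 0 ≤ t) (hF : Integrable F ((slab d t).prod ν)) :
    ∫ r in (0 : ℝ)..t, (∫ x, (∫ z, F ((r, x), z) ∂ν)) = ∫ z, (∫ q, F (q, z) ∂(slab d t)) ∂ν := by
  rw [← integral_prod_symm F hF, integral_prod F hF, intervalIntegral.integral_of_le ht]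
  exact (integral_prod (fun q : ℝ × Torus d => ∫ z, F (q, z) ∂ν) hF.integral_prod_left).symm

lemma intervalIntegral_integral_swap' (ht : 0 ≤ t) (hF : Integrable F ((slab d t).prod ν)) :
    ∫ r in (0 : ℝ)..t, (∫ z, (∫ x, F ((r, x), z)) ∂ν) = ∫ z, (∫ q, F (q, z) ∂(slab d t)) ∂ν := by
  rw [← intervalIntegral_integral_swap ht hF, intervalIntegral.integral_of_le ht,
    intervalIntegral.integral_of_le ht]
  have h : Integrable (fun p : ℝ × Torus d × Z => F ((p.1, p.2.1), p.2.2))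
      ((volume.restrict (Ioc 0 t)).prod ((volume : Measure (Torus d)).prod ν)) :=
    (measurePreserving_prodAssoc (volume.restrict (Ioc 0 t)) (volume : Measure (Torus d))
      ν).symm.integrable_comp_of_integrable hF
  refine integral_congr_ae ?_
  filter_upwards [h.prod_right_ae] with r hr
  exact (integral_integral_swap hr).symm

end Fubini

/-- The flux term of the balance law, as a radial average of the cubic flux. -/
lemma integral_kernelForm_eq_cubicFlux {k : Kind} {b : ℝ} (hb : b ≤ 1 / 16) {g : ℝ → ℝ}
    (hg : IsProfile b g)
    {K : E d → E d →L[ℝ] E d} (hK : IsLawKernel k b g K) {u : ℝ → Torus d → E d}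
    (hu : MemLp (fun z : ℝ × Torus d => u z.1 z.2) 3 (spaceTime d)) {t : ℝ}
    (ht : t ∈ Icc (0 : ℝ) 1) :
    ∫ r in (0 : ℝ)..t, (∫ z, (∫ x, kernelForm K z (incr z (u r) x) (incr z (u r) x)
        (incr z (u r) x)) ∂(ballMeasure d))
      = -2 * ∫ z : E d, g (‖z‖ ^ 2) * cubicFlux k u t z := by
  have hm := (memLp_incr_spaceTime hu).mono_measure (Measure.prod_mono (slab_le ht.2) le_rfl)
  have hF : Integrable (fun q : (ℝ × Torus d) × E d => kernelForm K q.2 (incr q.2 (u q.1.1) q.1.2)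
      (incr q.2 (u q.1.1) q.1.2) (incr q.2 (u q.1.1) q.1.2)) ((slab d t).prod (ballMeasure d)) :=
    integrable_kernelForm hK.toIsSmoothKernel measurable_snd hm hm hm
  rw [intervalIntegral_integral_swap' ht.1 hF, ← integral_const_mul, ← integral_ballMeasure]
  · refine integral_congr_ae (Eventually.of_forall fun z => ?_)
    beta_reduce
    simp_rw [hK.form]
    rw [integral_const_mul, cubicFlux]
    ring
  · intro z hz
    rw [radial_eq_zero hb hg.zero_right hz]
    ring

/-! ### The structure functions as spherical averages of the cubic flux -/

lemma increment3_eq_cubicForm {k : Kind} (hk : k ≠ Kind.T) (v : Torus d → E d) (ℓ : ℝ) (x : Torus d)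
    {y : E d} (hy : ‖y‖ = 1) : increment3 k v ℓ x y = cubicForm k y (incr (ℓ • y) v x) := by
  cases k
  · simp only [increment3, tensor, cubicForm, incr, real_inner_comm y]
  · simp only [increment3, tensor, cubicForm, incr, hy, norm_smul, one_pow, div_one, mul_one,
      Real.norm_eq_abs, sq_abs, real_inner_comm y]
    ring
  · exact absurd rfl hk

/-- Pythagoras: `|T_T(y) w|² = |w|² - |T_L(y) w|²`. -/
lemma increment3_transversal (v : Torus d → E d) (ℓ : ℝ) (x : Torus d) {y : E d} (hy : ‖y‖ = 1) :
    increment3 Kind.T v ℓ x y = increment3 Kind.I v ℓ x y - increment3 Kind.L v ℓ x y := by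
  simp only [increment3, tensor]
  set w := v (x + toTorus (ℓ • y)) - v x
  rw [norm_sub_sq_real, real_inner_smul_right, norm_smul, hy, real_inner_comm y w]
  simp only [one_pow, div_one, mul_one, Real.norm_eq_abs, sq_abs]
  ring

lemma integrable_increment3_of_ne (k : Kind) (hk : k ≠ Kind.T) {u : ℝ → Torus d → E d}
    (hu : MemLp (fun z : ℝ × Torus d => u z.1 z.2) 3 (spaceTime d)) (ℓ : ℝ) :
    Integrable (fun q : (ℝ × Torus d) × Metric.sphere (0 : E d) 1 =>
      increment3 k (u q.1.1) ℓ q.1.2 q.2) ((spaceTime d).prod (sphereMeasure d)) := by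
  have hθ : Measurable fun y : Metric.sphere (0 : E d) 1 => toTorus (ℓ • (y : E d)) :=
    measurable_toTorus.comp (measurable_subtype_coe.const_smul ℓ)
  have hm : MemLp (fun q : (ℝ × Torus d) × Metric.sphere (0 : E d) 1 =>
      incr (ℓ • (q.2 : E d)) (u q.1.1) q.1.2) 3 ((spaceTime d).prod (sphereMeasure d)) :=
    (memLp_shift (measurable_spaceTimeShift hθ)
      (fun y => measurePreserving_spaceTime_translate (toTorus (ℓ • (y : E d)))) hu).sub
      (hu.comp_fst _)
  have h := integrable_cubicForm k (ζ := fun q : (ℝ × Torus d) × Metric.sphere (0 : E d) 1 =>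
    (q.2 : E d)) (measurable_subtype_coe.comp measurable_snd).aestronglyMeasurable (C := 1)
    (fun q => (norm_eq_of_mem_sphere q.2).le) hm
  refine h.congr (Eventually.of_forall fun q => ?_)
  exact (increment3_eq_cubicForm hk _ _ _ (norm_eq_of_mem_sphere q.2)).symm

lemma integrable_increment3 (k : Kind) {u : ℝ → Torus d → E d}
    (hu : MemLp (fun z : ℝ × Torus d => u z.1 z.2) 3 (spaceTime d)) (ℓ : ℝ) :
    Integrable (fun q : (ℝ × Torus d) × Metric.sphere (0 : E d) 1 =>
      increment3 k (u q.1.1) ℓ q.1.2 q.2) ((spaceTime d).prod (sphereMeasure d)) := by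
  by_cases hk : k = Kind.T
  · subst hk
    refine ((integrable_increment3_of_ne Kind.I (by simp) hu ℓ).sub'
      (integrable_increment3_of_ne Kind.L (by simp) hu ℓ)).congr (Eventually.of_forall fun q => ?_)
    exact (increment3_transversal _ _ _ (norm_eq_of_mem_sphere q.2)).symm
  · exact integrable_increment3_of_ne k hk hu ℓ

lemma coeff_pos (hd : 2 ≤ d) (k : Kind) : 0 < coeff d k := by
  have h2 : (2 : ℝ) ≤ d := by exact_mod_cast hd
  cases k <;> simp only [coeff]
  · positivity
  · positivity
  · have : 0 < (d : ℝ) - 1 := by linarith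
    positivity

/-- The time-integrated third-order structure function, before normalization. -/
def sphereFlux (k : Kind) (u : ℝ → Torus d → E d) (ℓ t : ℝ) : ℝ :=
  ∫ y : Metric.sphere (0 : E d) 1, (∫ q : ℝ × Torus d, increment3 k (u q.1) ℓ q.2 y ∂(slab d t))
    ∂(sphereMeasure d)

lemma lawDefect_eq (k : Kind) {u₀ : Torus d → E d} {f u : ℝ → Torus d → E d}
    (hu : MemLp (fun z : ℝ × Torus d => u z.1 z.2) 3 (spaceTime d)) (ℓ : ℝ) {t : ℝ}
    (ht : t ∈ Icc (0 : ℝ) 1) :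
    lawDefect k u₀ f u ℓ t = coeff d k / ((sphereMeasure d).real univ * ℓ) * sphereFlux k u ℓ t
      + dissipation u₀ f u t := by
  have hF := (integrable_increment3 k hu ℓ).mono_measure
    (Measure.prod_mono (slab_le ht.2) (le_refl (sphereMeasure d)))
  unfold lawDefect sphereFlux
  rw [← intervalIntegral_integral_swap ht.1 hF, ← intervalIntegral.integral_const_mul]
  congr 1
  refine intervalIntegral.integral_congr fun r _ => ?_
  beta_reduce
  simp only [structureFn, average_eq, smul_eq_mul]
  rw [integral_const_mul]
  field_simp

/-- The transversal law is a linear combination of the other two, with coefficients of sum one. -/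
lemma lawDefect_transversal (hd : 2 ≤ d) {u₀ : Torus d → E d} {f u : ℝ → Torus d → E d}
    (hu : MemLp (fun z : ℝ × Torus d => u z.1 z.2) 3 (spaceTime d)) (ℓ : ℝ) {t : ℝ}
    (ht : t ∈ Icc (0 : ℝ) 1) :
    lawDefect Kind.T u₀ f u ℓ t = ((d : ℝ) + 2) / (d - 1) * lawDefect Kind.I u₀ f u ℓ t
      - 3 / ((d : ℝ) - 1) * lawDefect Kind.L u₀ f u ℓ t := by
  have hI := (integrable_increment3 Kind.I hu ℓ).mono_measure
    (Measure.prod_mono (slab_le ht.2) (le_refl (sphereMeasure d)))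
  have hL := (integrable_increment3 Kind.L hu ℓ).mono_measure
    (Measure.prod_mono (slab_le ht.2) (le_refl (sphereMeasure d)))
  have hT : sphereFlux Kind.T u ℓ t = sphereFlux Kind.I u ℓ t - sphereFlux Kind.L u ℓ t := by
    have hT := (integrable_increment3 Kind.T hu ℓ).mono_measure
      (Measure.prod_mono (slab_le ht.2) (le_refl (sphereMeasure d)))
    unfold sphereFlux
    rw [← integral_prod_symm _ hT, ← integral_prod_symm _ hI, ← integral_prod_symm _ hL,
      ← integral_sub hI hL]
    refine integral_congr_ae (Eventually.of_forall fun q => ?_)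
    exact increment3_transversal _ _ _ (norm_eq_of_mem_sphere q.2)
  rw [lawDefect_eq _ hu ℓ ht, lawDefect_eq _ hu ℓ ht, lawDefect_eq _ hu ℓ ht, hT]
  have h2 : (2 : ℝ) ≤ d := by exact_mod_cast hd
  have h1 : (d : ℝ) - 1 ≠ 0 := by linarith
  generalize sphereFlux Kind.I u ℓ t = a
  generalize sphereFlux Kind.L u ℓ t = b
  generalize dissipation u₀ f u t = e
  have e1 : coeff d Kind.T = ((d : ℝ) + 2) / (d - 1) * coeff d Kind.I := by
    simp only [coeff]; field_simp
  have e2 : coeff d Kind.T = 3 / ((d : ℝ) - 1) * coeff d Kind.L := by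
    simp only [coeff]; field_simp; norm_num
  have e3 : ((d : ℝ) + 2) / (d - 1) - 3 / (d - 1) = 1 := by field_simp; ring
  have e4 : coeff d Kind.T / ((sphereMeasure d).real univ * ℓ) * (a - b) + e
      = (coeff d Kind.T) / ((sphereMeasure d).real univ * ℓ) * a
        - (coeff d Kind.T) / ((sphereMeasure d).real univ * ℓ) * b + 1 * e := by ring
  rw [e4]
  nth_rewrite 1 [e1]
  rw [e2]
  linear_combination (-e) * e3

/-! ### The defect at a fixed scale -/

/-- Radial averages of the balance law converge to a multiple of the defect of the law. -/
lemma tendsto_smoothed_defect (hd : 2 ≤ d) {k : Kind} (hk : k ≠ Kind.T) {u₀ : Torus d → E d}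
    {f u : ℝ → Torus d → E d} (hu : MemLp (fun z : ℝ × Torus d => u z.1 z.2) 3 (spaceTime d))
    {ℓ : ℝ} (hℓ : 0 < ℓ) {t : ℝ} (ht : t ∈ Icc (0 : ℝ) 1) {b : ℝ} {g : ℕ → ℝ → ℝ}
    (hg : ∀ n, IsProfile b (g n)) (hc : Concentrates ℓ g) :
    Tendsto (fun n => (1 / (2 * coeff d k) * ∫ z : E d, g n (‖z‖ ^ 2) * ‖z‖ ^ (2 * kindPow k + 2))
        * dissipation u₀ f u t + 1 / 2 * ∫ z : E d, g n (‖z‖ ^ 2) * cubicFlux k u t z) atTop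
      (𝓝 ((sphereMeasure d).real univ / (4 * coeff d k) * ℓ ^ (d + 2 * kindPow k)
        * lawDefect k u₀ f u ℓ t)) := by
  have h1 := tendsto_integral_radial_mul hd hℓ hg hc
    (h := fun z : E d => ‖z‖ ^ (2 * kindPow k + 2)) (by fun_prop)
  have h2 := tendsto_integral_radial_mul hd hℓ hg hc (continuous_cubicFlux k hu ht.2)
  have h3 := ((h1.const_mul (1 / (2 * coeff d k))).mul_const (dissipation u₀ f u t)).add
    (h2.const_mul (1 / 2))
  refine h3.congr' (Eventually.of_forall fun n => rfl) |>.trans (le_of_eq ?_)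
  congr 1
  have e1 : ∀ y : Metric.sphere (0 : E d) 1, ‖ℓ • (y : E d)‖ ^ (2 * kindPow k + 2)
      = ℓ ^ (2 * kindPow k + 2) := fun y => by
    rw [norm_smul, norm_eq_of_mem_sphere, mul_one, Real.norm_of_nonneg hℓ.le]
  have e2 : ∀ y : Metric.sphere (0 : E d) 1, cubicFlux k u t (ℓ • (y : E d))
      = ℓ ^ (2 * kindPow k + 1)
        * ∫ q : ℝ × Torus d, increment3 k (u q.1) ℓ q.2 y ∂(slab d t) := fun y => by
    unfold cubicFlux
    simp_rw [increment3_eq_cubicForm hk _ _ _ (norm_eq_of_mem_sphere y), cubicForm_smul]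
    rw [integral_const_mul]
  simp_rw [e1, e2]
  rw [integral_const, integral_const_mul, smul_eq_mul, ← sphereFlux, lawDefect_eq k hu ℓ ht]
  have hS := sphereMeasure_real_univ_pos (d := d) (by omega)
  have hcf := coeff_pos hd k
  obtain ⟨m, rfl⟩ : ∃ m, d = m + 2 := ⟨d - 2, by omega⟩
  rw [show m + 2 - 2 = m by omega]
  field_simp
  ring

lemma lintegral_closedBall_le {ρ : ℝ} (hρ : 0 ≤ ρ) {Φ : E d → ℝ≥0∞} {M : ℝ≥0∞}
    (h : ∀ z, ‖z‖ ≤ ρ → Φ z ≤ M) :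
    ∫⁻ z in Metric.closedBall (0 : E d) ρ, Φ z
      ≤ ENNReal.ofReal (ρ ^ d * volume.real (Metric.ball (0 : E d) 1)) * M := by
  calc _ ≤ ∫⁻ _ in Metric.closedBall (0 : E d) ρ, M :=
        setLIntegral_mono' measurableSet_closedBall fun z hz => h z (by simpa using hz)
    _ = M * volume (Metric.closedBall (0 : E d) ρ) := by rw [setLIntegral_const]
    _ = _ := by
        rw [Measure.addHaar_closedBall _ _ hρ, ENNReal.ofReal_mul (by positivity),
          Measure.real, ENNReal.ofReal_toReal (measure_ball_lt_top).ne, mul_comm]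
        simp

lemma lintegral_mul_ballMeasure_le {ℓ : ℝ} {Ψ Φ : E d → ℝ≥0∞} (hℓ : 0 ≤ ℓ)
    (hΨ : ∀ z, 4 * ℓ ^ 2 < ‖z‖ ^ 2 → Ψ z = 0) :
    ∫⁻ z, Ψ z * Φ z ∂(ballMeasure d) ≤ ∫⁻ z in Metric.closedBall (0 : E d) (2 * ℓ), Ψ z * Φ z := by
  refine (lintegral_mono' (Measure.restrict_le_self) le_rfl).trans ?_
  rw [← lintegral_indicator measurableSet_closedBall]
  refine lintegral_mono fun z => ?_
  by_cases hz : z ∈ Metric.closedBall (0 : E d) (2 * ℓ)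
  · rw [indicator_of_mem hz]
  · rw [indicator_of_notMem hz, hΨ z, zero_mul]
    have : 2 * ℓ < ‖z‖ := by simpa using hz
    nlinarith

lemma IsProfile.lintegral_radial_le (hd : 2 ≤ d) {ℓ : ℝ} (hℓ : 0 < ℓ) {g : ℝ → ℝ}
    (hg : IsProfile (4 * ℓ ^ 2) g) :
    ∫⁻ z : E d, ENNReal.ofReal (g (‖z‖ ^ 2))
      ≤ ENNReal.ofReal (1 / 2 * (2 * ℓ) ^ (d - 2) * (sphereMeasure d).real univ) := by
  have hgc := hg.smooth.continuous
  have hi : Integrable fun z : E d => g (‖z‖ ^ 2) := by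
    refine Continuous.integrable_of_hasCompactSupport (by fun_prop)
      (HasCompactSupport.intro (isCompact_closedBall (0 : E d) (2 * ℓ)) fun z hz => ?_)
    have : 2 * ℓ < ‖z‖ := by simpa using hz
    exact hg.zero_right _ (by nlinarith)
  rw [← ofReal_integral_eq_lintegral_ofReal hi (Eventually.of_forall fun z => hg.nonneg _)]
  refine ENNReal.ofReal_le_ofReal ?_
  have h := hg.integral_radial_mul hd (h := fun _ : E d => (1 : ℝ)) continuous_const
  simp only [mul_one, integral_const, smul_eq_mul] at h
  rw [h]
  calc _ ≤ ∫ r in Ioi (0 : ℝ), 2 * r * g (r ^ 2) *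
        (1 / 2 * (2 * ℓ) ^ (d - 2) * (sphereMeasure d).real univ) := by
        refine setIntegral_mono_on (hg.integrable_weight_mul (by fun_prop))
          (hg.integrable_weight_mul continuous_const) measurableSet_Ioi fun r hr => ?_
        have hr0 : 0 < r := hr
        have hg0 := hg.nonneg (r ^ 2)
        by_cases hrl : r ≤ 2 * ℓ
        · gcongr
        · rw [hg.zero_right (r ^ 2) (by nlinarith)]
          simp
    _ = _ := by rw [integral_mul_const, hg.integral_radius, one_mul]

/-! ### A bound for the defect by second-order increments -/

lemma incr_congr_ae {v w : Torus d → E d} (h : v =ᵐ[volume] w) (z : E d) :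
    incr z v =ᵐ[volume] incr z w :=
  ((measurePreserving_translate (toTorus z)).quasiMeasurePreserving.ae_eq_comp h).sub h

namespace IsLerayHopfWith

variable {ν : ℝ} {u₀ : Torus d → E d} {f u : ℝ → Torus d → E d} {G : ℝ → Torus d → Fin d → E d}
  (h : IsLerayHopfWith ν u₀ f u G)
include h

/-- The remainder of the balance law averaged with a kernel supported at scale `ℓ`. -/
lemma enorm_smoothed_defect_le (hd : 2 ≤ d) {k : Kind} (hk : k ≠ Kind.T)
    (h3 : MemLp (fun z : ℝ × Torus d => u z.1 z.2) 3 (spaceTime d)) {ℓ : ℝ} (hℓ : 0 < ℓ)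
    (hℓ' : ℓ ≤ 1 / 8) {t : ℝ} (ht : t ∈ Icc (0 : ℝ) 1) {E0 EF EG : ℝ≥0∞}
    (hE0 : ∀ z : E d, ‖z‖ ≤ 2 * ℓ → eLpNorm (incr z u₀) 2 volume ^ 2 ≤ E0)
    (hEF : ∀ z : E d, ‖z‖ ≤ 2 * ℓ →
      ∫⁻ r, eLpNorm (f r) 2 volume * eLpNorm (incr z (u r)) 2 volume ∂timeMeasure ≤ EF)
    (hEG : ∀ z : E d, ‖z‖ ≤ 2 * ℓ → ∀ j, ∫⁻ r, eLpNorm (fun x => G r x j) 2 volume *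
      eLpNorm (incr z (u r)) 2 volume ∂timeMeasure ≤ EG)
    {g : ℝ → ℝ} (hg : IsProfile (4 * ℓ ^ 2) g) :
    ‖(1 / (2 * coeff d k) * ∫ z : E d, g (‖z‖ ^ 2) * ‖z‖ ^ (2 * kindPow k + 2))
        * dissipation u₀ f u t + 1 / 2 * ∫ z : E d, g (‖z‖ ^ 2) * cubicFlux k u t z‖ₑ
      ≤ ENNReal.ofReal (2 * (4 * ℓ ^ 2) ^ kindPow k)
          * (∫⁻ z in Metric.closedBall (0 : E d) (2 * ℓ), eLpNorm (incr z (u t)) 2 volume ^ 2)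
        + ENNReal.ofReal (2 * (4 * ℓ ^ 2) ^ kindPow k
            * ((2 * ℓ) ^ d * volume.real (Metric.ball (0 : E d) 1))) * (E0 + EF)
        + ‖ν‖ₑ * (d * (ENNReal.ofReal (4 * kindPow k * (2 * ℓ)
            * ((2 * ℓ) ^ d * volume.real (Metric.ball (0 : E d) 1))
            + 2 * (2 * ℓ) ^ (2 * kindPow k + 1)
              * (1 / 2 * (2 * ℓ) ^ (d - 2) * (sphereMeasure d).real univ)) * EG)) := by
  have hb : 4 * ℓ ^ 2 ≤ 1 / 16 := by nlinarith
  obtain ⟨K, hK⟩ := hg.exists_isLawKernel (d := d) (by omega) (by positivity) hb hk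
  have hm := h.enorm_dissipation_sub_le hK.toIsSolenoidalKernel hK.mean h3 ht
  rw [integral_kernelForm_eq_cubicFlux hb hg hK h3 ht] at hm
  have e : ∀ c D J : ℝ, c * D - 1 / 4 * (-2 * J) = c * D + 1 / 2 * J := fun c D J => by ring
  rw [e] at hm
  refine hm.trans ?_
  have hKz : ∀ z, 4 * ℓ ^ 2 < ‖z‖ ^ 2 → ‖K z‖ₑ = 0 := fun z hz => by
    rw [← ofReal_norm, hK.supp_ball z hz, norm_zero, ENNReal.ofReal_zero]
  have hKle : ∀ z, ‖K z‖ₑ ≤ ENNReal.ofReal (2 * (4 * ℓ ^ 2) ^ kindPow k) := fun z => by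
    rw [← ofReal_norm]; exact ENNReal.ofReal_le_ofReal (hK.norm_le z)
  have hker : ∀ Φ : E d → ℝ≥0∞, ∫⁻ z, ‖K z‖ₑ * Φ z ∂(ballMeasure d)
      ≤ ENNReal.ofReal (2 * (4 * ℓ ^ 2) ^ kindPow k)
        * ∫⁻ z in Metric.closedBall (0 : E d) (2 * ℓ), Φ z := fun Φ => by
    refine (lintegral_mul_ballMeasure_le hℓ.le hKz).trans ?_
    rw [← lintegral_const_mul' _ _ ENNReal.ofReal_ne_top]
    gcongr
    exact hKle _
  have hker' : ∀ (Φ : E d → ℝ≥0∞) (M : ℝ≥0∞), (∀ z, ‖z‖ ≤ 2 * ℓ → Φ z ≤ M) →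
      ∫⁻ z, ‖K z‖ₑ * Φ z ∂(ballMeasure d)
      ≤ ENNReal.ofReal (2 * (4 * ℓ ^ 2) ^ kindPow k
            * ((2 * ℓ) ^ d * volume.real (Metric.ball (0 : E d) 1))) * M := fun Φ M hΦ => by
    refine (hker Φ).trans ?_
    rw [ENNReal.ofReal_mul (p := 2 * (4 * ℓ ^ 2) ^ kindPow k) (by positivity), mul_assoc]
    gcongr
    exact lintegral_closedBall_le (by positivity) hΦ
  have t0 := hker' (fun z => eLpNorm (incr z (u 0)) 2 volume ^ 2) E0 fun z hz => by
    rw [eLpNorm_congr_ae (incr_congr_ae h.initial z)]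
    exact hE0 z hz
  have tF := hker' _ EF hEF
  have hg0 := hg.nonneg
  have tG : ∀ j, ∫⁻ z, ‖fderiv ℝ K z (EuclideanSpace.single j 1)‖ₑ *
      ∫⁻ r, eLpNorm (fun x => G r x j) 2 volume * eLpNorm (incr z (u r)) 2 volume ∂timeMeasure
        ∂(ballMeasure d) ≤ ENNReal.ofReal (4 * kindPow k * (2 * ℓ)
            * ((2 * ℓ) ^ d * volume.real (Metric.ball (0 : E d) 1))
            + 2 * (2 * ℓ) ^ (2 * kindPow k + 1)
              * (1 / 2 * (2 * ℓ) ^ (d - 2) * (sphereMeasure d).real univ)) * EG := by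
    intro j
    refine (lintegral_mul_ballMeasure_le hℓ.le fun z hz => by
      rw [← ofReal_norm, hK.supp_fderiv z hz, norm_zero, ENNReal.ofReal_zero]).trans ?_
    have hpt : ∀ z ∈ Metric.closedBall (0 : E d) (2 * ℓ),
        ‖fderiv ℝ K z (EuclideanSpace.single j 1)‖ₑ *
          (∫⁻ r, eLpNorm (fun x => G r x j) 2 volume * eLpNorm (incr z (u r)) 2 volume ∂timeMeasure)
        ≤ (ENNReal.ofReal (4 * kindPow k * (2 * ℓ)) + ENNReal.ofReal (2 * (2 * ℓ) ^ (2 * kindPow k + 1))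
          * ENNReal.ofReal (g (‖z‖ ^ 2))) * EG := by
      intro z hz
      have hz' : ‖z‖ ≤ 2 * ℓ := by simpa using hz
      gcongr ?_ * ?_
      · rw [← ENNReal.ofReal_mul (by positivity), ← ENNReal.ofReal_add (by positivity)
          (mul_nonneg (by positivity) (hg0 _)), ← ofReal_norm]
        refine ENNReal.ofReal_le_ofReal ((hK.norm_fderiv_le z _).trans ?_)
        have hg1 := hg0 (‖z‖ ^ 2)
        rw [PiLp.norm_single, norm_one, mul_one]
        calc _ ≤ 4 * kindPow k * (2 * ℓ) + 2 * (g (‖z‖ ^ 2) * (2 * ℓ) ^ (2 * kindPow k + 1)) := by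
              gcongr
          _ = _ := by ring
      · exact hEG z hz' j
    refine (setLIntegral_mono' measurableSet_closedBall hpt).trans ?_
    have hgm : Measurable fun z : E d => ENNReal.ofReal (g (‖z‖ ^ 2)) := by
      have := hg.smooth.continuous
      exact (by fun_prop : Continuous fun z : E d => g (‖z‖ ^ 2)).measurable.ennreal_ofReal
    rw [lintegral_mul_const _ (by fun_prop)]
    gcongr
    rw [lintegral_add_left measurable_const, lintegral_const_mul _ hgm,
      ENNReal.ofReal_add (by positivity) (by positivity)]
    gcongr
    · rw [mul_comm (4 * (kindPow k : ℝ) * (2 * ℓ)) ((2 * ℓ) ^ d * _),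
        ENNReal.ofReal_mul (p := (2 * ℓ) ^ d * _) (by positivity)]
      exact lintegral_closedBall_le (by positivity) fun _ _ => le_rfl
    · rw [ENNReal.ofReal_mul (p := 2 * (2 * ℓ) ^ (2 * kindPow k + 1)) (by positivity)]
      gcongr
      exact (setLIntegral_le_lintegral _ _).trans (hg.lintegral_radial_le hd hℓ)
  calc _ ≤ ENNReal.ofReal (2 * (4 * ℓ ^ 2) ^ kindPow k)
          * (∫⁻ z in Metric.closedBall (0 : E d) (2 * ℓ), eLpNorm (incr z (u t)) 2 volume ^ 2)
        + ENNReal.ofReal (2 * (4 * ℓ ^ 2) ^ kindPow k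
            * ((2 * ℓ) ^ d * volume.real (Metric.ball (0 : E d) 1))) * E0
        + ENNReal.ofReal (2 * (4 * ℓ ^ 2) ^ kindPow k
            * ((2 * ℓ) ^ d * volume.real (Metric.ball (0 : E d) 1))) * EF
        + ‖ν‖ₑ * ∑ _j : Fin d, (ENNReal.ofReal (4 * kindPow k * (2 * ℓ)
            * ((2 * ℓ) ^ d * volume.real (Metric.ball (0 : E d) 1))
            + 2 * (2 * ℓ) ^ (2 * kindPow k + 1)
              * (1 / 2 * (2 * ℓ) ^ (d - 2) * (sphereMeasure d).real univ)) * EG) :=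
        add_le_add (add_le_add (add_le_add (hker _) t0) tF)
          (mul_le_mul_right (Finset.sum_le_sum fun j _ => tG j) _)
    _ = _ := by
        rw [Finset.sum_const, Finset.card_univ, Fintype.card_fin, nsmul_eq_mul]
        ring

end IsLerayHopfWith

/-- The quantity controlling the defect of the laws at scale `ℓ` and time `t`, for errors `E0`
from the initial datum, `EF` from the force and `EG` from the viscosity. -/
def defectBound (u : ℝ → Torus d → E d) (ν ℓ t : ℝ) (E0 EF EG : ℝ≥0∞) : ℝ≥0∞ :=
  ENNReal.ofReal (ℓ ^ d)⁻¹
      * (∫⁻ z in Metric.closedBall (0 : E d) (2 * ℓ), eLpNorm (incr z (u t)) 2 volume ^ 2)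
    + E0 + EF + ‖ν‖ₑ * (ENNReal.ofReal ℓ⁻¹ * EG)

/-- The remainder bound for the smoothed balance passes to the limit of concentrating profiles. -/
lemma exists_defect_const_of_ne (hd : 2 ≤ d) (k : Kind) (hk : k ≠ Kind.T) :
    ∃ C : ℝ≥0, ∀ {ν : ℝ} {u₀ : Torus d → E d} {f u : ℝ → Torus d → E d}
      {G : ℝ → Torus d → Fin d → E d}, IsLerayHopfWith ν u₀ f u G →
      MemLp (fun z : ℝ × Torus d => u z.1 z.2) 3 (spaceTime d) →
      ∀ {ℓ : ℝ}, 0 < ℓ → ℓ ≤ 1 / 8 → ∀ {t : ℝ}, t ∈ Icc (0 : ℝ) 1 → ∀ {E0 EF EG : ℝ≥0∞},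
      (∀ z : E d, ‖z‖ ≤ 2 * ℓ → eLpNorm (incr z u₀) 2 volume ^ 2 ≤ E0) →
      (∀ z : E d, ‖z‖ ≤ 2 * ℓ →
        ∫⁻ r, eLpNorm (f r) 2 volume * eLpNorm (incr z (u r)) 2 volume ∂timeMeasure ≤ EF) →
      (∀ z : E d, ‖z‖ ≤ 2 * ℓ → ∀ j, ∫⁻ r, eLpNorm (fun x => G r x j) 2 volume *
        eLpNorm (incr z (u r)) 2 volume ∂timeMeasure ≤ EG) →
      ENNReal.ofReal |lawDefect k u₀ f u ℓ t| ≤ C * defectBound u ν ℓ t E0 EF EG := by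
  have hS := sphereMeasure_real_univ_pos (d := d) (by omega)
  have hc := coeff_pos hd k
  set S := (sphereMeasure d).real univ with hSdef
  set c := coeff d k with hcdef
  set V := volume.real (Metric.ball (0 : E d) 1) with hVdef
  have hV : 0 ≤ V := measureReal_nonneg
  set C1 : ℝ := 8 * c * 4 ^ kindPow k / S with hC1
  set C2 : ℝ := C1 * 2 ^ d * V with hC2
  set C3 : ℝ := 4 * c / S * (8 * kindPow k * (2 ^ d * V) + 2 ^ (2 * kindPow k + 1) * 2 ^ (d - 2) * S)
    with hC3
  have p1 : 0 ≤ C1 := by positivity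
  have p2 : 0 ≤ C2 := by positivity
  have p3 : 0 ≤ C3 := by positivity
  refine ⟨(C1 + C2 + d * C3).toNNReal, ?_⟩
  intro ν u₀ f u G h h3 ℓ hℓ hℓ' t ht E0 EF EG hE0 hEF hEG
  obtain ⟨g, hg, hcon⟩ := exists_concentrating_profiles hℓ
  have hlim := (tendsto_smoothed_defect hd hk (u₀ := u₀) (f := f) h3 hℓ ht hg hcon).enorm
  have hle := le_of_tendsto hlim (Eventually.of_forall fun n =>
    h.enorm_smoothed_defect_le hd hk h3 hℓ hℓ' ht hE0 hEF hEG (hg n))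
  rw [← hSdef, ← hcdef, ← hVdef] at hle
  -- the factor in front of the defect in the limit; the bound is divided by it
  set κ : ℝ := S / (4 * c) * ℓ ^ (d + 2 * kindPow k) with hκ
  have hκ0 : 0 < κ := by positivity
  have a1 : 2 * (4 * ℓ ^ 2) ^ kindPow k = κ * (C1 * (ℓ ^ d)⁻¹) := by
    rw [hκ, hC1, mul_pow, ← pow_mul, pow_add]; field_simp; norm_num
  have a2 : 2 * (4 * ℓ ^ 2) ^ kindPow k * ((2 * ℓ) ^ d * V) = κ * C2 := by
    rw [a1, hC2, mul_pow]; field_simp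
  have a3 : 4 * kindPow k * (2 * ℓ) * ((2 * ℓ) ^ d * V)
      + 2 * (2 * ℓ) ^ (2 * kindPow k + 1) * (1 / 2 * (2 * ℓ) ^ (d - 2) * S) = κ * (C3 * ℓ⁻¹) := by
    rw [hκ, hC3]
    obtain ⟨m, rfl⟩ : ∃ m, d = m + 2 := ⟨d - 2, by omega⟩
    rw [show m + 2 - 2 = m by omega]
    have hm : kindPow k = 0 ∨ kindPow k = 1 := by cases k <;> simp [kindPow]
    rcases hm with hm | hm <;> rw [hm] <;> push_cast <;> field_simp <;> ring
  rw [a2, a1, a3, ENNReal.ofReal_mul hκ0.le, ENNReal.ofReal_mul hκ0.le, ENNReal.ofReal_mul hκ0.le,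
    ENNReal.ofReal_mul p1, ENNReal.ofReal_mul p3, enorm_mul, ← ofReal_norm κ,
    Real.norm_of_nonneg hκ0.le, ← ofReal_norm (lawDefect k u₀ f u ℓ t), Real.norm_eq_abs] at hle
  set X := ENNReal.ofReal |lawDefect k u₀ f u ℓ t|
  set T := ∫⁻ z in Metric.closedBall (0 : E d) (2 * ℓ), eLpNorm (incr z (u t)) 2 volume ^ 2 with hT
  have hle2 : ENNReal.ofReal κ * X ≤ ENNReal.ofReal κ * (ENNReal.ofReal C1 *
      (ENNReal.ofReal (ℓ ^ d)⁻¹ * T) + ENNReal.ofReal C2 * (E0 + EF)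
      + d * ENNReal.ofReal C3 * (‖ν‖ₑ * (ENNReal.ofReal ℓ⁻¹ * EG))) :=
    hle.trans (le_of_eq (by ring))
  rw [ENNReal.mul_le_mul_iff_right (by simpa using hκ0) ENNReal.ofReal_ne_top] at hle2
  refine hle2.trans ?_
  have hC : ((C1 + C2 + d * C3).toNNReal : ℝ≥0∞)
      = ENNReal.ofReal C1 + ENNReal.ofReal C2 + d * ENNReal.ofReal C3 := by
    change ENNReal.ofReal _ = _
    rw [ENNReal.ofReal_add (by positivity) (by positivity), ENNReal.ofReal_add p1 p2,
      ENNReal.ofReal_mul (p := (d : ℝ)) (by positivity), ENNReal.ofReal_natCast]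
  rw [hC, defectBound, ← hT]
  generalize ENNReal.ofReal C1 = x
  generalize ENNReal.ofReal C2 = y
  generalize d * ENNReal.ofReal C3 = w
  generalize ENNReal.ofReal (ℓ ^ d)⁻¹ * T = p
  generalize ‖ν‖ₑ * (ENNReal.ofReal ℓ⁻¹ * EG) = q
  calc x * p + y * (E0 + EF) + w * q
      ≤ (x + y + w) * p + (x + y + w) * (E0 + EF) + (x + y + w) * q := by
        gcongr
        · exact le_add_right le_self_add
        · exact le_add_right le_add_self
        · exact le_add_self
    _ = _ := by ring

/-- The defect of the laws at a fixed scale and time, for a constant that depends only on `d`. -/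
theorem exists_defect_const (hd : 2 ≤ d) (k : Kind) :
    ∃ C : ℝ≥0, ∀ {ν : ℝ} {u₀ : Torus d → E d} {f u : ℝ → Torus d → E d}
      {G : ℝ → Torus d → Fin d → E d}, IsLerayHopfWith ν u₀ f u G →
      MemLp (fun z : ℝ × Torus d => u z.1 z.2) 3 (spaceTime d) →
      ∀ {ℓ : ℝ}, 0 < ℓ → ℓ ≤ 1 / 8 → ∀ {t : ℝ}, t ∈ Icc (0 : ℝ) 1 → ∀ {E0 EF EG : ℝ≥0∞},
      (∀ z : E d, ‖z‖ ≤ 2 * ℓ → eLpNorm (incr z u₀) 2 volume ^ 2 ≤ E0) →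
      (∀ z : E d, ‖z‖ ≤ 2 * ℓ →
        ∫⁻ r, eLpNorm (f r) 2 volume * eLpNorm (incr z (u r)) 2 volume ∂timeMeasure ≤ EF) →
      (∀ z : E d, ‖z‖ ≤ 2 * ℓ → ∀ j, ∫⁻ r, eLpNorm (fun x => G r x j) 2 volume *
        eLpNorm (incr z (u r)) 2 volume ∂timeMeasure ≤ EG) →
      ENNReal.ofReal |lawDefect k u₀ f u ℓ t| ≤ C * defectBound u ν ℓ t E0 EF EG := by
  by_cases hk : k = Kind.T
  · subst hk
    obtain ⟨CI, hI⟩ := exists_defect_const_of_ne hd Kind.I (by simp)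
    obtain ⟨CL, hL⟩ := exists_defect_const_of_ne hd Kind.L (by simp)
    have h2 : (2 : ℝ) ≤ d := by exact_mod_cast hd
    have h1 : 0 < (d : ℝ) - 1 := by linarith
    have pI : 0 ≤ ((d : ℝ) + 2) / (d - 1) := by positivity
    have pL : 0 ≤ 3 / ((d : ℝ) - 1) := by positivity
    refine ⟨(((d : ℝ) + 2) / (d - 1)).toNNReal * CI + (3 / ((d : ℝ) - 1)).toNNReal * CL, ?_⟩
    intro ν u₀ f u G h h3 ℓ hℓ hℓ' t ht E0 EF EG hE0 hEF hEG
    have bI := hI h h3 hℓ hℓ' ht hE0 hEF hEG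
    have bL := hL h h3 hℓ hℓ' ht hE0 hEF hEG
    rw [lawDefect_transversal hd h3 ℓ ht]
    refine (ENNReal.ofReal_le_ofReal (abs_sub _ _)).trans ?_
    rw [abs_mul, abs_mul, abs_of_nonneg pI, abs_of_nonneg pL,
      ENNReal.ofReal_add (by positivity) (by positivity), ENNReal.ofReal_mul pI,
      ENNReal.ofReal_mul pL, ENNReal.coe_add, ENNReal.coe_mul, ENNReal.coe_mul, add_mul, mul_assoc,
      mul_assoc]
    exact add_le_add (mul_le_mul_right bI _) (mul_le_mul_right bL _)
  · exact exists_defect_const_of_ne hd k hk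

/-! ### Consequences of the energy inequality -/

lemma lintegral_enorm_sq {X F' : Type*} [MeasurableSpace X] {μ : Measure X} [NormedAddCommGroup F']
    (v : X → F') : ∫⁻ x, ‖v x‖ₑ ^ 2 ∂μ = eLpNorm v 2 μ ^ 2 := by
  have h := eLpNorm_nnreal_pow_eq_lintegral (f := v) (μ := μ) (p := 2) (by norm_num)
  simp only [NNReal.coe_ofNat, ENNReal.coe_ofNat] at h
  norm_cast at h
  exact h.symm

lemma ofReal_integral_norm_sq {X F' : Type*} [MeasurableSpace X] {μ : Measure X}
    [NormedAddCommGroup F'] {v : X → F'} (hv : MemLp v 2 μ) :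
    ENNReal.ofReal (∫ x, ‖v x‖ ^ 2 ∂μ) = eLpNorm v 2 μ ^ 2 := by
  rw [ofReal_integral_eq_lintegral_ofReal (hv.integrable_norm_pow (by norm_num))
    (Eventually.of_forall fun x => by positivity), ← lintegral_enorm_sq]
  refine lintegral_congr fun x => ?_
  rw [ENNReal.ofReal_pow (norm_nonneg _), ofReal_norm]

lemma integral_norm_sq {X F' : Type*} [MeasurableSpace X] {μ : Measure X}
    [NormedAddCommGroup F'] {v : X → F'} (hv : MemLp v 2 μ) :
    ∫ x, ‖v x‖ ^ 2 ∂μ = (eLpNorm v 2 μ).toReal ^ 2 := by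
  rw [← ENNReal.toReal_pow, ← ofReal_integral_norm_sq hv,
    ENNReal.toReal_ofReal (integral_nonneg fun x => by positivity)]

instance isProbabilityMeasure_timeMeasure : IsProbabilityMeasure timeMeasure :=
  ⟨by simp [timeMeasure]⟩

namespace IsLerayHopfWith

variable {ν : ℝ} {u₀ : Torus d → E d} {f u : ℝ → Torus d → E d} {G : ℝ → Torus d → Fin d → E d}
  (h : IsLerayHopfWith ν u₀ f u G)
include h

lemma aemeasurable_eLpNorm_force : AEMeasurable (fun t => eLpNorm (f t) 2 volume) timeMeasure :=
  aemeasurable_eLpNorm_two_slice (μ := timeMeasure) (ν := (volume : Measure (Torus d)))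
    (g := fun q : ℝ × Torus d => f q.1 q.2) h.force_meas

lemma memLp_initial : MemLp u₀ 2 volume :=
  (memLp_congr_ae h.initial).1 (h.memLp 0 (by simp))

lemma enorm_work_le {A S : ℝ≥0∞} (hA : normLqL2 1 f ≤ A)
    (hS : ∀ t ∈ Icc (0 : ℝ) 1, eLpNorm (u t) 2 volume ≤ S) {t : ℝ} (ht : t ∈ Icc (0 : ℝ) 1) :
    ‖∫ s in (0 : ℝ)..t, ∫ x, inner ℝ (f s x) (u s x)‖ₑ ≤ A * S := by
  refine (enorm_intervalIntegral_le _ ht).trans ?_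
  rw [normLqL2, eLpNorm_one_eq_lintegral_enorm] at hA
  simp only [enorm_eq_self] at hA
  calc _ ≤ ∫⁻ s, eLpNorm (f s) 2 volume * S ∂timeMeasure := by
        refine lintegral_mono_ae ?_
        filter_upwards [h.force_meas.prodMk_left, ae_mem_Icc_timeMeasure] with r hr hr1
        calc _ ≤ ∫⁻ x, ‖(inner ℝ (f r x) (u r x) : ℝ)‖ₑ := enorm_integral_le_lintegral_enorm _
          _ ≤ ∫⁻ x, ‖f r x‖ₑ * ‖u r x‖ₑ := lintegral_mono fun x => enorm_inner_le_enorm _ _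
          _ ≤ eLpNorm (f r) 2 volume * eLpNorm (u r) 2 volume :=
              lintegral_enorm_mul_le_eLpNorm_two hr (h.memLp r hr1).1
          _ ≤ _ := by gcongr; exact hS r hr1
    _ = (∫⁻ s, eLpNorm (f s) 2 volume ∂timeMeasure) * S :=
        lintegral_mul_const'' _ h.aemeasurable_eLpNorm_force
    _ ≤ _ := by gcongr

/-- The energy inequality bounds the kinetic energy by the data. -/
lemma eLpNorm_le_of_force (hν : 0 ≤ ν) {A : ℝ≥0} (hA : normLqL2 1 f ≤ A) :
    ∀ t ∈ Icc (0 : ℝ) 1, eLpNorm (u t) 2 volume ≤ eLpNorm u₀ 2 volume + 2 * A := by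
  obtain ⟨M, hM⟩ := h.bounded
  have hne : (Icc (0 : ℝ) 1).Nonempty := ⟨0, by simp⟩
  -- the least bound for the kinetic energy
  set S := sSup ((fun t => (eLpNorm (u t) 2 volume).toReal) '' Icc 0 1) with hSdef
  have hbdd : BddAbove ((fun t => (eLpNorm (u t) 2 volume).toReal) '' Icc 0 1) := by
    refine ⟨M, ?_⟩
    rintro _ ⟨t, ht, rfl⟩
    exact ENNReal.toReal_mono ENNReal.coe_ne_top (hM t ht)
  have hle : ∀ t ∈ Icc (0 : ℝ) 1, (eLpNorm (u t) 2 volume).toReal ≤ S := fun t ht =>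
    le_csSup hbdd ⟨t, ht, rfl⟩
  have hS0 : 0 ≤ S := ENNReal.toReal_nonneg.trans (hle 0 (by simp))
  have hle' : ∀ t ∈ Icc (0 : ℝ) 1, eLpNorm (u t) 2 volume ≤ ENNReal.ofReal S := fun t ht => by
    rw [← ENNReal.ofReal_toReal (h.memLp t ht).2.ne]
    exact ENNReal.ofReal_le_ofReal (hle t ht)
  set U := (eLpNorm u₀ 2 volume).toReal with hU
  have hU0 : 0 ≤ U := ENNReal.toReal_nonneg
  have hsq : ∀ t ∈ Icc (0 : ℝ) 1, (eLpNorm (u t) 2 volume).toReal ^ 2 ≤ U ^ 2 + 2 * A * S := by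
    intro t ht
    have he := h.energy t ht
    have hw := h.enorm_work_le hA hle' ht
    rw [← ofReal_norm, ← ENNReal.ofReal_coe_nnreal, ← ENNReal.ofReal_mul A.coe_nonneg,
      ENNReal.ofReal_le_ofReal_iff (by positivity), Real.norm_eq_abs] at hw
    rw [integral_norm_sq (h.memLp t ht), integral_norm_sq h.memLp_initial] at he
    have hG : 0 ≤ ∫ s in (0 : ℝ)..t, ∫ x, ∑ j, ‖G s x j‖ ^ 2 :=
      intervalIntegral.integral_nonneg ht.1 fun s _ => integral_nonneg fun x => by positivity
    have := mul_nonneg hν hG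
    linarith [le_abs_self (∫ s in (0 : ℝ)..t, ∫ x, inner ℝ (f s x) (u s x))]
  -- from `S² ≤ U² + 2 A S`
  have hS2 : S ≤ U + 2 * A := by
    have hAn : (0 : ℝ) ≤ A := A.coe_nonneg
    have h1 : S ≤ √(U ^ 2 + 2 * A * S) := by
      refine csSup_le (hne.image _) ?_
      rintro _ ⟨t, ht, rfl⟩
      exact Real.le_sqrt_of_sq_le (hsq t ht)
    have h2 : S ^ 2 ≤ U ^ 2 + 2 * A * S := by
      have := Real.sq_sqrt (show 0 ≤ U ^ 2 + 2 * A * S by positivity)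
      nlinarith
    by_contra! hlt
    nlinarith [mul_nonneg hU0 hAn]
  intro t ht
  refine (hle' t ht).trans ?_
  refine (ENNReal.ofReal_le_ofReal hS2).trans (le_of_eq ?_)
  rw [ENNReal.ofReal_add hU0 (by positivity), hU, ENNReal.ofReal_toReal h.memLp_initial.2.ne,
    ENNReal.ofReal_mul (by norm_num)]
  simp

/-- The energy inequality bounds the dissipation by the data. -/
lemma lintegral_gradient_le (hν : 0 ≤ ν) {A : ℝ≥0} (hA : normLqL2 1 f ≤ A) (j : Fin d) :
    ENNReal.ofReal ν * ∫⁻ r, eLpNorm (fun x => G r x j) 2 volume ^ 2 ∂timeMeasure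
      ≤ (eLpNorm u₀ 2 volume + 2 * A) ^ 2 := by
  have hGi : ∀ i, Integrable (fun z : ℝ × Torus d => ‖G z.1 z.2 i‖ ^ 2) (spaceTime d) := fun i =>
    (h.grad_memLp i).integrable_norm_pow (by norm_num)
  have e1 : ∫⁻ r, eLpNorm (fun x => G r x j) 2 volume ^ 2 ∂timeMeasure
      = ENNReal.ofReal (∫ z : ℝ × Torus d, ‖G z.1 z.2 j‖ ^ 2 ∂(spaceTime d)) := by
    rw [ofReal_integral_norm_sq (h.grad_memLp j), ← lintegral_enorm_sq, spaceTime,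
      lintegral_prod _ (((h.grad_memLp j).1.enorm).pow_const 2)]
    simp_rw [lintegral_enorm_sq]
  have e2 : ∫ z : ℝ × Torus d, ‖G z.1 z.2 j‖ ^ 2 ∂(spaceTime d)
      ≤ ∫ s in (0 : ℝ)..1, ∫ x, ∑ j, ‖G s x j‖ ^ 2 := by
    have hs : Integrable (fun z : ℝ × Torus d => ∑ i, ‖G z.1 z.2 i‖ ^ 2) (spaceTime d) :=
      integrable_finsetSum _ fun i _ => hGi i
    calc _ ≤ ∫ z : ℝ × Torus d, ∑ i, ‖G z.1 z.2 i‖ ^ 2 ∂(spaceTime d) :=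
          integral_mono (hGi j) hs fun z =>
            Finset.single_le_sum (f := fun i => ‖G z.1 z.2 i‖ ^ 2) (fun i _ => by positivity)
              (Finset.mem_univ j)
      _ = _ := by
          rw [spaceTime, integral_prod _ hs, intervalIntegral.integral_of_le zero_le_one,
            ← integral_Icc_eq_integral_Ioc]
          rfl
  have hS : ∀ t ∈ Icc (0 : ℝ) 1, eLpNorm (u t) 2 volume
      ≤ ENNReal.ofReal ((eLpNorm u₀ 2 volume).toReal + 2 * A) := fun t ht => by
    refine (h.eLpNorm_le_of_force hν hA t ht).trans (le_of_eq ?_)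
    rw [ENNReal.ofReal_add ENNReal.toReal_nonneg (by positivity),
      ENNReal.ofReal_toReal h.memLp_initial.2.ne, ENNReal.ofReal_mul (by norm_num)]
    simp
  set U := (eLpNorm u₀ 2 volume).toReal with hU
  have hU0 : 0 ≤ U := ENNReal.toReal_nonneg
  have hAn : (0 : ℝ) ≤ A := A.coe_nonneg
  have hw := h.enorm_work_le hA hS (t := 1) (by simp)
  rw [← ofReal_norm, ← ENNReal.ofReal_coe_nnreal, ← ENNReal.ofReal_mul A.coe_nonneg,
    ENNReal.ofReal_le_ofReal_iff (by positivity), Real.norm_eq_abs] at hw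
  have he := h.energy 1 (by simp)
  rw [integral_norm_sq (h.memLp 1 (by simp)), integral_norm_sq h.memLp_initial, ← hU] at he
  have hfin : eLpNorm u₀ 2 volume + 2 * A = ENNReal.ofReal (U + 2 * A) := by
    rw [ENNReal.ofReal_add hU0 (by positivity), hU,
      ENNReal.ofReal_toReal h.memLp_initial.2.ne, ENNReal.ofReal_mul (by norm_num)]
    simp
  rw [e1, hfin, ← ENNReal.ofReal_mul hν, ← ENNReal.ofReal_pow (by positivity)]
  refine ENNReal.ofReal_le_ofReal ?_
  refine (mul_le_mul_of_nonneg_left e2 hν).trans ?_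
  nlinarith [le_abs_self (∫ s in (0 : ℝ)..1, ∫ x, inner ℝ (f s x) (u s x)),
    sq_nonneg (eLpNorm (u 1) 2 volume).toReal, mul_nonneg hU0 hAn]

end IsLerayHopfWith

/-! ### Consequences of the Besov bounds -/

lemma incr_zero (v : Torus d → E d) : incr 0 v = 0 := by
  funext x; simp [incr, toTorus_zero]

lemma eLpNorm_incr_le_besovNorm {α : ℝ} (v : Torus d → E d) (z : E d) :
    eLpNorm (incr z v) 2 volume ≤ ENNReal.ofReal (‖z‖ ^ α) * besovNorm α v := by
  by_cases hz : z = 0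
  · rw [hz, incr_zero, eLpNorm_zero]; exact zero_le
  · have hz' : 0 < ‖z‖ := norm_pos_iff.2 hz
    have h1 : ENNReal.ofReal (‖z‖ ^ (-α)) * eLpNorm (incr z v) 2 volume ≤ besovNorm α v :=
      (le_iSup₂ (f := fun (y : E d) (_ : y ≠ 0) => ENNReal.ofReal (‖y‖ ^ (-α)) *
        eLpNorm (fun x => v (x + toTorus y) - v x) 2 volume) z hz).trans le_add_self
    calc eLpNorm (incr z v) 2 volume
        = ENNReal.ofReal (‖z‖ ^ α) * (ENNReal.ofReal (‖z‖ ^ (-α)) * eLpNorm (incr z v) 2 volume) := by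
          rw [← mul_assoc, ← ENNReal.ofReal_mul (by positivity), ← Real.rpow_add hz']
          simp
      _ ≤ _ := by gcongr

lemma eLpNorm_incr_le_two_mul {v : Torus d → E d} (hv : AEStronglyMeasurable v volume) (z : E d) :
    eLpNorm (incr z v) 2 volume ≤ 2 * eLpNorm v 2 volume := by
  have h := eLpNorm_sub_le (hv.comp_measurePreserving (measurePreserving_translate (toTorus z))) hv
    (p := 2) (by norm_num)
  rw [eLpNorm_comp_measurePreserving hv (measurePreserving_translate (toTorus z)), ← two_mul] at h
  exact h

lemma lintegral_incr_sq_le {α : ℝ} {u : ℝ → Torus d → E d} {M : ℝ≥0}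
    (hM : normLqBesov 2 α u ≤ M) (z : E d) :
    ∫⁻ r, eLpNorm (incr z (u r)) 2 volume ^ 2 ∂timeMeasure
      ≤ (ENNReal.ofReal (‖z‖ ^ α) * M) ^ 2 := by
  calc _ ≤ ∫⁻ r, (ENNReal.ofReal (‖z‖ ^ α)) ^ 2 * ‖besovNorm α (u r)‖ₑ ^ 2 ∂timeMeasure := by
        refine lintegral_mono fun r => ?_
        rw [← mul_pow, enorm_eq_self]
        gcongr
        exact eLpNorm_incr_le_besovNorm _ z
    _ = (ENNReal.ofReal (‖z‖ ^ α)) ^ 2 * normLqBesov 2 α u ^ 2 := by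
        rw [lintegral_const_mul' _ _ (ENNReal.pow_ne_top ENNReal.ofReal_ne_top)]
        congr 1
        have h := eLpNorm_nnreal_pow_eq_lintegral (f := fun r => besovNorm α (u r))
          (μ := timeMeasure) (p := 2) (by norm_num)
        simp only [NNReal.coe_ofNat, ENNReal.coe_ofNat] at h
        norm_cast at h
        exact h.symm
    _ ≤ _ := by rw [mul_pow]; gcongr

/-! ### The error terms of the balance law -/

lemma lintegral_mul_le_of_sq_le {X : Type*} [MeasurableSpace X] {μ : Measure X} {a b : X → ℝ≥0∞}
    (ha : AEMeasurable a μ) (hb : AEMeasurable b μ) {A B : ℝ≥0∞} (hA : ∫⁻ x, a x ^ 2 ∂μ ≤ A ^ 2)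
    (hB : ∫⁻ x, b x ^ 2 ∂μ ≤ B ^ 2) : ∫⁻ x, a x * b x ∂μ ≤ A * B := by
  have h := ENNReal.lintegral_mul_le_Lp_mul_Lq μ Real.HolderConjugate.two_two ha hb
  have e : ∀ {C D : ℝ≥0∞}, C ≤ D ^ 2 → C ^ (1 / 2 : ℝ) ≤ D := fun {C D} hCD => by
    refine (ENNReal.rpow_le_rpow hCD (by norm_num)).trans (le_of_eq ?_)
    rw [← ENNReal.rpow_natCast, ← ENNReal.rpow_mul]; norm_num
  simp only [Pi.mul_apply, ENNReal.rpow_ofNat] at h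
  exact h.trans (mul_le_mul' (e hA) (e hB))

lemma aemeasurable_eLpNorm_incr_time {u : ℝ → Torus d → E d}
    (hu : AEStronglyMeasurable (fun z : ℝ × Torus d => u z.1 z.2) (spaceTime d)) (z : E d) :
    AEMeasurable (fun r => eLpNorm (incr z (u r)) 2 volume) timeMeasure :=
  aemeasurable_eLpNorm_two_slice (μ := timeMeasure) (ν := (volume : Measure (Torus d)))
    (g := fun q : ℝ × Torus d => incr z (u q.1) q.2)
    ((hu.comp_measurePreserving (measurePreserving_spaceTime_translate (toTorus z))).sub hu)

/-- The spatial average of squared increments up to distance `2ℓ`. -/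
def averagedIncr (v : Torus d → E d) (ℓ : ℝ) : ℝ≥0∞ :=
  ENNReal.ofReal (ℓ ^ d)⁻¹
    * ∫⁻ z in Metric.closedBall (0 : E d) (2 * ℓ), eLpNorm (incr z v) 2 volume ^ 2

/-- `2^d` times the volume of the unit ball. -/
def ballConst (d : ℕ) : ℝ≥0 := (2 ^ d * volume.real (Metric.ball (0 : E d) 1)).toNNReal

lemma ofReal_mul_ball {ℓ : ℝ} (hℓ : 0 < ℓ) (B : ℝ≥0∞) :
    ENNReal.ofReal (ℓ ^ d)⁻¹
      * (ENNReal.ofReal ((2 * ℓ) ^ d * volume.real (Metric.ball (0 : E d) 1)) * B)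
      = ballConst d * B := by
  rw [← mul_assoc, ← ENNReal.ofReal_mul (by positivity), ballConst]
  change _ = ENNReal.ofReal _ * B
  congr 2
  rw [mul_pow]
  field_simp

lemma averagedIncr_le {v : Torus d → E d} {ℓ : ℝ} (hℓ : 0 < ℓ) {B : ℝ≥0∞}
    (hB : ∀ z : E d, ‖z‖ ≤ 2 * ℓ → eLpNorm (incr z v) 2 volume ≤ B) :
    averagedIncr v ℓ ≤ ballConst d * B ^ 2 := by
  rw [← ofReal_mul_ball hℓ, averagedIncr]
  gcongr
  exact lintegral_closedBall_le (by positivity) fun z hz => by gcongr; exact hB z hz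

lemma lintegral_averagedIncr_le {u : ℝ → Torus d → E d}
    (hu : AEStronglyMeasurable (fun z : ℝ × Torus d => u z.1 z.2) (spaceTime d)) {ℓ : ℝ}
    (hℓ : 0 < ℓ) (hℓ' : ℓ ≤ 1 / 8) {B : ℝ≥0∞}
    (hB : ∀ z : E d, ‖z‖ ≤ 2 * ℓ → ∫⁻ r, eLpNorm (incr z (u r)) 2 volume ^ 2 ∂timeMeasure ≤ B) :
    ∫⁻ r, averagedIncr (u r) ℓ ∂timeMeasure ≤ ballConst d * B := by
  have hm := (aemeasurable_eLpNorm_incr hu).pow_const 2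
  have hle : volume.restrict (Metric.closedBall (0 : E d) (2 * ℓ)) ≤ ballMeasure d :=
    Measure.restrict_mono (Metric.closedBall_subset_closedBall (by linarith)) le_rfl
  have hm' := hm.mono_measure (Measure.prod_mono (le_refl timeMeasure) hle)
  unfold averagedIncr
  rw [lintegral_const_mul' _ _ ENNReal.ofReal_ne_top, lintegral_lintegral_swap hm',
    ← ofReal_mul_ball hℓ]
  gcongr
  exact lintegral_closedBall_le (by positivity) hB

/-- Interpolation of a force in `L^{1+σ}` between `L^∞` and `L¹`, at the height `1/ρ`. -/
lemma mul_le_truncation {ρ σ : ℝ} (hρ : 0 < ρ) (hσ : 0 < σ) {a Y B : ℝ≥0∞} (hY : Y ≤ B) :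
    a * Y ≤ ENNReal.ofReal ρ⁻¹ * Y + B * (ENNReal.ofReal (ρ ^ σ) * a ^ (1 + σ)) := by
  rcases le_total a (ENNReal.ofReal ρ⁻¹) with h | h
  · exact (mul_le_mul_left h Y).trans le_self_add
  · refine le_trans ?_ le_add_self
    rw [mul_comm a]
    refine mul_le_mul' hY ?_
    have h1 : ENNReal.ofReal (ρ ^ σ) * ENNReal.ofReal ρ⁻¹ ^ σ = 1 := by
      rw [ENNReal.ofReal_rpow_of_pos (by positivity), ← ENNReal.ofReal_mul (by positivity),
        Real.inv_rpow hρ.le, mul_inv_cancel₀ (by positivity), ENNReal.ofReal_one]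
    calc a = ENNReal.ofReal (ρ ^ σ) * (a * ENNReal.ofReal ρ⁻¹ ^ σ) := by
          rw [mul_left_comm, h1, mul_one]
      _ ≤ ENNReal.ofReal (ρ ^ σ) * (a * a ^ σ) := by gcongr
      _ = _ := by
          rw [ENNReal.rpow_add_of_nonneg _ _ zero_le_one hσ.le, ENNReal.rpow_one]

lemma normLqL2_one_le {f : ℝ → Torus d → E d}
    (hf : AEStronglyMeasurable (fun z : ℝ × Torus d => f z.1 z.2) (spaceTime d)) {q : ℝ≥0∞}
    (hq : 1 ≤ q) : normLqL2 1 f ≤ normLqL2 q f :=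
  eLpNorm_le_eLpNorm_of_exponent_le hq
    (aemeasurable_eLpNorm_two_slice (μ := timeMeasure) (ν := (volume : Measure (Torus d)))
      (g := fun q : ℝ × Torus d => f q.1 q.2) hf).aestronglyMeasurable

lemma lintegral_force_rpow_le {f : ℝ → Torus d → E d} {σ : ℝ} (hσ : 0 < σ) {A : ℝ≥0}
    (hA : normLqL2 (ENNReal.ofReal (1 + σ)) f ≤ A) :
    ∫⁻ r, eLpNorm (f r) 2 volume ^ (1 + σ) ∂timeMeasure ≤ (A : ℝ≥0∞) ^ (1 + σ) := by
  have hpos : 0 < 1 + σ := by linarith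
  rw [normLqL2, eLpNorm_eq_lintegral_rpow_enorm_toReal (by simpa using hpos) ENNReal.ofReal_ne_top,
    ENNReal.toReal_ofReal hpos.le] at hA
  have h := ENNReal.rpow_le_rpow hA hpos.le
  rw [← ENNReal.rpow_mul, one_div, inv_mul_cancel₀ hpos.ne', ENNReal.rpow_one] at h
  simpa only [enorm_eq_self] using h

/-- The modulus of continuity of translations of `v` in `L²`, squared. -/
def translationModulus (v : Torus d → E d) (ℓ : ℝ) : ℝ≥0∞ :=
  ⨆ z : E d, ⨆ _ : ‖z‖ ≤ 2 * ℓ, eLpNorm (incr z v) 2 volume ^ 2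

lemma tendsto_translationModulus {v : Torus d → E d} (hv : MemLp v 2 volume) :
    Tendsto (translationModulus v) (𝓝[>] 0) (𝓝 0) := by
  have h := tendsto_eLpNorm_translate (by norm_num) (by norm_num) hv (0 : E d)
  have h2 : Tendsto (fun z : E d => eLpNorm (incr z v) 2 volume ^ 2) (𝓝 0) (𝓝 0) := by
    have h1 := ENNReal.Tendsto.pow (n := 2) h
    simp only [toTorus_zero, add_zero, ne_eq, OfNat.ofNat_ne_zero, not_false_eq_true,
      zero_pow] at h1
    exact h1
  rw [ENNReal.tendsto_nhds_zero] at h2 ⊢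
  intro ε hε
  obtain ⟨δ, hδ, hball⟩ := Metric.eventually_nhds_iff.1 (h2 ε hε)
  filter_upwards [Ioo_mem_nhdsGT (show (0 : ℝ) < δ / 2 by positivity)] with ℓ hℓ
  refine iSup₂_le fun z hz => hball ?_
  rw [dist_zero_right]
  linarith [hℓ.2]

lemma tendsto_ofReal_two_mul_rpow {a : ℝ} (ha : 0 < a) :
    Tendsto (fun ℓ : ℝ => ENNReal.ofReal ((2 * ℓ) ^ a)) (𝓝[>] 0) (𝓝 0) := by
  have h : Continuous fun ℓ : ℝ => (2 * ℓ) ^ a :=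
    (by fun_prop : Continuous fun ℓ : ℝ => 2 * ℓ).rpow_const fun _ => Or.inr ha.le
  have h2 := ((ENNReal.continuous_ofReal.comp h).tendsto 0).mono_left
    (nhdsWithin_le_nhds (s := Ioi (0 : ℝ)))
  simpa [Function.comp_def, Real.zero_rpow ha.ne'] using h2

/-- The viscous error at scales above `ν^L` is a power of the viscosity. -/
lemma viscous_scale_le {ν L α ℓ : ℝ} (hν : ν ∈ Ioo (0 : ℝ) 1) (hα : α ∈ Ioo (0 : ℝ) 1)
    (hℓ : ν ^ L ≤ ℓ) :
    ν * (ℓ⁻¹ * (ν ^ (-(1 / 2) : ℝ) * (2 * ℓ) ^ α)) ≤ 2 * ν ^ (1 / 2 - L * (1 - α)) := by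
  have hν0 := hν.1
  have hℓ0 : 0 < ℓ := (Real.rpow_pos_of_pos hν0 L).trans_le hℓ
  have e1 : ν * ν ^ (-(1 / 2) : ℝ) = ν ^ (1 / 2 : ℝ) := by
    nth_rewrite 1 [← Real.rpow_one ν]
    rw [← Real.rpow_add hν0]; norm_num
  have e2 : ℓ⁻¹ * (2 * ℓ) ^ α = 2 ^ α * ℓ ^ (α - 1) := by
    rw [Real.mul_rpow (by norm_num) hℓ0.le, Real.rpow_sub_one hℓ0.ne']; field_simp
  have e3 : ℓ ^ (α - 1) ≤ ν ^ (-(L * (1 - α))) := by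
    have := Real.rpow_le_rpow_of_nonpos (Real.rpow_pos_of_pos hν0 L) hℓ
      (by linarith [hα.2] : α - 1 ≤ 0)
    rw [← Real.rpow_mul hν0.le] at this
    refine this.trans (le_of_eq ?_)
    congr 1; ring
  have e4 : (2 : ℝ) ^ α ≤ 2 := by
    calc (2 : ℝ) ^ α ≤ 2 ^ (1 : ℝ) := Real.rpow_le_rpow_of_exponent_le (by norm_num) hα.2.le
      _ = 2 := Real.rpow_one 2
  calc ν * (ℓ⁻¹ * (ν ^ (-(1 / 2) : ℝ) * (2 * ℓ) ^ α))
      = (ν * ν ^ (-(1 / 2) : ℝ)) * (ℓ⁻¹ * (2 * ℓ) ^ α) := by ring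
    _ = ν ^ (1 / 2 : ℝ) * (2 ^ α * ℓ ^ (α - 1)) := by rw [e1, e2]
    _ ≤ ν ^ (1 / 2 : ℝ) * (2 * ν ^ (-(L * (1 - α)))) := by
        have : 0 ≤ ℓ ^ (α - 1) := by positivity
        gcongr
    _ = 2 * ν ^ (1 / 2 - L * (1 - α)) := by
        rw [show 1 / 2 - L * (1 - α) = 1 / 2 + -(L * (1 - α)) by ring, Real.rpow_add hν0]; ring

/-- The viscous part of the defect bound. -/
lemma viscous_error_le {u₀ : Torus d → E d} {A M : ℝ≥0} {ν L α ℓ : ℝ} (hν : ν ∈ Ioo (0 : ℝ) 1) (hα : α ∈ Ioo (0 : ℝ) 1)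
    (hℓ : ν ^ L ≤ ℓ) :
    ‖ν‖ₑ * (ENNReal.ofReal ℓ⁻¹ * (ENNReal.ofReal (ν ^ (-(1 / 2) : ℝ)) * (eLpNorm u₀ 2 volume + 2 * A)
        * (ENNReal.ofReal ((2 * ℓ) ^ α) * M)))
      ≤ 2 * (eLpNorm u₀ 2 volume + 2 * A) * M
        * ENNReal.ofReal (ν ^ (1 / 2 - L * (1 - α))) := by
  have hν0 := hν.1
  have hℓ0 : 0 < ℓ := (Real.rpow_pos_of_pos hν0 L).trans_le hℓ
  rw [← ofReal_norm, Real.norm_of_nonneg hν.1.le]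
  calc _ = ENNReal.ofReal (ν * (ℓ⁻¹ * (ν ^ (-(1 / 2) : ℝ) * (2 * ℓ) ^ α)))
        * ((eLpNorm u₀ 2 volume + 2 * A) * M) := by
        rw [ENNReal.ofReal_mul hν0.le, ENNReal.ofReal_mul (by positivity),
          ENNReal.ofReal_mul (by positivity)]
        ring
    _ ≤ ENNReal.ofReal (2 * ν ^ (1 / 2 - L * (1 - α))) * ((eLpNorm u₀ 2 volume + 2 * A) * M) := by
        exact mul_le_mul_left (ENNReal.ofReal_le_ofReal (viscous_scale_le hν hα hℓ)) _
    _ = _ := by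
        rw [ENNReal.ofReal_mul (by norm_num), ENNReal.ofReal_ofNat]
        ring

lemma integrable_inner_of_memLp {v w : Torus d → E d} (hv : MemLp v 2 volume)
    (hw : MemLp w 2 volume) : Integrable fun x => (inner ℝ (v x) (w x) : ℝ) :=
  integrable_of_bilinear_bound (C := 1) hv hw (hv.1.inner hw.1) fun x => by
    simpa using abs_real_inner_le_norm (v x) (w x)

/-! ### The defect in terms of uniform bounds -/

namespace IsLerayHopfWith

variable {ν : ℝ} {u₀ : Torus d → E d} {f u : ℝ → Torus d → E d} {G : ℝ → Torus d → Fin d → E d}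
  (h : IsLerayHopfWith ν u₀ f u G)
include h

lemma lintegral_gradient_mul_incr_le (hν : 0 < ν) {A M : ℝ≥0} (hA : normLqL2 1 f ≤ A) {α : ℝ}
    (hα : 0 ≤ α) (hM : normLqBesov 2 α u ≤ M) {ℓ : ℝ} {z : E d} (hz : ‖z‖ ≤ 2 * ℓ) (j : Fin d) :
    ∫⁻ r, eLpNorm (fun x => G r x j) 2 volume * eLpNorm (incr z (u r)) 2 volume ∂timeMeasure
      ≤ ENNReal.ofReal (ν ^ (-(1 / 2) : ℝ)) * (eLpNorm u₀ 2 volume + 2 * A)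
        * (ENNReal.ofReal ((2 * ℓ) ^ α) * M) := by
  refine lintegral_mul_le_of_sq_le ?_ (aemeasurable_eLpNorm_incr_time h.meas z) ?_ ?_
  · exact aemeasurable_eLpNorm_two_slice (μ := timeMeasure) (ν := (volume : Measure (Torus d)))
      (g := fun q : ℝ × Torus d => G q.1 q.2 j) (h.grad_memLp j).1
  · have h1 := h.lintegral_gradient_le hν.le hA j
    have e : (ENNReal.ofReal (ν ^ (-(1 / 2) : ℝ))) ^ 2 * ENNReal.ofReal ν = 1 := by
      rw [← ENNReal.ofReal_pow (by positivity), ← Real.rpow_natCast, ← Real.rpow_mul hν.le,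
        ← ENNReal.ofReal_mul (by positivity)]
      nth_rewrite 2 [← Real.rpow_one ν]
      rw [← Real.rpow_add hν]
      norm_num
    calc _ = (ENNReal.ofReal (ν ^ (-(1 / 2) : ℝ))) ^ 2 * (ENNReal.ofReal ν *
          ∫⁻ r, eLpNorm (fun x => G r x j) 2 volume ^ 2 ∂timeMeasure) := by
          rw [← mul_assoc, e, one_mul]
      _ ≤ _ := by rw [mul_pow]; gcongr
  · refine (lintegral_incr_sq_le hM z).trans ?_
    gcongr

/-- The pairing of an `L^{1+σ}` force with increments is a power of the scale. -/
lemma lintegral_force_mul_incr_le {σ : ℝ} (hσ : 0 < σ) {A M : ℝ≥0}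
    (hA : normLqL2 (ENNReal.ofReal (1 + σ)) f ≤ A) {α : ℝ} (hα : 0 < α)
    (hM : normLqBesov 2 α u ≤ M) {B : ℝ≥0∞}
    (hB : ∀ t ∈ Icc (0 : ℝ) 1, eLpNorm (u t) 2 volume ≤ B) {ℓ : ℝ} (hℓ : 0 < ℓ) {z : E d}
    (hz : ‖z‖ ≤ 2 * ℓ) :
    ∫⁻ r, eLpNorm (f r) 2 volume * eLpNorm (incr z (u r)) 2 volume ∂timeMeasure
      ≤ ENNReal.ofReal ((2 * ℓ) ^ (α / 2)) * M
        + 2 * B * (ENNReal.ofReal ((2 * ℓ) ^ (α / 2 * σ)) * (A : ℝ≥0∞) ^ (1 + σ)) := by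
  -- this truncation height makes both contributions a positive power of `ℓ`
  set ρ : ℝ := (2 * ℓ) ^ (α / 2) with hρ
  have hρ0 : 0 < ρ := by positivity
  have hρσ : ρ ^ σ = (2 * ℓ) ^ (α / 2 * σ) := by rw [hρ, ← Real.rpow_mul (by positivity)]
  have hYm := aemeasurable_eLpNorm_incr_time h.meas z
  have hY : ∫⁻ r, eLpNorm (incr z (u r)) 2 volume ∂timeMeasure
      ≤ ENNReal.ofReal ((2 * ℓ) ^ α) * M := by
    have h1 := lintegral_mul_le_of_sq_le hYm (b := fun _ => 1) aemeasurable_const (B := 1)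
      (A := ENNReal.ofReal ((2 * ℓ) ^ α) * M) ((lintegral_incr_sq_le hM z).trans (by gcongr)) (by simp)
    simpa using h1
  calc _ ≤ ∫⁻ r, (ENNReal.ofReal ρ⁻¹ * eLpNorm (incr z (u r)) 2 volume
        + 2 * B * (ENNReal.ofReal (ρ ^ σ) * eLpNorm (f r) 2 volume ^ (1 + σ))) ∂timeMeasure := by
        refine lintegral_mono_ae ?_
        filter_upwards [ae_mem_Icc_timeMeasure] with r hr
        refine mul_le_truncation hρ0 hσ ?_
        refine (eLpNorm_incr_le_two_mul (h.memLp r hr).1 z).trans ?_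
        gcongr
        exact hB r hr
    _ = ENNReal.ofReal ρ⁻¹ * (∫⁻ r, eLpNorm (incr z (u r)) 2 volume ∂timeMeasure)
        + 2 * B * (ENNReal.ofReal (ρ ^ σ)
          * ∫⁻ r, eLpNorm (f r) 2 volume ^ (1 + σ) ∂timeMeasure) := by
        have hfm := h.aemeasurable_eLpNorm_force.pow_const (1 + σ)
        rw [lintegral_add_left' (hYm.const_mul _), lintegral_const_mul'' _ hYm,
          lintegral_const_mul'' _ (hfm.const_mul _), lintegral_const_mul'' _ hfm]
    _ ≤ ENNReal.ofReal ρ⁻¹ * (ENNReal.ofReal ((2 * ℓ) ^ α) * M)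
        + 2 * B * (ENNReal.ofReal (ρ ^ σ) * (A : ℝ≥0∞) ^ (1 + σ)) := by
        gcongr
        exact lintegral_force_rpow_le hσ hA
    _ = _ := by
        rw [hρσ, ← mul_assoc (ENNReal.ofReal ρ⁻¹), ← ENNReal.ofReal_mul (by positivity)]
        congr 3
        have : (2 * ℓ) ^ α = ρ * ρ := by
          rw [hρ, ← Real.rpow_add (by positivity)]; norm_num
        rw [this]
        field_simp

lemma lintegral_force_mul_le {A : ℝ≥0} (hA : normLqL2 1 f ≤ A) {z : E d} {B : ℝ≥0∞}
    (hB : ∀ t ∈ Icc (0 : ℝ) 1, eLpNorm (incr z (u t)) 2 volume ≤ B) :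
    ∫⁻ r, eLpNorm (f r) 2 volume * eLpNorm (incr z (u r)) 2 volume ∂timeMeasure ≤ A * B := by
  rw [normLqL2, eLpNorm_one_eq_lintegral_enorm] at hA
  simp only [enorm_eq_self] at hA
  calc _ ≤ ∫⁻ r, eLpNorm (f r) 2 volume * B ∂timeMeasure := by
        refine lintegral_mono_ae ?_
        filter_upwards [ae_mem_Icc_timeMeasure] with r hr
        gcongr
        exact hB r hr
    _ = (∫⁻ r, eLpNorm (f r) 2 volume ∂timeMeasure) * B :=
        lintegral_mul_const'' _ h.aemeasurable_eLpNorm_force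
    _ ≤ _ := by gcongr

/-- A Besov bound for almost every time holds at every time, by weak continuity. -/
lemma eLpNorm_incr_le_of_normLqBesov_top {α : ℝ} {M : ℝ≥0} (hM : normLqBesov ⊤ α u ≤ M) {t₀ : ℝ}
    (ht₀ : t₀ ∈ Icc (0 : ℝ) 1) (z : E d) :
    eLpNorm (incr z (u t₀)) 2 volume ≤ ENNReal.ofReal (‖z‖ ^ α) * M := by
  set v := incr z (u t₀) with hv
  have hvL : MemLp v 2 volume := memLp_incr (h.memLp t₀ ht₀) z
  set B : ℝ≥0∞ := ENNReal.ofReal (‖z‖ ^ α) * M with hB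
  have hBtop : B ≠ ⊤ := ENNReal.mul_ne_top ENNReal.ofReal_ne_top ENNReal.coe_ne_top
  have hae : ∀ᵐ t ∂timeMeasure, eLpNorm (incr z (u t)) 2 volume ≤ B := by
    have h1 : ∀ᵐ t ∂timeMeasure, ‖besovNorm α (u t)‖ₑ ≤ normLqBesov ⊤ α u := by
      rw [normLqBesov, eLpNorm_exponent_top]
      exact enorm_ae_le_eLpNormEssSup _ _
    filter_upwards [h1] with t ht
    refine (eLpNorm_incr_le_besovNorm (α := α) (u t) z).trans ?_
    rw [hB]
    gcongr
    exact ht.trans hM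
  -- `φ` is continuous because the increment can be moved onto the fixed field `v`, and
  -- `φ t₀ = ‖v‖²`
  let φ : ℝ → ℝ := fun t => ∫ x, inner ℝ (incr z (u t) x) (v x)
  have hφc : ContinuousOn φ (Icc 0 1) := by
    have hw : MemLp (incr (-z) v) 2 volume := memLp_incr hvL (-z)
    refine (h.weak_cont _ hw).congr fun t ht => ?_
    have i1 : Integrable fun x => (inner ℝ (u t (x + toTorus z)) (v x) : ℝ) :=
      integrable_inner_of_memLp (memLp_translate (h.memLp t ht) _) hvL
    have i2 : Integrable fun x => (inner ℝ (u t x) (v x) : ℝ) :=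
      integrable_inner_of_memLp (h.memLp t ht) hvL
    have i3 : Integrable fun x => (inner ℝ (u t x) (v (x + toTorus (-z))) : ℝ) :=
      integrable_inner_of_memLp (h.memLp t ht) (memLp_translate hvL _)
    simp only [φ, incr, inner_sub_left, inner_sub_right]
    rw [integral_sub i1 i2, integral_sub i3 i2]
    congr 1
    rw [← integral_add_right_eq_self (fun x => (inner ℝ (u t x) (v (x + toTorus (-z))) : ℝ))
      (toTorus z)]
    refine integral_congr_ae (Eventually.of_forall fun x => ?_)
    simp [toTorus_neg]
  set N := (eLpNorm v 2 volume).toReal with hN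
  have hN0 : 0 ≤ N := ENNReal.toReal_nonneg
  have hφle : ∀ᵐ t ∂timeMeasure, φ t ≤ B.toReal * N := by
    filter_upwards [hae, ae_mem_Icc_timeMeasure] with t ht ht1
    have h1 : ‖φ t‖ₑ ≤ B * eLpNorm v 2 volume := by
      refine (enorm_integral_le_lintegral_enorm _).trans ?_
      refine (lintegral_mono fun x => enorm_inner_le_enorm _ _).trans ?_
      refine (lintegral_enorm_mul_le_eLpNorm_two (memLp_incr (h.memLp t ht1) z).1 hvL.1).trans ?_
      gcongr
    have h2 := ENNReal.toReal_mono (ENNReal.mul_ne_top hBtop hvL.2.ne) h1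
    rw [toReal_enorm, ENNReal.toReal_mul] at h2
    exact (le_abs_self _).trans h2
  have hall : EqOn (fun t => max (φ t) (B.toReal * N)) (fun _ => B.toReal * N) (Icc 0 1) := by
    refine Measure.eqOn_Icc_of_ae_eq volume zero_ne_one ?_ (ContinuousOn.sup' hφc continuousOn_const)
      continuousOn_const
    filter_upwards [hφle] with t ht
    exact max_eq_right ht
  have hφ0 : φ t₀ ≤ B.toReal * N := max_eq_right_iff.1 (hall ht₀)
  have hφN : φ t₀ = N ^ 2 := by
    rw [hN, ← integral_norm_sq hvL]
    refine integral_congr_ae (Eventually.of_forall fun x => ?_)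
    exact real_inner_self_eq_norm_sq _
  have hNB : N ≤ B.toReal := by
    rw [hφN] at hφ0
    rcases hN0.eq_or_lt with h0 | h0
    · rw [← h0]; exact ENNReal.toReal_nonneg
    · nlinarith
  rwa [hN, ENNReal.toReal_le_toReal hvL.2.ne hBtop] at hNB

end IsLerayHopfWith

/-! ### Passing to the limit -/

/-- A bound by a function vanishing at scale zero plus a power of the viscosity gives the iterated
limit over the scales between `ν ^ L` and `ℓI`. -/
lemma tendsto_limsup_iSup {F : ℝ → ℝ → ℝ≥0∞} {L γ : ℝ} {Ψ : ℝ → ℝ≥0∞} {K : ℝ≥0∞} (hK : K ≠ ⊤)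
    (hγ : 0 < γ) (hΨ : Tendsto Ψ (𝓝[>] 0) (𝓝 0))
    (hF : ∀ ν ∈ Ioo (0 : ℝ) 1, ∀ ℓ, ν ^ L ≤ ℓ → ℓ ≤ 1 / 8 →
      F ν ℓ ≤ Ψ ℓ + K * ENNReal.ofReal (ν ^ γ)) :
    Tendsto (fun ℓI : ℝ => limsup (fun ν : ℝ => ⨆ ℓ ∈ Icc (ν ^ L) ℓI, F ν ℓ) (𝓝[>] (0 : ℝ)))
      (𝓝[>] (0 : ℝ)) (𝓝 0) := by
  rw [ENNReal.tendsto_nhds_zero] at hΨ ⊢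
  intro ε hε
  obtain ⟨δ, hδ, hsub⟩ := mem_nhdsGT_iff_exists_Ioo_subset.1 (hΨ ε hε)
  have hδ0 : (0 : ℝ) < δ := hδ
  filter_upwards [Ioo_mem_nhdsGT (lt_min hδ0 (by norm_num : (0 : ℝ) < 1 / 8))] with ℓI hℓI
  have hlim : Tendsto (fun ν : ℝ => ε + K * ENNReal.ofReal (ν ^ γ)) (𝓝[>] 0) (𝓝 ε) := by
    have h1 : Continuous fun ν : ℝ => ν ^ γ := continuous_id.rpow_const fun _ => Or.inr hγ.le
    have h2 := ((ENNReal.continuous_ofReal.comp h1).tendsto 0).mono_left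
      (nhdsWithin_le_nhds (s := Ioi (0 : ℝ)))
    have h3 := (ENNReal.Tendsto.const_mul h2 (Or.inr hK)).const_add ε
    simpa [Real.zero_rpow hγ.ne'] using h3
  rw [← hlim.limsup_eq]
  refine limsup_le_limsup ?_
  filter_upwards [Ioo_mem_nhdsGT (zero_lt_one (α := ℝ))] with ν hν
  refine iSup₂_le fun ℓ hℓ => (hF ν hν ℓ hℓ.1 ?_).trans ?_
  · exact hℓ.2.trans (hℓI.2.le.trans (min_le_right _ _))
  · gcongr
    refine hsub ⟨(Real.rpow_pos_of_pos hν.1 L).trans_le hℓ.1, ?_⟩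
    exact hℓ.2.trans_lt (hℓI.2.trans_le (min_le_left _ _))

/-! ### The laws in the inviscid limit -/

section Limits

variable {u₀ : Torus d → E d} {u f : ℝ → ℝ → Torus d → E d} {α L : ℝ}

lemma exponent_pos (hα : α ∈ Ioo (0 : ℝ) 1) (hL : L < 1 / (2 * (1 - α))) :
    0 < 1 / 2 - L * (1 - α) := by
  have h1 : 0 < 1 - α := by linarith [hα.2]
  rw [lt_div_iff₀ (by positivity)] at hL
  linarith

lemma ofReal_rpow_le_one {ν γ : ℝ} (hν : ν ∈ Ioo (0 : ℝ) 1) (hγ : 0 < γ) :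
    ENNReal.ofReal (ν ^ γ) ≤ 1 := by
  rw [← ENNReal.ofReal_one]
  exact ENNReal.ofReal_le_ofReal (Real.rpow_le_one hν.1.le hν.2.le hγ.le)

/-- Convergence of the laws in `L^p` in time. -/
theorem tendsto_lawDefect_Lp (hd : 2 ≤ d) (hu₀ : MemLp u₀ 2 volume)
    (hLH : ∀ ν ∈ Ioo (0 : ℝ) 1, IsLerayHopf ν u₀ (f ν) (u ν))
    (h3 : ∀ ν ∈ Ioo (0 : ℝ) 1, MemLp (fun z : ℝ × Torus d => u ν z.1 z.2) 3 (spaceTime d))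
    (hα : α ∈ Ioo (0 : ℝ) 1) {M : ℝ≥0}
    (hM : ∀ ν ∈ Ioo (0 : ℝ) 1, normLqBesov 2 α (u ν) ≤ M) (hL : L < 1 / (2 * (1 - α)))
    {σ : ℝ} (hσ : 0 < σ) {A : ℝ≥0}
    (hA : ∀ ν ∈ Ioo (0 : ℝ) 1, normLqL2 (ENNReal.ofReal (1 + σ)) (f ν) ≤ A) (k : Kind) {p : ℝ}
    (hp : 1 ≤ p) :
    Tendsto (fun ℓI : ℝ => limsup (fun ν : ℝ => ⨆ ℓ ∈ Icc (ν ^ L) ℓI,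
        ∫⁻ t in Icc (0 : ℝ) 1, ENNReal.ofReal (|lawDefect k u₀ (f ν) (u ν) ℓ t| ^ p))
      (𝓝[>] (0 : ℝ))) (𝓝[>] (0 : ℝ)) (𝓝 0) := by
  obtain ⟨C, hC⟩ := exists_defect_const hd k
  have hγ := exponent_pos hα hL
  set N := eLpNorm u₀ 2 volume with hN
  have hNtop : N ≠ ⊤ := hu₀.2.ne
  set W : ℝ≥0∞ := N + 2 * A with hW
  have hWtop : W ≠ ⊤ := ENNReal.add_ne_top.2 ⟨hNtop, ENNReal.mul_ne_top (by simp) (by simp)⟩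
  -- a bound for the defect that is uniform in time, scale and viscosity
  set D : ℝ≥0∞ := C * (ballConst d * (2 * W) ^ 2 + (2 * N) ^ 2 + A * (2 * W) + 2 * W * M) with hD
  have hWM : 2 * W * M ≠ ⊤ := ENNReal.mul_ne_top (ENNReal.mul_ne_top (by simp) hWtop) (by simp)
  have hDtop : D ≠ ⊤ := by
    refine ENNReal.mul_ne_top (by simp) (ENNReal.add_ne_top.2 ⟨ENNReal.add_ne_top.2
      ⟨ENNReal.add_ne_top.2 ⟨?_, ?_⟩, ?_⟩, hWM⟩)
    · exact ENNReal.mul_ne_top (by simp) (ENNReal.pow_ne_top (ENNReal.mul_ne_top (by simp) hWtop))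
    · exact ENNReal.pow_ne_top (ENNReal.mul_ne_top (by simp) hNtop)
    · exact ENNReal.mul_ne_top (by simp) (ENNReal.mul_ne_top (by simp) hWtop)
  have hDp : D ^ (p - 1) ≠ ⊤ := ENNReal.rpow_ne_top_of_nonneg (by linarith) hDtop
  let EF : ℝ → ℝ≥0∞ := fun ℓ => ENNReal.ofReal ((2 * ℓ) ^ (α / 2)) * M
    + 2 * W * (ENNReal.ofReal ((2 * ℓ) ^ (α / 2 * σ)) * (A : ℝ≥0∞) ^ (1 + σ))
  let R : ℝ → ℝ≥0∞ := fun ℓ => ballConst d * (ENNReal.ofReal ((2 * ℓ) ^ α) * M) ^ 2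
    + translationModulus u₀ ℓ + EF ℓ
  have hAσ : (A : ℝ≥0∞) ^ (1 + σ) ≠ ⊤ := ENNReal.rpow_ne_top_of_nonneg (by linarith) (by simp)
  have tR : Tendsto R (𝓝[>] 0) (𝓝 0) := by
    have t1 : Tendsto (fun ℓ : ℝ => ballConst d * (ENNReal.ofReal ((2 * ℓ) ^ α) * (M : ℝ≥0∞)) ^ 2)
        (𝓝[>] 0) (𝓝 (ballConst d * (0 * (M : ℝ≥0∞)) ^ 2)) :=
      ENNReal.Tendsto.const_mul (ENNReal.Tendsto.pow (ENNReal.Tendsto.mul_const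
        (tendsto_ofReal_two_mul_rpow hα.1) (Or.inr (by simp)))) (Or.inr (by simp))
    have t2 : Tendsto EF (𝓝[>] 0) (𝓝 (0 * M + 2 * W * (0 * (A : ℝ≥0∞) ^ (1 + σ)))) :=
      (ENNReal.Tendsto.mul_const (tendsto_ofReal_two_mul_rpow (by linarith [hα.1]))
        (Or.inr (by simp))).add (ENNReal.Tendsto.const_mul (ENNReal.Tendsto.mul_const
          (tendsto_ofReal_two_mul_rpow (mul_pos (by linarith [hα.1]) hσ)) (Or.inr hAσ))
          (Or.inr (ENNReal.mul_ne_top (by simp) hWtop)))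
    have := (t1.add (tendsto_translationModulus hu₀)).add t2
    simpa using this
  have tΨ : Tendsto (fun ℓ => D ^ (p - 1) * (C * R ℓ)) (𝓝[>] 0) (𝓝 0) := by
    have := ENNReal.Tendsto.const_mul (a := D ^ (p - 1)) (ENNReal.Tendsto.const_mul
      (a := (C : ℝ≥0∞)) tR (Or.inr (by simp))) (Or.inr hDp)
    simpa using this
  refine tendsto_limsup_iSup (K := D ^ (p - 1) * (C * (2 * W * M)))
    (ENNReal.mul_ne_top hDp (ENNReal.mul_ne_top (by simp) hWM)) hγ tΨ ?_
  intro ν hν ℓ hνℓ hℓ'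
  obtain ⟨G, h⟩ := hLH ν hν
  have hℓ : 0 < ℓ := (Real.rpow_pos_of_pos hν.1 L).trans_le hνℓ
  have hA1 : normLqL2 1 (f ν) ≤ A := (normLqL2_one_le h.force_meas (by
    rw [← ENNReal.ofReal_one]; exact ENNReal.ofReal_le_ofReal (by linarith))).trans (hA ν hν)
  have hu := h.eLpNorm_le_of_force hν.1.le hA1
  have hincr : ∀ (z : E d), ∀ t ∈ Icc (0 : ℝ) 1, eLpNorm (incr z (u ν t)) 2 volume ≤ 2 * W :=
    fun z t ht => (eLpNorm_incr_le_two_mul (h.memLp t ht).1 z).trans (by gcongr; exact hu t ht)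
  have hvis := viscous_error_le (u₀ := u₀) (A := A) (M := M) hν hα hνℓ
  rw [← hN, ← hW] at hvis
  have hcrude : ∀ t ∈ Icc (0 : ℝ) 1, ENNReal.ofReal |lawDefect k u₀ (f ν) (u ν) ℓ t| ≤ D := by
    intro t ht
    refine (hC h (h3 ν hν) hℓ hℓ' ht (E0 := (2 * N) ^ 2) (EF := A * (2 * W)) (fun z _ => ?_)
      (fun z _ => h.lintegral_force_mul_le hA1 (hincr z)) (fun z hz j =>
        h.lintegral_gradient_mul_incr_le hν.1 hA1 hα.1.le (hM ν hν) hz j)).trans ?_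
    · gcongr
      exact eLpNorm_incr_le_two_mul hu₀.1 z
    · rw [hD]
      refine mul_le_mul_right (add_le_add (add_le_add (add_le_add ?_ le_rfl) le_rfl) ?_) _
      · exact averagedIncr_le hℓ fun z _ => hincr z t ht
      · refine hvis.trans ?_
        calc _ ≤ 2 * W * M * 1 := by gcongr; exact ofReal_rpow_le_one hν hγ
          _ = _ := mul_one _
  have hfine : ∀ t ∈ Icc (0 : ℝ) 1, ENNReal.ofReal |lawDefect k u₀ (f ν) (u ν) ℓ t|
      ≤ C * (averagedIncr (u ν t) ℓ + (translationModulus u₀ ℓ + EF ℓ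
        + 2 * W * M * ENNReal.ofReal (ν ^ (1 / 2 - L * (1 - α))))) := by
    intro t ht
    refine (hC h (h3 ν hν) hℓ hℓ' ht (E0 := translationModulus u₀ ℓ) (EF := EF ℓ)
      (fun z hz => le_iSup₂ (f := fun (z : E d) (_ : ‖z‖ ≤ 2 * ℓ) =>
        eLpNorm (incr z u₀) 2 volume ^ 2) z hz)
      (fun z hz => h.lintegral_force_mul_incr_le hσ (hA ν hν) hα.1 (hM ν hν) hu hℓ hz)
      (fun z hz j =>
        h.lintegral_gradient_mul_incr_le hν.1 hA1 hα.1.le (hM ν hν) hz j)).trans ?_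
    refine mul_le_mul_right ?_ _
    rw [← add_assoc, ← add_assoc]
    exact add_le_add (add_le_add (add_le_add le_rfl le_rfl) le_rfl) hvis
  have havg := lintegral_averagedIncr_le h.meas hℓ hℓ' (B := (ENNReal.ofReal ((2 * ℓ) ^ α) * M) ^ 2)
    fun z hz => (lintegral_incr_sq_le (hM ν hν) z).trans (by have := hα.1.le; gcongr)
  change ∫⁻ t, _ ∂timeMeasure ≤ _
  calc _ ≤ ∫⁻ t, D ^ (p - 1) * (C * (averagedIncr (u ν t) ℓ + (translationModulus u₀ ℓ + EF ℓ
        + 2 * W * M * ENNReal.ofReal (ν ^ (1 / 2 - L * (1 - α)))))) ∂timeMeasure := by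
        refine lintegral_mono_ae ?_
        filter_upwards [ae_mem_Icc_timeMeasure] with t ht
        -- `X ^ p ≤ D ^ (p - 1) * X`, and `X` is small in `L¹` in time
        rw [← ENNReal.ofReal_rpow_of_nonneg (abs_nonneg _) (by linarith)]
        set X := ENNReal.ofReal |lawDefect k u₀ (f ν) (u ν) ℓ t| with hX
        calc X ^ p = X ^ (p - 1) * X := by
              nth_rewrite 3 [← ENNReal.rpow_one X]
              rw [← ENNReal.rpow_add_of_nonneg _ _ (by linarith) zero_le_one, sub_add_cancel]
          _ ≤ _ := mul_le_mul' (ENNReal.rpow_le_rpow (hcrude t ht) (by linarith)) (hfine t ht)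
    _ = D ^ (p - 1) * (C * ((∫⁻ t, averagedIncr (u ν t) ℓ ∂timeMeasure)
        + (translationModulus u₀ ℓ + EF ℓ
          + 2 * W * M * ENNReal.ofReal (ν ^ (1 / 2 - L * (1 - α)))))) := by
        rw [lintegral_const_mul' _ _ hDp, lintegral_const_mul' _ _ (by simp),
          lintegral_add_right _ measurable_const, lintegral_const, measure_univ, mul_one]
    _ ≤ D ^ (p - 1) * (C * (ballConst d * (ENNReal.ofReal ((2 * ℓ) ^ α) * M) ^ 2
        + (translationModulus u₀ ℓ + EF ℓ
          + 2 * W * M * ENNReal.ofReal (ν ^ (1 / 2 - L * (1 - α)))))) := by gcongr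
    _ = _ := by simp only [R]; ring

/-- Convergence of the laws uniformly in time. -/
theorem tendsto_lawDefect_uniform (hd : 2 ≤ d) (hu₀ : MemLp u₀ 2 volume)
    (hLH : ∀ ν ∈ Ioo (0 : ℝ) 1, IsLerayHopf ν u₀ (f ν) (u ν))
    (h3 : ∀ ν ∈ Ioo (0 : ℝ) 1, MemLp (fun z : ℝ × Torus d => u ν z.1 z.2) 3 (spaceTime d))
    (hα : α ∈ Ioo (0 : ℝ) 1) {M : ℝ≥0}
    (hM : ∀ ν ∈ Ioo (0 : ℝ) 1, normLqBesov 2 α (u ν) ≤ M) (hL : L < 1 / (2 * (1 - α)))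
    {β : ℝ} (hβ : 0 < β) {B : ℝ≥0} (hB : ∀ ν ∈ Ioo (0 : ℝ) 1, normLqBesov ⊤ β (u ν) ≤ B)
    {A : ℝ≥0} (hA : ∀ ν ∈ Ioo (0 : ℝ) 1, normLqL2 1 (f ν) ≤ A) (k : Kind) :
    Tendsto (fun ℓI : ℝ => limsup (fun ν : ℝ => ⨆ ℓ ∈ Icc (ν ^ L) ℓI, ⨆ t ∈ Icc (0 : ℝ) 1,
        ENNReal.ofReal |lawDefect k u₀ (f ν) (u ν) ℓ t|)
      (𝓝[>] (0 : ℝ))) (𝓝[>] (0 : ℝ)) (𝓝 0) := by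
  obtain ⟨C, hC⟩ := exists_defect_const hd k
  have hγ := exponent_pos hα hL
  set N := eLpNorm u₀ 2 volume with hN
  have hNtop : N ≠ ⊤ := hu₀.2.ne
  set W : ℝ≥0∞ := N + 2 * A with hW
  have hWtop : W ≠ ⊤ := ENNReal.add_ne_top.2 ⟨hNtop, ENNReal.mul_ne_top (by simp) (by simp)⟩
  have hWM : 2 * W * M ≠ ⊤ := ENNReal.mul_ne_top (ENNReal.mul_ne_top (by simp) hWtop) (by simp)
  let R : ℝ → ℝ≥0∞ := fun ℓ => ballConst d * (ENNReal.ofReal ((2 * ℓ) ^ β) * B) ^ 2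
    + translationModulus u₀ ℓ + A * (ENNReal.ofReal ((2 * ℓ) ^ β) * B)
  have tR : Tendsto (fun ℓ => C * R ℓ) (𝓝[>] 0) (𝓝 0) := by
    have t0 := ENNReal.Tendsto.mul_const (b := (B : ℝ≥0∞)) (tendsto_ofReal_two_mul_rpow hβ)
      (Or.inr (by simp))
    have t1 : Tendsto (fun ℓ : ℝ => ballConst d * (ENNReal.ofReal ((2 * ℓ) ^ β) * (B : ℝ≥0∞)) ^ 2)
        (𝓝[>] 0) (𝓝 (ballConst d * (0 * (B : ℝ≥0∞)) ^ 2)) :=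
      ENNReal.Tendsto.const_mul (ENNReal.Tendsto.pow t0) (Or.inr (by simp))
    have t2 := ENNReal.Tendsto.const_mul (a := (A : ℝ≥0∞)) t0 (Or.inr (by simp))
    have := ENNReal.Tendsto.const_mul (a := (C : ℝ≥0∞))
      ((t1.add (tendsto_translationModulus hu₀)).add t2) (Or.inr (by simp))
    simpa using this
  refine tendsto_limsup_iSup (K := C * (2 * W * M)) (ENNReal.mul_ne_top (by simp) hWM) hγ tR ?_
  intro ν hν ℓ hνℓ hℓ'
  obtain ⟨G, h⟩ := hLH ν hν
  have hℓ : 0 < ℓ := (Real.rpow_pos_of_pos hν.1 L).trans_le hνℓ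
  have hincr : ∀ (z : E d), ‖z‖ ≤ 2 * ℓ → ∀ t ∈ Icc (0 : ℝ) 1,
      eLpNorm (incr z (u ν t)) 2 volume ≤ ENNReal.ofReal ((2 * ℓ) ^ β) * B := fun z hz t ht =>
    (h.eLpNorm_incr_le_of_normLqBesov_top (hB ν hν) ht z).trans (by gcongr)
  have hvis := viscous_error_le (u₀ := u₀) (A := A) (M := M) hν hα hνℓ
  rw [← hN, ← hW] at hvis
  refine iSup₂_le fun t ht => ?_
  refine (hC h (h3 ν hν) hℓ hℓ' ht (E0 := translationModulus u₀ ℓ)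
    (fun z hz => le_iSup₂ (f := fun (z : E d) (_ : ‖z‖ ≤ 2 * ℓ) =>
      eLpNorm (incr z u₀) 2 volume ^ 2) z hz)
    (fun z hz => h.lintegral_force_mul_le (hA ν hν) (hincr z hz))
    (fun z hz j =>
      h.lintegral_gradient_mul_incr_le hν.1 (hA ν hν) hα.1.le (hM ν hν) hz j)).trans ?_
  rw [mul_assoc (C : ℝ≥0∞) (2 * W * M), ← mul_add]
  refine mul_le_mul_right ?_ _
  exact add_le_add (add_le_add (add_le_add
    (averagedIncr_le hℓ fun z hz => hincr z hz t ht) le_rfl) le_rfl) hvis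

end Limits

/-! ### Averaging against a mollifier -/

/-- Averages over a probability measure contract `L²`. -/
lemma eLpNorm_two_average_sq_le {m : Measure (E d)} [IsProbabilityMeasure m] {F' : Type*}
    [NormedAddCommGroup F'] [NormedSpace ℝ F'] {F : Torus d × E d → F'}
    (hF : AEStronglyMeasurable F (volume.prod m)) :
    eLpNorm (fun x => ∫ z, F (x, z) ∂m) 2 volume ^ 2
      ≤ ∫⁻ z, eLpNorm (fun x => F (x, z)) 2 volume ^ 2 ∂m := by
  simp_rw [← lintegral_enorm_sq]
  rw [← lintegral_lintegral_swap (f := fun x z => ‖F (x, z)‖ₑ ^ 2) (hF.enorm.pow_const 2)]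
  refine lintegral_mono_ae ?_
  filter_upwards [hF.prodMk_left] with x hx
  rw [lintegral_enorm_sq]
  gcongr
  refine (enorm_integral_le_lintegral_enorm _).trans ?_
  rw [← eLpNorm_one_eq_lintegral_enorm]
  exact eLpNorm_le_eLpNorm_of_exponent_le (by norm_num) hx

/-- The scalar kernel `ρ · Id` of a normalized bump function. -/
def bumpKernel (φ : ContDiffBump (0 : E d)) (z : E d) : E d →L[ℝ] E d :=
  φ.normed volume z • ContinuousLinearMap.id ℝ (E d)

lemma isSmoothKernel_bumpKernel {φ : ContDiffBump (0 : E d)} (hφ : φ.rOut ≤ 1 / 4) :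
    IsSmoothKernel (bumpKernel φ) where
  smooth := φ.contDiff_normed.smul contDiff_const
  supp z hz := by
    have : φ.normed volume z = 0 := by
      rw [← Function.notMem_support, φ.support_normed_eq]
      simp only [Metric.mem_ball, dist_zero_right, not_lt]
      linarith
    rw [bumpKernel, this]
    ext1 w
    simp

/-- The probability measure on `ℝ^d` with a normalized bump as density. -/
def bumpMeasure (φ : ContDiffBump (0 : E d)) : Measure (E d) :=
  volume.withDensity fun z => ENNReal.ofReal (φ.normed volume z)

instance isProbabilityMeasure_bumpMeasure (φ : ContDiffBump (0 : E d)) :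
    IsProbabilityMeasure (bumpMeasure φ) := by
  refine ⟨?_⟩
  rw [bumpMeasure, withDensity_apply _ MeasurableSet.univ, Measure.restrict_univ,
    ← ofReal_integral_eq_lintegral_ofReal φ.integrable_normed
      (Eventually.of_forall φ.nonneg_normed), φ.integral_normed, ENNReal.ofReal_one]

lemma ae_bumpMeasure (φ : ContDiffBump (0 : E d)) :
    ∀ᵐ z ∂(bumpMeasure φ), ‖z‖ < φ.rOut := by
  rw [bumpMeasure, ae_withDensity_iff φ.continuous_normed.measurable.ennreal_ofReal]
  refine Eventually.of_forall fun z hz => ?_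
  have : z ∈ Function.support (φ.normed volume) := fun h0 => hz (by simp [h0])
  rw [φ.support_normed_eq] at this
  simpa using this

lemma smear_bumpKernel (φ : ContDiffBump (0 : E d)) (v : Torus d → E d) (x : Torus d) :
    smear (bumpKernel φ) v x = ∫ z, v (x + toTorus z) ∂(bumpMeasure φ) := by
  rw [bumpMeasure, integral_withDensity_eq_integral_toReal_smul
    φ.continuous_normed.measurable.ennreal_ofReal (Eventually.of_forall fun z => by simp)]
  refine integral_congr_ae (Eventually.of_forall fun z => ?_)
  simp [bumpKernel, ENNReal.toReal_ofReal (φ.nonneg_normed z)]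

lemma aestronglyMeasurable_shift_bump (φ : ContDiffBump (0 : E d)) {v : Torus d → E d}
    (hv : AEStronglyMeasurable v volume) :
    AEStronglyMeasurable (fun q : Torus d × E d => v (q.1 + toTorus q.2))
      (volume.prod (bumpMeasure φ)) :=
  aestronglyMeasurable_shift (measurable_torusShift measurable_toTorus)
    (fun z => measurePreserving_translate (toTorus z)) hv

lemma eLpNorm_smear_bumpKernel_le (φ : ContDiffBump (0 : E d)) {v : Torus d → E d}
    (hv : AEStronglyMeasurable v volume) :
    eLpNorm (smear (bumpKernel φ) v) 2 volume ≤ eLpNorm v 2 volume := by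
  rw [← ENNReal.pow_le_pow_left_iff two_ne_zero, show smear (bumpKernel φ) v = _ from
    funext fun x => smear_bumpKernel φ v x]
  refine (eLpNorm_two_average_sq_le (aestronglyMeasurable_shift_bump φ hv)).trans ?_
  have : ∀ z : E d, eLpNorm (fun x => v (x + toTorus z)) 2 volume = eLpNorm v 2 volume := fun z =>
    eLpNorm_comp_measurePreserving hv (measurePreserving_translate (toTorus z))
  simp [this]

lemma eLpNorm_smear_bumpKernel_sub_le {φ : ContDiffBump (0 : E d)} {v : Torus d → E d}
    (hv : MemLp v 2 volume) {η : ℝ≥0∞}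
    (hη : ∀ z : E d, ‖z‖ < φ.rOut → eLpNorm (fun x => v (x + toTorus z) - v x) 2 volume ≤ η) :
    eLpNorm (fun x => smear (bumpKernel φ) v x - v x) 2 volume ≤ η := by
  have hm := aestronglyMeasurable_shift_bump φ hv.1
  have hmem : MemLp (fun q : Torus d × E d => v (q.1 + toTorus q.2)) 2
      (volume.prod (bumpMeasure φ)) :=
    memLp_shift (measurable_torusShift measurable_toTorus)
      (fun z => measurePreserving_translate (toTorus z)) hv
  have hint := (hmem.integrable (by norm_num)).prod_right_ae
  have e : (fun x => smear (bumpKernel φ) v x - v x)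
      =ᵐ[volume] fun x => ∫ z, (v (x + toTorus z) - v x) ∂(bumpMeasure φ) := by
    filter_upwards [hint] with x hx
    rw [integral_sub hx (integrable_const _), smear_bumpKernel]
    simp
  rw [← ENNReal.pow_le_pow_left_iff two_ne_zero, eLpNorm_congr_ae e]
  refine (eLpNorm_two_average_sq_le (F := fun q => v (q.1 + toTorus q.2) - v q.1)
    (hm.sub hv.1.comp_fst)).trans ?_
  calc _ ≤ ∫⁻ _, η ^ 2 ∂(bumpMeasure φ) := by
        refine lintegral_mono_ae ?_
        filter_upwards [ae_bumpMeasure φ] with z hz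
        gcongr
        exact hη z hz
    _ = η ^ 2 := by simp

/-- Mollification commutes with weak differentiation. -/
lemma partialDeriv_smear_bumpKernel {φ : ContDiffBump (0 : E d)} (hφ : φ.rOut ≤ 1 / 4)
    {v : Torus d → E d} (hv : Integrable v) {H : Torus d → Fin d → E d} (hH : IsWeakGradient v H)
    {j : Fin d} (hHj : Integrable fun x => H x j) (x : Torus d) :
    partialDeriv j (smear (bumpKernel φ) v) x = smear (bumpKernel φ) (fun w => H w j) x := by
  have hK := isSmoothKernel_bumpKernel hφ
  set ρ := φ.normed (volume : Measure (E d)) with hρ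
  have hρs : ContDiff ℝ (⊤ : ℕ∞) ρ := φ.contDiff_normed
  have hρ0 : ∀ z, 1 / 4 < ‖z‖ → ρ z = 0 := by
    intro z hz
    rw [← Function.notMem_support, hρ, φ.support_normed_eq]
    simp only [Metric.mem_ball, dist_zero_right, not_lt]
    linarith
  have hder : ∀ z, fderiv ℝ (bumpKernel φ) z (EuclideanSpace.single j 1)
      = fderiv ℝ ρ z (EuclideanSpace.single j 1) • ContinuousLinearMap.id ℝ (E d) := by
    intro z
    have h1 : HasFDerivAt (bumpKernel φ) _ z :=
      ((hρs.differentiable (by simp)) z).hasFDerivAt.smul_const (ContinuousLinearMap.id ℝ (E d))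
    rw [h1.fderiv]
    simp
  rw [partialDeriv_smear hK hv, smear_eq_torus (hK.fderiv_apply _) hv, smear_eq_torus hK hHj]
  have hcoord : ∀ (κ : E d → ℝ) (w : Torus d → E d) (i : Fin d), Continuous κ → (∃ C, ∀ z, ‖κ z‖ ≤ C) →
      Integrable w → (∫ y, (κ (torusRepr (y - x)) • ContinuousLinearMap.id ℝ (E d)) (w y)) i
        = ∫ y, w y i * κ (torusRepr (y - x)) := by
    intro κ w i hκ ⟨C, hC⟩ hw
    have hi : Integrable fun y => κ (torusRepr (y - x)) • w y := by
      refine hw.bdd_smul C ?_ (Eventually.of_forall fun y => hC _)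
      exact (hκ.comp_stronglyMeasurable ((measurable_torusRepr.comp
          (measurable_id.sub_const x)).stronglyMeasurable)).aestronglyMeasurable
    refine ((EuclideanSpace.proj (𝕜 := ℝ) i).integral_comp_comm hi).symm.trans ?_
    refine integral_congr_ae (Eventually.of_forall fun y => ?_)
    simp [mul_comm]
  have hcs : HasCompactSupport ρ := φ.hasCompactSupport_normed
  have hρd : Continuous fun z => fderiv ℝ ρ z (EuclideanSpace.single j 1) :=
    (hρs.continuous_fderiv (by simp)).clm_apply continuous_const
  ext i
  rw [PiLp.neg_apply]
  simp_rw [hder]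
  rw [hcoord _ _ i hρd ((hcs.fderiv_apply ℝ _).exists_bound_of_continuous hρd) hv]
  have h2 : ∀ y, bumpKernel φ (torusRepr (y - x))
      = ρ (torusRepr (y - x)) • ContinuousLinearMap.id ℝ (E d) := fun y => rfl
  simp_rw [h2]
  rw [hcoord _ _ i hρs.continuous (hcs.exists_bound_of_continuous hρs.continuous) hHj]
  have h3 := hH (periodize ρ x) (smoothOnTorus_periodize hρs hρ0 x) i j
  simp_rw [partialDeriv_periodize hρs hρ0] at h3
  rw [h3, neg_neg]
  rfl

/-! ### The Sobolev embedding `H¹ ⊂ L⁴` in dimension at most four -/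

lemma eLpNorm_unitCube {F' : Type*} [NormedAddCommGroup F'] {p : ℝ≥0∞} {g : Torus d → F'}
    (hg : AEStronglyMeasurable g volume) (a : E d) :
    eLpNorm (fun y => g (toTorus y)) p (volume.restrict (unitCube a)) = eLpNorm g p volume :=
  eLpNorm_comp_measurePreserving hg (measurePreserving_toTorus a)

lemma exists_eLpNorm_two_lift_le {s : Set (E d)} (hs : IsCompact s) :
    ∃ N : ℝ≥0, ∀ g : Torus d → ℝ, AEStronglyMeasurable g volume →
      eLpNorm (fun y => g (toTorus y)) 2 (volume.restrict s) ≤ N * eLpNorm g 2 volume := by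
  obtain ⟨N, hN⟩ := exists_lintegral_lift_le hs
  refine ⟨NNReal.sqrt N, fun g hg => ?_⟩
  rw [← ENNReal.pow_le_pow_left_iff two_ne_zero, mul_pow, ← lintegral_enorm_sq, ← lintegral_enorm_sq]
  have := hN (fun x => ‖g x‖ₑ ^ 2) (hg.enorm.pow_const 2)
  refine this.trans_eq ?_
  rw [← ENNReal.coe_pow, NNReal.sq_sqrt]

lemma smoothOnTorus_apply_fderiv {g : Torus d → E d} (hg : SmoothOnTorus g) (y : E d) (j : Fin d) :
    fderiv ℝ (fun y => g (toTorus y)) y (EuclideanSpace.single j 1)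
      = partialDeriv j g (toTorus y) := by
  have h0 : y + EuclideanSpace.single j (0 : ℝ) = y := by
    have : (EuclideanSpace.single j (0 : ℝ) : E d) = 0 := by ext i; simp
    rw [this, add_zero]
  have h1 : HasFDerivAt (fun y => g (toTorus y)) (fderiv ℝ (fun y => g (toTorus y)) y)
      (y + EuclideanSpace.single j (0 : ℝ)) := by
    rw [h0]
    exact (hg.differentiable (by simp) y).hasFDerivAt
  have h := h1.comp_hasDerivAt (0 : ℝ) (hasDerivAt_line y j)
  rw [← h.deriv]
  unfold partialDeriv
  congr 1

lemma norm_clm_le_sum (D : E d →L[ℝ] E d) :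
    ‖D‖ ≤ ∑ j, ‖D (EuclideanSpace.single j 1)‖ := by
  refine D.opNorm_le_bound (Finset.sum_nonneg fun j _ => norm_nonneg _) fun a => ?_
  have ha : a = ∑ j, a j • (EuclideanSpace.single j 1 : E d) := by
    ext i; simp [Pi.single_apply]
  conv_lhs => rw [ha, map_sum]
  rw [Finset.sum_mul]
  refine (norm_sum_le _ _).trans (Finset.sum_le_sum fun j _ => ?_)
  rw [map_smul, norm_smul, mul_comm]
  exact mul_le_mul_of_nonneg_left (PiLp.norm_apply_le a j) (norm_nonneg _)

/-- The Sobolev inequality for smooth fields: localize by a cutoff which equals one on a period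
cell, and use the Gagliardo–Nirenberg–Sobolev inequality from `L^{4d/(d+4)}` to `L⁴`; the exponent
`4d/(d+4)` is at most `2` since `d ≤ 4`. -/
lemma exists_sobolev_smooth (hd : 2 ≤ d) (hd4 : d ≤ 4) :
    ∃ C : ℝ≥0, ∀ g : Torus d → E d, SmoothOnTorus g →
      (∀ j, AEStronglyMeasurable (partialDeriv j g) volume) →
      eLpNorm g 4 volume ≤ C * (eLpNorm g 2 volume + ∑ j, eLpNorm (partialDeriv j g) 2 volume) := by
  have hdR : (2 : ℝ) ≤ d := by exact_mod_cast hd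
  have hd4R : (d : ℝ) ≤ 4 := by exact_mod_cast hd4
  let χ : ContDiffBump (0 : E d) := ⟨d + 1, d + 2, by positivity, by linarith⟩
  set B : Set (E d) := Metric.closedBall 0 (d + 2) with hB
  obtain ⟨N, hN⟩ := exists_eLpNorm_two_lift_le (isCompact_closedBall (0 : E d) ((d : ℝ) + 2))
  have hχs : ContDiff ℝ (⊤ : ℕ∞) χ := χ.contDiff
  have hχc : HasCompactSupport χ := χ.hasCompactSupport
  obtain ⟨A, hA⟩ := (hχc.fderiv (𝕜 := ℝ)).exists_bound_of_continuous
    (hχs.continuous_fderiv (by simp))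
  let p : ℝ≥0 := 4 * d / (d + 4)
  have hpR : (p : ℝ) = 4 * d / (d + 4) := by simp [p]
  have hp1 : 1 ≤ p := by
    rw [← NNReal.coe_le_coe, hpR, NNReal.coe_one, le_div_iff₀ (by positivity)]
    linarith
  have hp2 : (p : ℝ≥0∞) ≤ 2 := by
    rw [show (2 : ℝ≥0∞) = ((2 : ℝ≥0) : ℝ≥0∞) by rfl, ENNReal.coe_le_coe, ← NNReal.coe_le_coe, hpR,
      div_le_iff₀ (by positivity)]
    push_cast
    linarith
  set S := eLpNormLESNormFDerivOfEqInnerConst (volume : Measure (E d)) p with hS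
  set V : ℝ≥0∞ := (volume B) ^ (1 / (p : ℝ≥0∞).toReal - 1 / (2 : ℝ≥0∞).toReal) with hV
  have hVtop : V ≠ ⊤ := by
    refine ENNReal.rpow_ne_top_of_nonneg ?_ (measure_closedBall_lt_top).ne
    rw [sub_nonneg]
    exact one_div_le_one_div_of_le (by simp; exact lt_of_lt_of_le one_pos hp1)
      (ENNReal.toReal_mono (by simp) hp2)
  let A' : ℝ≥0 := (Real.toNNReal A) + 1
  refine ⟨S * V.toNNReal * (A' * N), fun g hg hgm => ?_⟩
  have hgmeas : AEStronglyMeasurable g volume := (measurable_of_smoothOnTorus hg).aestronglyMeasurable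
  have hgs : ContDiff ℝ (⊤ : ℕ∞) fun y : E d => g (toTorus y) := hg
  set w : E d → E d := fun y => χ y • g (toTorus y) with hw
  have hws : ContDiff ℝ 1 w := (hχs.smul hgs).of_le (by simp)
  have hwc : HasCompactSupport w := hχc.smul_right
  -- the cutoff is one on the unit cube, whose points have norm at most `d`
  have h1 : eLpNorm g 4 volume ≤ eLpNorm w 4 volume := by
    rw [← eLpNorm_unitCube hgmeas 0]
    refine le_trans (le_of_eq ?_) (eLpNorm_mono_measure w (Measure.restrict_le_self (s := unitCube 0)))
    refine eLpNorm_congr_ae ?_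
    filter_upwards [ae_restrict_mem (measurableSet_unitCube 0)] with y hy
    have : ‖y‖ ≤ d := by
      rw [EuclideanSpace.norm_eq]
      refine Real.sqrt_le_iff.2 ⟨by positivity, ?_⟩
      calc ∑ i, ‖y i‖ ^ 2 ≤ ∑ i : Fin d, (1 : ℝ) := by
            refine Finset.sum_le_sum fun i _ => ?_
            have := hy i
            simp only [PiLp.zero_apply, zero_add] at this
            rw [Real.norm_eq_abs, sq_abs]
            nlinarith [this.1, this.2]
        _ = d := by simp
        _ ≤ (d : ℝ) ^ 2 := by nlinarith
    have hχ1 : χ y = 1 := χ.one_of_mem_closedBall (by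
      simp only [Metric.mem_closedBall, dist_zero_right]
      exact this.trans (by simp [χ]))
    simp [hw, hχ1]
  have h2 : eLpNorm w 4 volume ≤ S * eLpNorm (fderiv ℝ w) p volume := by
    refine eLpNorm_le_eLpNorm_fderiv_of_eq_inner (p' := 4) volume hws hwc hp1 (by simp; omega) ?_
    rw [finrank_euclideanSpace, Fintype.card_fin, NNReal.coe_inv, hpR]
    have : (d : ℝ) ≠ 0 := by positivity
    push_cast
    field_simp
    ring
  have hsupp : ∀ y ∉ B, fderiv ℝ w y = 0 := by
    intro y hy
    have : χ.toFun =ᶠ[𝓝 y] fun _ => 0 := by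
      have h : y ∉ tsupport χ := by rw [χ.tsupport_eq]; exact hy
      exact notMem_tsupport_iff_eventuallyEq.1 h
    have h' : w =ᶠ[𝓝 y] fun _ => 0 := by
      filter_upwards [this] with z hz
      simp only [hw]
      rw [show χ z = 0 from hz, zero_smul]
    rw [h'.fderiv_eq, fderiv_const_apply]
  have h3 : eLpNorm (fderiv ℝ w) p volume = eLpNorm (fderiv ℝ w) p (volume.restrict B) := by
    rw [← eLpNorm_norm, ← eLpNorm_norm (fderiv ℝ w),
      ← eLpNorm_indicator_eq_eLpNorm_restrict (f := fun y => ‖fderiv ℝ w y‖) (s := B)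
      Metric.isClosed_closedBall.measurableSet]
    congr 1
    refine (indicator_eq_self.2 fun y hy => ?_).symm
    by_contra hcon
    exact hy (norm_eq_zero.2 (hsupp y hcon))
  have h4 : eLpNorm (fderiv ℝ w) p (volume.restrict B)
      ≤ eLpNorm (fderiv ℝ w) 2 (volume.restrict B) * V := by
    have := eLpNorm_le_eLpNorm_mul_rpow_measure_univ (μ := volume.restrict B) hp2
      ((hws.continuous_fderiv (by simp)).aestronglyMeasurable)
    rwa [Measure.restrict_apply_univ] at this
  set Φ : Torus d → ℝ := fun x => ‖g x‖ + ∑ j, ‖partialDeriv j g x‖ with hΦ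
  have hΦm : AEStronglyMeasurable Φ volume :=
    hgmeas.norm.add (Finset.aestronglyMeasurable_fun_sum _ fun j _ => (hgm j).norm)
  have hA0 : 0 ≤ A := (norm_nonneg _).trans (hA 0)
  have hpt : ∀ y, ‖fderiv ℝ w y‖ ≤ ‖(A' : ℝ) • Φ (toTorus y)‖ := by
    intro y
    have hd1 : HasFDerivAt w _ y := ((hχs.differentiable (by simp)) y).hasFDerivAt.smul
      ((hgs.differentiable (by simp)) y).hasFDerivAt
    have hsum : ‖fderiv ℝ (fun y => g (toTorus y)) y‖ ≤ ∑ j, ‖partialDeriv j g (toTorus y)‖ := by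
      refine (norm_clm_le_sum _).trans_eq (Finset.sum_congr rfl fun j _ => ?_)
      rw [smoothOnTorus_apply_fderiv hg]
    have hsum0 : 0 ≤ ∑ j, ‖partialDeriv j g (toTorus y)‖ := (norm_nonneg _).trans hsum
    have hA' : (A' : ℝ) = A + 1 := by simp [A', hA0]
    rw [hd1.fderiv, smul_eq_mul, Real.norm_of_nonneg (by positivity)]
    refine (norm_add_le _ _).trans ?_
    rw [norm_smul, Real.norm_of_nonneg χ.nonneg]
    refine (add_le_add (mul_le_mul χ.le_one hsum (norm_nonneg _) zero_le_one)
      (ContinuousLinearMap.norm_smulRight_apply _ _).le).trans ?_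
    have := mul_le_mul_of_nonneg_right (hA y) (norm_nonneg (g (toTorus y)))
    rw [hA', hΦ]
    nlinarith [norm_nonneg (g (toTorus y)), mul_nonneg hA0 hsum0]
  have h5 : eLpNorm (fderiv ℝ w) 2 (volume.restrict B)
      ≤ A' * (N * (eLpNorm g 2 volume + ∑ j, eLpNorm (partialDeriv j g) 2 volume)) := by
    refine (eLpNorm_mono hpt).trans ?_
    refine (eLpNorm_const_smul (A' : ℝ) (fun y => Φ (toTorus y)) 2 (volume.restrict B)).le.trans ?_
    rw [show ‖(A' : ℝ)‖ₑ = A' by simp]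
    gcongr
    refine (hN Φ hΦm).trans ?_
    gcongr
    refine (eLpNorm_add_le hgmeas.norm
      (Finset.aestronglyMeasurable_fun_sum _ fun j _ => (hgm j).norm) (by norm_num)).trans ?_
    rw [eLpNorm_norm]
    gcongr
    rw [show (fun x => ∑ j, ‖partialDeriv j g x‖) = ∑ j, fun x => ‖partialDeriv j g x‖ by
      ext x; simp]
    refine (eLpNorm_sum_le (fun j _ => (hgm j).norm) (by norm_num)).trans_eq ?_
    simp_rw [eLpNorm_norm]
  calc eLpNorm g 4 volume ≤ S * (A' * (N * (eLpNorm g 2 volume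
        + ∑ j, eLpNorm (partialDeriv j g) 2 volume)) * V) := by
        refine (h1.trans h2).trans ?_
        rw [h3]
        gcongr
        refine h4.trans ?_
        gcongr
    _ = _ := by
        push_cast
        rw [ENNReal.coe_toNNReal hVtop]
        ring

/-- The Sobolev inequality `‖v‖_{L⁴} ≤ C ‖v‖_{H¹}` on the torus in dimension at most four. -/
lemma exists_sobolev (hd : 2 ≤ d) (hd4 : d ≤ 4) :
    ∃ C : ℝ≥0, ∀ (v : Torus d → E d) (H : Torus d → Fin d → E d), MemLp v 2 volume →
      IsWeakGradient v H → (∀ j, MemLp (fun x => H x j) 2 volume) →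
      eLpNorm v 4 volume
        ≤ C * (eLpNorm v 2 volume + ∑ j, eLpNorm (fun x => H x j) 2 volume) := by
  obtain ⟨C, hC⟩ := exists_sobolev_smooth hd hd4
  refine ⟨C, fun v H hv hH hHj => ?_⟩
  let φ : ℕ → ContDiffBump (0 : E d) := fun n =>
    ⟨1 / (8 * ((n : ℝ) + 1)), 1 / (4 * ((n : ℝ) + 1)), by positivity,
      one_div_lt_one_div_of_lt (by positivity) (by linarith [Nat.cast_nonneg (α := ℝ) n])⟩
  have hφ : ∀ n, (φ n).rOut ≤ 1 / 4 := fun n =>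
    one_div_le_one_div_of_le (by norm_num) (by linarith [Nat.cast_nonneg (α := ℝ) n])
  have hφ0 : Tendsto (fun n => (φ n).rOut) atTop (𝓝 0) := by
    have := (tendsto_one_div_add_atTop_nhds_zero_nat (𝕜 := ℝ)).const_mul (1 / 4)
    rw [mul_zero] at this
    refine this.congr fun n => ?_
    simp only [φ]
    field_simp
  have hvi : Integrable v := hv.integrable (by norm_num)
  have hK := fun n => isSmoothKernel_bumpKernel (hφ n)
  have hmeas : ∀ n, AEStronglyMeasurable (smear (bumpKernel (φ n)) v) volume := fun n =>
    (measurable_smear (hK n) hvi).aestronglyMeasurable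
  have hconv : Tendsto (fun n => eLpNorm (smear (bumpKernel (φ n)) v - v) 2 volume) atTop
      (𝓝 0) := by
    rw [ENNReal.tendsto_nhds_zero]
    intro η hη
    have h1 := tendsto_eLpNorm_translate (by norm_num) (by norm_num) hv (0 : E d)
    have h2 := (ENNReal.tendsto_nhds_zero.1 h1) η hη
    obtain ⟨r, hr, hball⟩ := Metric.eventually_nhds_iff.1 h2
    filter_upwards [hφ0.eventually_lt_const hr] with n hn
    refine eLpNorm_smear_bumpKernel_sub_le hv fun z hz => ?_
    have := hball (y := z) (by rw [dist_zero_right]; exact hz.trans hn)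
    have h0 : toTorus (0 : E d) = 0 := by ext i; simp [toTorus]
    simpa [h0] using this
  refine eLpNorm_le_of_tendstoInMeasure (u := atTop) (Eventually.of_forall fun n => ?_)
    (tendstoInMeasure_of_tendsto_eLpNorm (by norm_num) hmeas hv.1 hconv) hmeas
  refine (hC _ (smoothOnTorus_smear (hK n) hvi) fun j =>
    (measurable_partialDeriv_smear (hK n) hvi j).aestronglyMeasurable).trans ?_
  gcongr with j
  · exact eLpNorm_smear_bumpKernel_le _ hv.1
  · rw [show partialDeriv j (smear (bumpKernel (φ n)) v) = _ from funext fun x =>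
      partialDeriv_smear_bumpKernel (hφ n) hvi hH ((hHj j).integrable (by norm_num)) x]
    exact eLpNorm_smear_bumpKernel_le _ (hHj j).1

lemma lintegral_enorm_pow_three_le {F' : Type*} [NormedAddCommGroup F'] {v : Torus d → F'}
    (hv : AEStronglyMeasurable v volume) :
    ∫⁻ x, ‖v x‖ₑ ^ 3 ≤ eLpNorm v 2 volume * eLpNorm v 4 volume ^ 2 := by
  have h := lintegral_enorm_mul_le_eLpNorm_two hv (hv.norm.pow 2)
  have e : eLpNorm (fun x => ‖v x‖ ^ 2) 2 volume = eLpNorm v 4 volume ^ 2 := by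
    have := eLpNorm_norm_rpow (p := 2) (μ := volume) v (q := 2) (by norm_num)
    rw [show (2 : ℝ≥0∞) * ENNReal.ofReal 2 = 4 by norm_num] at this
    exact_mod_cast this
  refine le_trans (le_of_eq (lintegral_congr fun x => ?_)) (h.trans_eq ?_)
  · simp [pow_succ, mul_assoc]
  · rw [← e]; rfl

lemma add_sum_sq_le (a : ℝ≥0∞) (b : Fin d → ℝ≥0∞) :
    (a + ∑ j, b j) ^ 2 ≤ 2 * (a ^ 2 + d * ∑ j, b j ^ 2) := by
  have h1 := ENNReal.rpow_add_le_mul_rpow_add_rpow a (∑ j, b j) (p := 2) (by norm_num)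
  have h2 := ENNReal.rpow_sum_le_const_mul_sum_rpow Finset.univ b (p := 2) (by norm_num)
  norm_num at h1 h2
  exact h1.trans (by gcongr)

/-- In dimension at most four every Leray–Hopf solution is in `L³` of space-time. -/
lemma IsLerayHopfWith.memLp_three (hd : 2 ≤ d) (hd4 : d ≤ 4) {ν : ℝ} {u₀ : Torus d → E d}
    {f u : ℝ → Torus d → E d} {G : ℝ → Torus d → Fin d → E d} (h : IsLerayHopfWith ν u₀ f u G) :
    MemLp (fun z : ℝ × Torus d => u z.1 z.2) 3 (spaceTime d) := by
  obtain ⟨C, hC⟩ := exists_sobolev hd hd4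
  obtain ⟨M, hM⟩ := h.bounded
  refine ⟨h.meas, ?_⟩
  have hroot : ∀ (a : ℝ≥0∞) (n : ℕ), n ≠ 0 → a ^ n < ⊤ → a < ⊤ := fun a n hn ha =>
    (ENNReal.pow_lt_top_iff.1 ha).resolve_right hn
  have hfin : ∀ g : ℝ × Torus d → E d, MemLp g 2 (spaceTime d) →
      ∫⁻ t, eLpNorm (fun x => g (t, x)) 2 volume ^ 2 ∂timeMeasure < ⊤ := by
    intro g hg
    simp_rw [← lintegral_enorm_sq]
    rw [← lintegral_prod _ (hg.1.enorm.pow_const 2)]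
    have := ENNReal.pow_lt_top (n := 2) hg.2
    rwa [← lintegral_enorm_sq] at this
  have hma : AEMeasurable (fun t => eLpNorm (u t) 2 volume) timeMeasure :=
    aemeasurable_eLpNorm_two_slice (μ := timeMeasure) (ν := (volume : Measure (Torus d)))
      (g := fun q : ℝ × Torus d => u q.1 q.2) h.meas
  have hmb : ∀ j, AEMeasurable (fun t => eLpNorm (fun x => G t x j) 2 volume) timeMeasure :=
    fun j => aemeasurable_eLpNorm_two_slice (μ := timeMeasure) (ν := (volume : Measure (Torus d)))
      (g := fun q : ℝ × Torus d => G q.1 q.2 j) (h.grad_memLp j).1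
  have hS : ∫⁻ t, 2 * (eLpNorm (u t) 2 volume ^ 2
      + d * ∑ j, eLpNorm (fun x => G t x j) 2 volume ^ 2) ∂timeMeasure < ⊤ := by
    rw [lintegral_const_mul' _ _ (by norm_num), lintegral_add_left' (hma.pow_const 2),
      lintegral_const_mul' _ _ (ENNReal.natCast_ne_top d),
      lintegral_finsetSum' _ fun j _ => (hmb j).pow_const 2]
    exact ENNReal.mul_lt_top (by norm_num) (ENNReal.add_lt_top.2 ⟨hfin (fun z => u z.1 z.2) h.memLp_spaceTime,
      ENNReal.mul_lt_top (ENNReal.natCast_lt_top d)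
        (ENNReal.sum_lt_top.2 fun j _ => hfin (fun z => G z.1 z.2 j) (h.grad_memLp j))⟩)
  refine hroot _ 3 three_ne_zero ?_
  rw [← lintegral_enorm_pow_three, spaceTime,
    lintegral_prod _ (h.meas.enorm.pow_const 3)]
  have hgrad : ∀ᵐ t ∂timeMeasure, ∀ j, MemLp (fun x => G t x j) 2 volume :=
    ae_all_iff.2 fun j => h.memLp_gradient j
  calc _ ≤ ∫⁻ t, (M * C ^ 2 : ℝ≥0) * (2 * (eLpNorm (u t) 2 volume ^ 2
      + d * ∑ j, eLpNorm (fun x => G t x j) 2 volume ^ 2)) ∂timeMeasure := by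
        refine lintegral_mono_ae ?_
        filter_upwards [hgrad, h.grad, ae_mem_Icc_timeMeasure] with t h1 h2 h3
        refine (lintegral_enorm_pow_three_le (h.memLp t h3).1).trans ?_
        push_cast
        rw [mul_assoc]
        refine mul_le_mul' (hM t h3) ((pow_le_pow_left' (hC _ _ (h.memLp t h3) h2 h1) 2).trans ?_)
        rw [mul_pow]
        exact mul_le_mul' le_rfl (add_sum_sq_le _ _)
    _ < ⊤ := by
        rw [lintegral_const_mul' _ _ ENNReal.coe_ne_top]
        exact ENNReal.mul_lt_top ENNReal.coe_lt_top hS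

/-- The third-order increment is integrable over time, space and directions. -/
lemma integrable_increment3_timeSpaceSphere (k : Kind) {u : ℝ → Torus d → E d}
    (hu : MemLp (fun z : ℝ × Torus d => u z.1 z.2) 3 (spaceTime d)) (ℓ : ℝ) :
    Integrable
      (fun z : ℝ × Torus d × Metric.sphere (0 : E d) 1 => increment3 k (u z.1) ℓ z.2.1 z.2.2)
      (timeMeasure.prod (volume.prod (sphereMeasure d))) := by
  have h := integrable_increment3 k hu ℓ
  exact ((measurePreserving_prodAssoc timeMeasure (volume : Measure (Torus d))
    (sphereMeasure d)).symm _).integrable_comp_of_integrable h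

end NSLaws

end

open NSLaws
theorem corollary1p6 (d : ℕ) (hd : 2 ≤ d)
    (u₀ : Torus d → E d) (hu₀ : MemLp u₀ 2 volume)
    -- `u ν` is the velocity and `f ν` the force at viscosity `ν`
    (u f : ℝ → ℝ → Torus d → E d)
    (hLH : ∀ ν ∈ Ioo (0 : ℝ) 1, IsLerayHopf ν u₀ (f ν) (u ν))
    -- in dimension at most four this holds for every Leray–Hopf solution
    (hL3 : 5 ≤ d → ∀ ν ∈ Ioo (0 : ℝ) 1,
      MemLp (fun z : ℝ × Torus d => u ν z.1 z.2) 3 (spaceTime d))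
    (α : ℝ) (hα : α ∈ Ioo (0 : ℝ) 1)
    (hBesov : ∃ M : ℝ≥0, ∀ ν ∈ Ioo (0 : ℝ) 1, normLqBesov 2 α (u ν) ≤ M)
    (L : ℝ) (hL : L < 1 / (2 * (1 - α))) :
    -- the structure functions are given by absolutely convergent integrals
    (∀ k : Kind, ∀ ν ∈ Ioo (0 : ℝ) 1, ∀ ℓ : ℝ, 0 < ℓ →
      Integrable
        (fun z : ℝ × Torus d × Metric.sphere (0 : E d) 1 =>
          increment3 k (u ν z.1) ℓ z.2.1 z.2.2)
        (timeMeasure.prod (volume.prod (sphereMeasure d)))) ∧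
    -- convergence in `L^p` in time
    (∀ σ : ℝ, 0 < σ →
      (∃ M : ℝ≥0, ∀ ν ∈ Ioo (0 : ℝ) 1, normLqL2 (ENNReal.ofReal (1 + σ)) (f ν) ≤ M) →
      ∀ k : Kind, ∀ p : ℝ, 1 ≤ p →
        Tendsto
          (fun ℓI : ℝ =>
            limsup
              (fun ν : ℝ => ⨆ ℓ ∈ Icc (ν ^ L) ℓI,
                ∫⁻ t in Icc (0 : ℝ) 1, ENNReal.ofReal (|lawDefect k u₀ (f ν) (u ν) ℓ t| ^ p))
              (𝓝[>] (0 : ℝ)))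
          (𝓝[>] (0 : ℝ)) (𝓝 0)) ∧
    -- uniform convergence in time
    (∀ αbar : ℝ, αbar ∈ Ioo (0 : ℝ) 1 →
      (∃ M : ℝ≥0, ∀ ν ∈ Ioo (0 : ℝ) 1, normLqBesov ⊤ αbar (u ν) ≤ M) →
      (∃ M : ℝ≥0, ∀ ν ∈ Ioo (0 : ℝ) 1, normLqL2 1 (f ν) ≤ M) →
      ∀ k : Kind,
        Tendsto
          (fun ℓI : ℝ =>
            limsup
              (fun ν : ℝ => ⨆ ℓ ∈ Icc (ν ^ L) ℓI, ⨆ t ∈ Icc (0 : ℝ) 1,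
                ENNReal.ofReal |lawDefect k u₀ (f ν) (u ν) ℓ t|)
              (𝓝[>] (0 : ℝ)))
          (𝓝[>] (0 : ℝ)) (𝓝 0)) := by
  have h3 : ∀ ν ∈ Ioo (0 : ℝ) 1,
      MemLp (fun z : ℝ × Torus d => u ν z.1 z.2) 3 (spaceTime d) := fun ν hν => by
    rcases le_or_gt 5 d with h5 | h5
    · exact hL3 h5 ν hν
    · obtain ⟨G, hG⟩ := hLH ν hν
      exact hG.memLp_three hd (by omega)
  obtain ⟨M, hM⟩ := hBesov
  refine ⟨fun k ν hν ℓ _ => integrable_increment3_timeSpaceSphere k (h3 ν hν) ℓ, ?_, ?_⟩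
  · rintro σ hσ ⟨A, hA⟩ k p hp
    exact tendsto_lawDefect_Lp hd hu₀ hLH h3 hα hM hL hσ hA k hp
  · rintro β hβ ⟨B, hB⟩ ⟨A, hA⟩ k
    exact tendsto_lawDefect_uniform hd hu₀ hLH h3 hα hM hL hβ.1 hB hA k
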